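/- Let $m\ge 1$, $m+3<p<\infty$, and let $\Sigma\subset\mathbb R^{m+1}$ be a compact embedded real analytic hypersurface without boundary. Fix a finite real analytic atlas $(\mathsf O_\kappa,\varphi_\kappa)_{\kappa}$ of $\Sigma$ with $\varphi_\kappa(\mathsf O_\kappa)=\mathsf Q^m:=(-1,1)^m$ whose transition maps have bounded derivatives of every order. For real-valued functions and $s\ge 0$, $W^s_p(\Sigma)$ consists of all $u$ with $u\circ\varphi_\kappa^{-1}\in W^s_p(\mathsf Q^m)$ for all $\kappa$, normed by $\sum_\kappa\|u\circ\varphi_\kappa^{-1}\|_{W^s_p(\mathsf Q^m)}$, and $L_p(\Sigma):=W^0_p(\Sigma)$. All spaces $W^s_p$ of non-integer order $s>0$ (on $\mathsf Q^m$, and on time intervals with values in $L_p(\Sigma)$) carry their intrinsic Slobodeckii norms. For $T>0$ and $J=[0,T]$ set \begin{align*} \mathbb F_2(J)&:=W^{1-1/(2p)}_p(J;L_p(\Sigma))\cap L_p(J;W^{2-1/p}_p(\Sigma)),\\ \mathbb F_3(J)&:=W^{1/2-1/(2p)}_p(J;L_p(\Sigma))\cap L_p(J;W^{1-1/p}_p(\Sigma)),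 \end{align*} normed by the sum of the two norms, and let ${}_0\mathbb F_j(J)$ be the subspace of those $v\in\mathbb F_j(J)$ whose time trace $v(0)$ vanishes, i.e. whose representative in $C(J;L_p(\Sigma))$ vanishes at $t=0$, with the norm of $\mathbb F_j(J)$. Then there is a constant $C_0$, depending on $m$, $p$, $\Sigma$ and the atlas but not on $T$, such that for every $T>0$: (a) for $j=2,3$ and all $(v_1,v_2)\in\mathbb F_j(J)\times{}_0\mathbb F_j(J)$, $v_1$ has a continuous representative on $J\times\Sigma$, $v_1v_2\in\mathbb F_j(J)$, and $$\|v_1v_2\|_{\mathbb F_j(J)}\le C_0\big(\|v_1\|_{C(J\times\Sigma)}+\|v_1\|_{\mathbb F_j(J)}\big)\|v_2\|_{\mathbb F_j(J)};$$ (b) for $j=2,3$ and all $v_1,v_2\in{}_0\mathbb F_j(J)$, $v_1v_2\in{}_0\mathbb F_j(J)$ and $$\|v_1v_2\|_{{}_0\mathbb F_j(J)}\le C_0\|v_1\|_{{}_0\mathbb F_j(J)}\|v_2\|_{{}_0\mathbb F_j(J)};$$ (c) for all $(v_1,v_2)\in\mathbb F_3(J)\times{}_0\mathbb F_2(J)$,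 $v_1v_2\in\mathbb F_3(J)$ and $$\|v_1v_2\|_{\mathbb F_3(J)}\le C_0\|v_1\|_{\mathbb F_3(J)}\|v_2\|_{{}_0\mathbb F_2(J)}.$$ -/

import Mathlib

open MeasureTheory Set Filter Topology
open scoped ENNReal NNReal ContDiff

namespace StefanTrace

noncomputable section

/-- The Euclidean space of dimension `n`. -/
abbrev Euc (n : ℕ) : Type := EuclideanSpace ℝ (Fin n)

/-- The open cube `(-1, 1)^m`. -/
def cube (m : ℕ) : Set (Euc m) := {x | ∀ i, x i ∈ Ioo (-1 : ℝ) 1}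

/-- Lebesgue measure on the cube. -/
def cubeMeasure (m : ℕ) : Measure (Euc m) := volume.restrict (cube m)

/-- Lebesgue measure on the time interval `J = [0, T]`. -/
def timeMeasure (T : ℝ) : Measure ℝ := volume.restrict (Icc 0 T)

/-! ### Function spaces on the cube -/

/-- `g` is the weak partial derivative `∂ᵢ u` on the cube. -/
structure IsWeakPartial {m : ℕ} (i : Fin m) (u g : Euc m → ℝ) : Prop where
  locInt : LocallyIntegrableOn u (cube m) volume
  locInt_deriv : LocallyIntegrableOn g (cube m) volume
  integral_eq : ∀ φ : Euc m → ℝ, ContDiff ℝ ∞ φ → HasCompactSupport φ → tsupport φ ⊆ cube m →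
    ∫ x in cube m, u x * fderiv ℝ φ x (EuclideanSpace.single i 1) = - ∫ x in cube m, g x * φ x

/-- The `L_p`-norm on the cube. -/
def cubeLp {m : ℕ} (p : ℝ) (u : Euc m → ℝ) : ℝ≥0∞ :=
  eLpNorm u (ENNReal.ofReal p) (cubeMeasure m)

/-- The Slobodeckii seminorm of order `s ∈ (0, 1)` on the cube. -/
def cubeSeminorm {m : ℕ} (p s : ℝ) (u : Euc m → ℝ) : ℝ≥0∞ :=
  (∫⁻ x, ∫⁻ y, ‖u x - u y‖ₑ ^ p / ‖x - y‖ₑ ^ ((m : ℝ) + s * p)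
    ∂(cubeMeasure m) ∂(cubeMeasure m)) ^ (1 / p)

/-- The norm of `W^s_p` on the cube, for `s ∈ (0, 1)`. -/
def cubeW {m : ℕ} (p s : ℝ) (u : Euc m → ℝ) : ℝ≥0∞ :=
  cubeLp p u + cubeSeminorm p s u

/-- The norm of `W^{1+s}_p` on the cube, for `s ∈ (0, 1)`. Weak partial derivatives are unique
up to null sets, so the infimum runs over at most one value; it is `∞` if `u` has no weak
gradient. -/
def cubeW1 {m : ℕ} (p s : ℝ) (u : Euc m → ℝ) : ℝ≥0∞ :=
  ⨅ (g : Fin m → Euc m → ℝ) (_ : ∀ i, IsWeakPartial i u (g i)),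
    cubeLp p u + ∑ i, cubeLp p (g i) + ∑ i, cubeSeminorm p s (g i)

/-! ### Vector-valued function spaces in time -/

/-- The norm of `L_p(J; X)`, `J = [0, T]`, where `N` is the norm of the function space `X`. -/
def timeLp {X : Type*} (p T : ℝ) (N : (X → ℝ) → ℝ≥0∞) (v : ℝ → X → ℝ) : ℝ≥0∞ :=
  (∫⁻ t, N (v t) ^ p ∂(timeMeasure T)) ^ (1 / p)

/-- The Slobodeckii seminorm of `W^s_p(J; X)`, `J = [0, T]`, `s ∈ (0, 1)`. -/
def timeSeminorm {X : Type*} (p s T : ℝ) (N : (X → ℝ) → ℝ≥0∞) (v : ℝ → X → ℝ) : ℝ≥0∞ :=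
  (∫⁻ t, ∫⁻ r, N (v t - v r) ^ p / ‖t - r‖ₑ ^ (1 + s * p)
    ∂(timeMeasure T) ∂(timeMeasure T)) ^ (1 / p)

/-- The norm of `W^s_p(J; X)`, `J = [0, T]`, `s ∈ (0, 1)`. -/
def timeW {X : Type*} (p s T : ℝ) (N : (X → ℝ) → ℝ≥0∞) (v : ℝ → X → ℝ) : ℝ≥0∞ :=
  timeLp p T N v + timeSeminorm p s T N v

/-! ### The hypersurface -/

/-- A finite normalized real analytic atlas of an embedded `m`-dimensional hypersurface
`S` of `ℝ^{m+1}` without boundary: every chart maps a relatively open subset of `S`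
homeomorphically onto the cube, its inverse is a real analytic immersion, and the transition maps
are real analytic with bounded derivatives of every order. -/
structure NormalizedAtlas (m : ℕ) (S : Set (Euc (m + 1))) (ι : Type*) where
  chart : ι → OpenPartialHomeomorph S (Euc m)
  target_eq : ∀ κ, (chart κ).target = cube m
  covers : ∀ x : S, ∃ κ, x ∈ (chart κ).source
  analytic : ∀ κ, AnalyticOnNhd ℝ (fun x => ((chart κ).symm x : Euc (m + 1))) (cube m)
  immersion : ∀ κ, ∀ x ∈ cube m,
    Function.Injective (fderiv ℝ (fun x => ((chart κ).symm x : Euc (m + 1))) x)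
  transition_analytic : ∀ κ κ', AnalyticOnNhd ℝ ((chart κ).symm.trans (chart κ'))
    ((chart κ).symm.trans (chart κ')).source
  transition_bounded : ∀ κ κ' (n : ℕ), ∃ C : ℝ, ∀ x ∈ ((chart κ).symm.trans (chart κ')).source,
    ‖iteratedFDeriv ℝ n ((chart κ).symm.trans (chart κ')) x‖ ≤ C

variable {m : ℕ} {S : Set (Euc (m + 1))} {ι : Type*} [Fintype ι]

/-- The pull-back of a function on `S` to the cube by the inverse of a chart. -/
def pull (A : NormalizedAtlas m S ι) (κ : ι) (u : S → ℝ) : Euc m → ℝ :=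
  fun x => u ((A.chart κ).symm x)

/-- The norm on `S` obtained by summing a norm on the cube over the charts. -/
def surfaceNorm (A : NormalizedAtlas m S ι) (N : (Euc m → ℝ) → ℝ≥0∞) (u : S → ℝ) : ℝ≥0∞ :=
  ∑ κ, N (pull A κ u)

/-- The norm of `L_p(S)`. -/
def surfaceLp (A : NormalizedAtlas m S ι) (p : ℝ) : (S → ℝ) → ℝ≥0∞ :=
  surfaceNorm A (cubeLp p)

/-- Equality almost everywhere on `J × S`. -/
def AEEqOn (A : NormalizedAtlas m S ι) (T : ℝ) (v w : ℝ → S → ℝ) : Prop :=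
  ∀ κ, ∀ᵐ z ∂((timeMeasure T).prod (cubeMeasure m)), pull A κ (v z.1) z.2 = pull A κ (w z.1) z.2

/-- Measurability (up to null sets) on `J × S`. -/
def AEMeasOn (A : NormalizedAtlas m S ι) (T : ℝ) (v : ℝ → S → ℝ) : Prop :=
  ∀ κ, AEStronglyMeasurable (fun z : ℝ × Euc m => pull A κ (v z.1) z.2)
    ((timeMeasure T).prod (cubeMeasure m))

/-! ### The trace spaces -/

/-- The norm of `𝔽₂(J) = W^{1-1/(2p)}_p(J; L_p(S)) ∩ L_p(J; W^{2-1/p}_p(S))`. -/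
def normF2 (A : NormalizedAtlas m S ι) (p T : ℝ) (v : ℝ → S → ℝ) : ℝ≥0∞ :=
  timeW p (1 - 1 / (2 * p)) T (surfaceLp A p) v
    + timeLp p T (surfaceNorm A (cubeW1 p (1 - 1 / p))) v

/-- The norm of `𝔽₃(J) = W^{1/2-1/(2p)}_p(J; L_p(S)) ∩ L_p(J; W^{1-1/p}_p(S))`. -/
def normF3 (A : NormalizedAtlas m S ι) (p T : ℝ) (v : ℝ → S → ℝ) : ℝ≥0∞ :=
  timeW p (1 / 2 - 1 / (2 * p)) T (surfaceLp A p) v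
    + timeLp p T (surfaceNorm A (cubeW p (1 - 1 / p))) v

/-- `v ∈ 𝔽₂(J)`. The field `grad` expresses the measurability of `v` as a function of time with
values in `W^{2-1/p}_p(S)`. -/
structure MemF2 (A : NormalizedAtlas m S ι) (p T : ℝ) (v : ℝ → S → ℝ) : Prop where
  meas : AEMeasOn A T v
  grad : ∀ κ i, ∃ g : ℝ × Euc m → ℝ,
    AEStronglyMeasurable g ((timeMeasure T).prod (cubeMeasure m)) ∧
    ∀ᵐ t ∂(timeMeasure T), IsWeakPartial i (pull A κ (v t)) (fun x => g (t, x))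
  norm_lt_top : normF2 A p T v < ⊤

/-- `v ∈ 𝔽₃(J)`. -/
structure MemF3 (A : NormalizedAtlas m S ι) (p T : ℝ) (v : ℝ → S → ℝ) : Prop where
  meas : AEMeasOn A T v
  norm_lt_top : normF3 A p T v < ⊤

/-- The time trace of `v` at `t = 0` exists and vanishes: `v` has a representative `w` in
`C(J; L_p(S))` with `w(0) = 0`. -/
def ZeroTrace (A : NormalizedAtlas m S ι) (p T : ℝ) (v : ℝ → S → ℝ) : Prop :=
  ∃ w : ℝ → S → ℝ,
    (∀ t ∈ Icc 0 T, (∀ κ, AEStronglyMeasurable (pull A κ (w t)) (cubeMeasure m)) ∧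
      surfaceLp A p (w t) < ⊤) ∧
    (∀ t ∈ Icc 0 T, Tendsto (fun r => surfaceLp A p (w r - w t)) (𝓝[Icc 0 T] t) (𝓝 0)) ∧
    AEEqOn A T v w ∧ surfaceLp A p (w 0) = 0

/-- `v ∈ ₀𝔽₂(J)`. -/
def MemF2Zero (A : NormalizedAtlas m S ι) (p T : ℝ) (v : ℝ → S → ℝ) : Prop :=
  MemF2 A p T v ∧ ZeroTrace A p T v

/-- `v ∈ ₀𝔽₃(J)`. -/
def MemF3Zero (A : NormalizedAtlas m S ι) (p T : ℝ) (v : ℝ → S → ℝ) : Prop :=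
  MemF3 A p T v ∧ ZeroTrace A p T v

/-- `w` is the continuous representative of `v` on `J × S`. -/
def IsContRep (A : NormalizedAtlas m S ι) (T : ℝ) (v w : ℝ → S → ℝ) : Prop :=
  ContinuousOn (fun z : ℝ × S => w z.1 z.2) (Icc 0 T ×ˢ univ) ∧ AEEqOn A T v w

/-- The norm of `C(J × S)`. -/
def supNorm (S : Set (Euc (m + 1))) (T : ℝ) (w : ℝ → S → ℝ) : ℝ≥0∞ :=
  ⨆ t ∈ Icc (0 : ℝ) T, ⨆ x : S, ‖w t x‖ₑ

end

end StefanTrace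

/-! Put `s = 1 - 1/p`. In a chart, the third trace space has `s/2` derivatives in time and `s` in
space, the second one `(1+s)/2` in time and `1+s` in space. Products are handled through `uv - u'v'
= u(v - v') + v'(u - u')`, so everything reduces to sup bounds for the factors, and for the second
space also for a spatial gradient, with constants that do not see `T`.

The sup bounds come from a telescoped Morrey inequality. Averages of a pseudo-metric against bounded
probability kernels at scales `r/2^j` change from one scale to the next by at most a multiple of
`(r/2^j)^(σ - n/p)` times the Slobodeckii functional (`IsKernel.pair_le`), and the sum converges
when `σ > n/p` (`average_dist_le_morrey`). In space this bounds `u` by its seminorm and its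
`L_p`-norm with a free scale `ε`; for a weak derivative the average is moved onto the kernel, at the
price of one more power `1/ε` (`exists_const_ae_enorm_le`, `exists_const_ae_enorm_weakPartial_le`).
In time the telescoping is run on the sup-distance of two time slices, with the parabolic coupling
`ε = √h` (`exists_const_time_average_le`). The exponents balance precisely when `1/p < (s - m/p)/2`,
that is, `p > m + 3`.

Independence of `T` is the delicate point. The bound at time scale `h = min 1 T` contains the
`L_p`-norm of a slice times the negative power `h^(-β/2)`. For short intervals this is compensated
by the vanishing trace, since Hölder continuity in time gives `‖v(t)‖ ≤ C t^(θ - 1/p)`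
(`exists_const_slice_le_of_zeroTrace`, `exists_const_sup_le`). A factor without vanishing trace has
no such bound: in (a) its sup norm appears explicitly, and in (c) only its sup norm in `L_p` over
time is used, paired with the Hölder continuity of the other factor, whose order exceeds `s/2`
(`exists_const_tSem_holder_le`, `exists_const_cylNorm_mul_le`).

In the second space the gradient of the product contains `v₂ ∇v₁`, and `∇v₁` has no uniform bound.
Its seminorm is estimated with `v₂` Lipschitz in space, so that only `L_p`-type norms of `∇v₁` enter
(`exists_const_gradNorm_mul_le`).

The kernels in space and in time are contracted so that they stay inside the cube and inside `[0,
T]`; no extension operator is needed. Estimates on the surface follow by summing over charts, and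
continuous representatives are glued because transition maps respect null sets. -/

namespace StefanTrace

/-! ### Averages against kernels -/

section Kernels

variable {X : Type*} [MeasurableSpace X]

/-- A weighted Hölder inequality. -/
theorem lintegral_mul_le_mass_mul {μ : Measure X} {p : ℝ} (hp : 1 ≤ p) {k f : X → ℝ≥0∞}
    (hk : AEMeasurable k μ) (hf : AEMeasurable f μ) :
    ∫⁻ z, k z * f z ∂μ ≤
      (∫⁻ z, k z ∂μ) ^ (1 - 1 / p) * (∫⁻ z, k z * f z ^ p ∂μ) ^ (1 / p) := by
  rcases hp.eq_or_lt with rfl | hp1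
  · simp
  have hp0 : 0 < p := by linarith
  have hc : (p / (p - 1)).HolderConjugate p := (Real.HolderConjugate.conjExponent hp1).symm
  have h1 : 0 ≤ 1 - 1 / p := by
    rw [sub_nonneg, div_le_one hp0]; exact hp
  have hq : 1 / (p / (p - 1)) = 1 - 1 / p := by field_simp
  have key := ENNReal.lintegral_mul_le_Lp_mul_Lq μ hc (hk.pow_const (1 - 1 / p))
    ((hk.pow_const (1 / p)).mul hf)
  have e1 : ∀ z, k z ^ (1 - 1 / p) * (k z ^ (1 / p) * f z) = k z * f z := fun z => by
    rw [← mul_assoc, ← ENNReal.rpow_add_of_nonneg _ _ h1 (by positivity)]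
    simp
  have e2 : ∀ z, (k z ^ (1 - 1 / p)) ^ (p / (p - 1)) = k z := fun z => by
    rw [← ENNReal.rpow_mul, ← hq, one_div_mul_cancel (by have : p - 1 ≠ 0 := by linarith
                                                         positivity)]
    simp
  have e3 : ∀ z, (k z ^ (1 / p) * f z) ^ p = k z * f z ^ p := fun z => by
    rw [ENNReal.mul_rpow_of_nonneg _ _ hp0.le, ← ENNReal.rpow_mul, one_div_mul_cancel hp0.ne']
    simp
  simp only [Pi.mul_apply, e1, e2, e3, hq] at key
  exact key

variable [PseudoEMetricSpace X]

/-- `k` is a probability density around `x`, bounded by `K` and supported in the ball of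
radius `ρ`. -/
structure IsKernel (μ : Measure X) (x : X) (K ρ : ℝ≥0∞) (k : X → ℝ≥0∞) : Prop where
  meas : Measurable k
  mass : ∫⁻ z, k z ∂μ = 1
  le : ∀ z, k z ≤ K
  supp : ∀ z, k z ≠ 0 → edist x z ≤ ρ

namespace IsKernel

variable {μ : Measure X} {x x' : X} {K K' ρ ρ' : ℝ≥0∞} {k k' : X → ℝ≥0∞} {p e : ℝ}

theorem lintegral_mul_const (hk : IsKernel μ x K ρ k) (c : ℝ≥0∞) : ∫⁻ z, k z * c ∂μ = c := by
  rw [MeasureTheory.lintegral_mul_const _ hk.meas, hk.mass, one_mul]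

theorem jensen (hk : IsKernel μ x K ρ k) (hp : 1 ≤ p) {f : X → ℝ≥0∞} (hf : AEMeasurable f μ) :
    ∫⁻ z, k z * f z ∂μ ≤ (∫⁻ z, k z * f z ^ p ∂μ) ^ (1 / p) := by
  simpa [hk.mass] using lintegral_mul_le_mass_mul hp hk.meas.aemeasurable hf

theorem jensen_rpow (hk : IsKernel μ x K ρ k) (hp : 1 ≤ p) {f : X → ℝ≥0∞}
    (hf : AEMeasurable f μ) :
    (∫⁻ z, k z * f z ∂μ) ^ p ≤ ∫⁻ z, k z * f z ^ p ∂μ := by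
  have hp0 : 0 < p := by linarith
  calc _ ≤ ((∫⁻ z, k z * f z ^ p ∂μ) ^ (1 / p)) ^ p :=
        ENNReal.rpow_le_rpow (hk.jensen hp hf) hp0.le
    _ = _ := by rw [← ENNReal.rpow_mul, one_div_mul_cancel hp0.ne', ENNReal.rpow_one]

/-- Averages are controlled by the `L_p`-norm. -/
theorem lintegral_le_Lp (hk : IsKernel μ x K ρ k) (hp : 1 ≤ p) {f : X → ℝ≥0∞}
    (hf : AEMeasurable f μ) :
    ∫⁻ z, k z * f z ∂μ ≤ (K * ∫⁻ z, f z ^ p ∂μ) ^ (1 / p) := by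
  refine (hk.jensen hp hf).trans (ENNReal.rpow_le_rpow ?_ (by positivity))
  rw [← lintegral_const_mul'' _ (hf.pow_const p)]
  exact lintegral_mono fun z => mul_le_mul_left (hk.le z) _

/-- On the support of the kernel the factor `(ρ' / edist y z) ^ e` is at least one. This is how a
bounded kernel is exchanged for the Slobodeckii weight. The reference point `y` need not be the
centre of the kernel. -/
theorem mul_rpow_le (hk : IsKernel μ x K ρ k) (he : 0 ≤ e)
    {y z : X} (hy : k z ≠ 0 → edist y z ≤ ρ') (hρ1 : ρ' ≠ 0) (hρ2 : ρ' ≠ ⊤) (a : ℝ≥0∞) :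
    k z * a ≤ K * ρ' ^ e * (a / edist y z ^ e) := by
  by_cases h0 : k z = 0
  · simp [h0]
  have h1 : ρ' ^ e ≠ 0 := by simp [ENNReal.rpow_eq_zero_iff, hρ1, hρ2]
  have h2 : ρ' ^ e ≠ ⊤ := ENNReal.rpow_ne_top_of_nonneg he hρ2
  calc k z * a ≤ K * a := mul_le_mul_left (hk.le z) _
    _ = K * (ρ' ^ e * (a / ρ' ^ e)) := by rw [ENNReal.mul_div_cancel h1 h2]
    _ ≤ K * (ρ' ^ e * (a / edist y z ^ e)) := by
        gcongr
        exact hy h0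
    _ = _ := by rw [mul_assoc]

/-- Averages of distances are controlled by the pointwise Slobodeckii functional. -/
theorem lintegral_dist_le (hk : IsKernel μ x K ρ k) (hp : 1 ≤ p) (he : 0 ≤ e) (hρ : ρ ≠ 0)
    (hρ' : ρ ≠ ⊤) {f : X → ℝ≥0∞} (hf : AEMeasurable f μ)
    (hm : AEMeasurable (fun z => f z ^ p / edist x z ^ e) μ) :
    ∫⁻ z, k z * f z ∂μ ≤ (K * ρ ^ e * ∫⁻ z, f z ^ p / edist x z ^ e ∂μ) ^ (1 / p) := by
  refine (hk.jensen hp hf).trans (ENNReal.rpow_le_rpow ?_ (by positivity))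
  rw [← lintegral_const_mul'' _ hm]
  exact lintegral_mono fun z => hk.mul_rpow_le he (hk.supp z) hρ hρ' _

/-- The averaged triangle inequality. -/
theorem average_triangle [SFinite μ] (hk : IsKernel μ x K ρ k) (hk' : IsKernel μ x' K' ρ' k')
    {d : X → X → ℝ≥0∞} (hd : Measurable (Function.uncurry d))
    (htri : ∀ a b c, d a c ≤ d a b + d b c) (hsymm : ∀ a b, d a b = d b a) (y : X) :
    ∫⁻ z, k z * d y z ∂μ ≤ ∫⁻ z, k' z * d y z ∂μ + ∫⁻ z, k z * ∫⁻ z', k' z' * d z z' ∂μ ∂μ := by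
  have hF : Measurable fun z => ∫⁻ z', k' z' * d z z' ∂μ :=
    ((hk'.meas.comp measurable_snd).mul hd).lintegral_prod_right'
  have hy : Measurable (d y) := hd.comp measurable_prodMk_left
  calc ∫⁻ z, k z * d y z ∂μ
      ≤ ∫⁻ z, k z * (∫⁻ z', k' z' * d y z' ∂μ + ∫⁻ z', k' z' * d z z' ∂μ) ∂μ := by
        refine lintegral_mono fun z => mul_le_mul_right ?_ _
        have h := lintegral_add_left (μ := μ) (hk'.meas.mul hy) fun z' => k' z' * d z z'
        simp only [Pi.mul_apply] at h
        -- Because `k'` has mass one, the constant `d y z` is its own average, and the triangle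
        -- inequality through `z'` can be applied under the integral.
        rw [← h, ← hk'.lintegral_mul_const (d y z)]
        refine lintegral_mono fun z' => ?_
        rw [← mul_add]
        exact mul_le_mul_right ((htri y z' z).trans (by rw [hsymm z' z])) _
    _ = _ := by
        simp_rw [mul_add]
        rw [lintegral_add_left (hk.meas.mul_const _), hk.lintegral_mul_const]

end IsKernel

/-- Telescoping over a sequence of kernels with geometrically decaying increments. -/
theorem average_dist_le_of_chain {μ : Measure X} [SFinite μ] {x : X} {K ρ : ℕ → ℝ≥0∞}
    {k : ℕ → X → ℝ≥0∞} (hk : ∀ n, IsKernel μ x (K n) (ρ n) (k n))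
    {d : X → X → ℝ≥0∞} (hd : Measurable (Function.uncurry d))
    (htri : ∀ a b c, d a c ≤ d a b + d b c) (hsymm : ∀ a b, d a b = d b a) {y : X} {c q : ℝ≥0∞}
    (hc : ∀ n, ∫⁻ z, k n z * ∫⁻ z', k (n + 1) z' * d z z' ∂μ ∂μ ≤ c * q ^ n)
    (hlim : Tendsto (fun n => ∫⁻ z, k n z * d y z ∂μ) atTop (𝓝 0)) :
    ∫⁻ z, k 0 z * d y z ∂μ ≤ c * (1 - q)⁻¹ := by
  have h : ∀ N, ∫⁻ z, k 0 z * d y z ∂μ ≤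
      ∫⁻ z, k N z * d y z ∂μ + ∑ n ∈ Finset.range N, c * q ^ n := fun N => by
    induction N with
    | zero => simp
    | succ N ih =>
      refine ih.trans ?_
      rw [Finset.sum_range_succ, add_comm (∑ n ∈ _, _), ← add_assoc]
      gcongr
      exact ((hk N).average_triangle (hk (N + 1)) hd htri hsymm y).trans (by gcongr; exact hc N)
  have h' : ∀ N, ∫⁻ z, k 0 z * d y z ∂μ ≤ ∫⁻ z, k N z * d y z ∂μ + c * (1 - q)⁻¹ := fun N => by
    refine (h N).trans (add_le_add_right ?_ _)
    rw [← ENNReal.tsum_geometric, ← ENNReal.tsum_mul_left]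
    exact ENNReal.sum_le_tsum _
  simpa using ge_of_tendsto' (hlim.add_const (c * (1 - q)⁻¹)) h'

variable [OpensMeasurableSpace X] [SecondCountableTopology X]

theorem measurable_rpow_div_edist {p e : ℝ} {d : X → X → ℝ≥0∞}
    (hd : Measurable (Function.uncurry d)) :
    Measurable (Function.uncurry fun y z => d y z ^ p / edist y z ^ e) :=
  (hd.pow_const p).div (measurable_edist.pow_const e)

namespace IsKernel

variable {μ : Measure X} [SFinite μ] {x x' : X} {K K' ρ ρ' : ℝ≥0∞} {k k' : X → ℝ≥0∞} {p e : ℝ}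

/-- Double averages of distances are controlled by the Slobodeckii functional. -/
theorem lintegral_lintegral_dist_le (hk : IsKernel μ x K ρ k) (hk' : IsKernel μ x' K' ρ' k')
    (hp : 1 ≤ p) (he : 0 ≤ e) (hρ : ρ ≠ 0) (hρ' : ρ ≠ ⊤) (hρ2 : ρ' ≠ ⊤)
    (hx : edist x x' ≠ ⊤)
    {d : X → X → ℝ≥0∞} (hd : Measurable (Function.uncurry d)) :
    ∫⁻ z, k z * ∫⁻ z', k' z' * d z z' ∂μ ∂μ ≤
      (K * K' * (ρ + edist x x' + ρ') ^ e *
        ∫⁻ z, ∫⁻ z', d z z' ^ p / edist z z' ^ e ∂μ ∂μ) ^ (1 / p) := by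
  have hF : Measurable fun z => ∫⁻ z', k' z' * d z z' ∂μ :=
    ((hk'.meas.comp measurable_snd).mul hd).lintegral_prod_right'
  have hm : Measurable (Function.uncurry fun y z => d y z ^ p / edist y z ^ e) :=
    measurable_rpow_div_edist hd
  have hΦ : Measurable fun z => ∫⁻ z', d z z' ^ p / edist z z' ^ e ∂μ := hm.lintegral_prod_right'
  set R := ρ + edist x x' + ρ' with hR
  have hR0 : R ≠ 0 := by simp [hR, hρ]
  have hRt : R ≠ ⊤ := by simp [hR, hρ', hρ2, hx]
  refine (hk.jensen hp hF.aemeasurable).trans (ENNReal.rpow_le_rpow ?_ (by positivity))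
  rw [← lintegral_const_mul _ hΦ]
  refine lintegral_mono fun z => ?_
  by_cases h0 : k z = 0
  · simp [h0]
  have hz := hk.supp z h0
  -- Jensen a second time, now in `z'` for fixed `z`. As `R` dominates `edist z z'` wherever both
  -- kernels live, the weight has to be inserted only once.
  have : (∫⁻ z', k' z' * d z z' ∂μ) ^ p ≤ K' * R ^ e * ∫⁻ z', d z z' ^ p / edist z z' ^ e ∂μ := by
    refine (hk'.jensen_rpow hp (hd.comp measurable_prodMk_left).aemeasurable).trans ?_
    have hmz : Measurable fun z' => d z z' ^ p / edist z z' ^ e := hm.comp measurable_prodMk_left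
    rw [← lintegral_const_mul _ hmz]
    refine lintegral_mono fun z' => hk'.mul_rpow_le he (fun h => ?_) hR0 hRt _
    calc edist z z' ≤ edist z x + edist x x' + edist x' z' := edist_triangle4 _ _ _ _
      _ ≤ R := by rw [edist_comm z x]; exact add_le_add (add_le_add_left hz _) (hk'.supp z' h)
  calc k z * (∫⁻ z', k' z' * d z z' ∂μ) ^ p
      ≤ K * (K' * R ^ e * ∫⁻ z', d z z' ^ p / edist z z' ^ e ∂μ) := mul_le_mul' (hk.le z) this
    _ = _ := by ring

end IsKernel

/-- Double averages at comparable scales. -/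
theorem IsKernel.pair_le {μ : Measure X} [SFinite μ] {x x' : X} {k k' : X → ℝ≥0∞}
    {B R n p σ r r' : ℝ} (hB : 1 ≤ B) (hR : 1 ≤ R) (hn : 0 < n) (hp : 1 ≤ p) (hσ : 0 < σ)
    (hr : 0 < r) (hr' : r / 2 ≤ r') (hr'' : r' ≤ r)
    (hk : IsKernel μ x (.ofReal (B * r ^ (-n))) (.ofReal (R * r)) k)
    (hk' : IsKernel μ x' (.ofReal (B * r' ^ (-n))) (.ofReal (R * r')) k')
    (hx : edist x x' ≤ .ofReal r)
    {d : X → X → ℝ≥0∞} (hd : Measurable (Function.uncurry d)) :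
    ∫⁻ z, k z * ∫⁻ z', k' z' * d z z' ∂μ ∂μ ≤
      .ofReal ((B * B * 2 ^ n * (3 * R) ^ (n + σ * p)) ^ (1 / p) * r ^ (σ - n / p)) *
        (∫⁻ z, ∫⁻ z', d z z' ^ p / edist z z' ^ (n + σ * p) ∂μ ∂μ) ^ (1 / p) := by
  have hp0 : 0 < p := by linarith
  have he : 0 < n + σ * p := by positivity
  have h0 : 0 < R * r := by positivity
  refine (hk.lintegral_lintegral_dist_le hk' hp he.le (by simpa using h0) ENNReal.ofReal_ne_top
    ENNReal.ofReal_ne_top (ne_top_of_le_ne_top ENNReal.ofReal_ne_top hx) hd).trans ?_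
  rw [ENNReal.mul_rpow_of_nonneg _ _ (by positivity)]
  refine mul_le_mul_left ?_ _
  -- Since `R ≥ 1` and `r' ≤ r`, each of the three distances is at most `R * r`.
  have h1 : ENNReal.ofReal (R * r) + edist x x' + ENNReal.ofReal (R * r') ≤
      ENNReal.ofReal (3 * R * r) := by
    calc _ ≤ ENNReal.ofReal (R * r) + ENNReal.ofReal (R * r) + ENNReal.ofReal (R * r) := by
          gcongr
          refine hx.trans (ENNReal.ofReal_le_ofReal (by nlinarith))
      _ = _ := by
          rw [← ENNReal.ofReal_add h0.le h0.le, ← ENNReal.ofReal_add (by positivity) h0.le]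
          ring_nf
  have h2 : r' ^ (-n) ≤ 2 ^ n * r ^ (-n) := by
    calc r' ^ (-n) ≤ (r / 2) ^ (-n) :=
          Real.rpow_le_rpow_of_nonpos (by positivity) hr' (by linarith)
      _ = _ := by
          rw [Real.div_rpow hr.le (by norm_num), Real.rpow_neg (by norm_num : (0:ℝ) ≤ 2), div_inv_eq_mul, mul_comm]
  -- Counting powers of `r`: the two kernel bounds give `-2n`, the weight gives `n + σp`, and the
  -- `p`-th root leaves `σ - n/p`.
  calc _ ≤ (ENNReal.ofReal (B * r ^ (-n)) * ENNReal.ofReal (B * (2 ^ n * r ^ (-n))) *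
        ENNReal.ofReal (3 * R * r) ^ (n + σ * p)) ^ (1 / p) := by gcongr
    _ = ENNReal.ofReal ((B * B * 2 ^ n * (3 * R) ^ (n + σ * p) * (r ^ (-n + -n + (n + σ * p))))
          ^ (1 / p)) := by
        rw [ENNReal.ofReal_rpow_of_pos (by positivity), ← ENNReal.ofReal_mul (by positivity),
          ← ENNReal.ofReal_mul (by positivity), ENNReal.ofReal_rpow_of_pos (by positivity),
          Real.mul_rpow (by positivity) hr.le, Real.rpow_add hr (-n + -n), Real.rpow_add hr (-n) (-n)]
        ring_nf
    _ = _ := by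
        rw [Real.mul_rpow (by positivity) (by positivity), ← Real.rpow_mul hr.le]
        congr 3
        field_simp
        ring

/-- Averages around the centre at scale `r`. -/
theorem IsKernel.center_le {μ : Measure X} {x : X} {k : X → ℝ≥0∞}
    {B R n p σ r : ℝ} (hB : 1 ≤ B) (hR : 1 ≤ R) (hn : 0 < n) (hp : 1 ≤ p) (hσ : 0 < σ)
    (hr : 0 < r)
    (hk : IsKernel μ x (.ofReal (B * r ^ (-n))) (.ofReal (R * r)) k)
    {d : X → X → ℝ≥0∞} (hd : Measurable (Function.uncurry d)) :
    ∫⁻ z, k z * d x z ∂μ ≤ .ofReal ((B * R ^ (n + σ * p)) ^ (1 / p) * r ^ σ) *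
      (∫⁻ z, d x z ^ p / edist x z ^ (n + σ * p) ∂μ) ^ (1 / p) := by
  have hp0 : 0 < p := by linarith
  have he : 0 < n + σ * p := by positivity
  have h0 : 0 < R * r := by positivity
  refine (hk.lintegral_dist_le hp he.le (by simpa using h0) ENNReal.ofReal_ne_top
    (hd.comp measurable_prodMk_left).aemeasurable
    ((measurable_rpow_div_edist hd).comp measurable_prodMk_left).aemeasurable).trans ?_
  rw [ENNReal.mul_rpow_of_nonneg _ _ (by positivity)]
  refine mul_le_mul_left (le_of_eq ?_) _
  rw [ENNReal.ofReal_rpow_of_pos (by positivity), ← ENNReal.ofReal_mul (by positivity),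
    ENNReal.ofReal_rpow_of_pos (by positivity), Real.mul_rpow (by positivity) hr.le]
  have : B * r ^ (-n) * (R ^ (n + σ * p) * r ^ (n + σ * p)) = B * R ^ (n + σ * p) * r ^ (σ * p) := by
    rw [Real.rpow_add hr n, Real.rpow_neg hr.le]
    field_simp
  rw [this, Real.mul_rpow (by positivity) (by positivity), ← Real.rpow_mul hr.le]
  congr 3
  field_simp

theorem ofReal_half_pow_rpow {r a : ℝ} (hr : 0 < r) (C : ℝ) (hC : 0 ≤ C) (n : ℕ) :
    ENNReal.ofReal (C * (r / 2 ^ n) ^ a) =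
      ENNReal.ofReal (C * r ^ a) * ENNReal.ofReal (2 ^ (-a)) ^ n := by
  rw [← ENNReal.ofReal_pow (by positivity), ← ENNReal.ofReal_mul (by positivity),
    Real.div_rpow hr.le (by positivity), ← Real.rpow_natCast, ← Real.rpow_natCast,
    ← Real.rpow_mul (by norm_num), ← Real.rpow_mul (by norm_num), div_eq_mul_inv,
    ← Real.rpow_neg (by norm_num)]
  ring_nf

theorem tendsto_half_pow_rpow {r a : ℝ} (hr : 0 < r) (ha : 0 < a) (C : ℝ) (hC : 0 ≤ C)
    {M : ℝ≥0∞} (hM : M ≠ ⊤) :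
    Tendsto (fun n : ℕ => ENNReal.ofReal (C * (r / 2 ^ n) ^ a) * M) atTop (𝓝 0) := by
  have h1 : ENNReal.ofReal ((2 : ℝ) ^ (-a)) < 1 := by
    rw [ENNReal.ofReal_lt_one]
    exact Real.rpow_lt_one_of_one_lt_of_neg (by norm_num) (by linarith)
  have h2 := ENNReal.tendsto_pow_atTop_nhds_zero_of_lt_one h1
  have h3 := ENNReal.Tendsto.mul_const (ENNReal.Tendsto.const_mul h2
    (Or.inr (ENNReal.ofReal_ne_top (r := C * r ^ a)))) (Or.inr hM)
  simpa [ofReal_half_pow_rpow hr C hC] using h3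

/-- The geometric factor in telescoping sums with decay `2^{-γ}`. -/
noncomputable def geomConst (γ : ℝ) : ℝ≥0∞ := (1 - ENNReal.ofReal (2 ^ (-γ)))⁻¹

theorem geomConst_ne_top {γ : ℝ} (hγ : 0 < γ) : geomConst γ ≠ ⊤ := by
  have h1 : ENNReal.ofReal ((2 : ℝ) ^ (-γ)) < 1 := by
    rw [ENNReal.ofReal_lt_one]
    exact Real.rpow_lt_one_of_one_lt_of_neg (by norm_num) (by linarith)
  simpa [geomConst, ENNReal.inv_eq_top, tsub_eq_zero_iff_le] using h1

/-- An averaged Morrey inequality for pseudo-metrics of finite Slobodeckii seminorm. -/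
theorem average_dist_le_morrey {μ : Measure X} [SFinite μ] {x : X} {k : ℕ → X → ℝ≥0∞}
    {B R n p σ r : ℝ} (hB : 1 ≤ B) (hR : 1 ≤ R) (hn : 0 < n) (hp : 1 ≤ p) (hσ : n / p < σ)
    (hr : 0 < r)
    (hk : ∀ j : ℕ, IsKernel μ x (.ofReal (B * (r / 2 ^ j) ^ (-n))) (.ofReal (R * (r / 2 ^ j))) (k j))
    {d : X → X → ℝ≥0∞} (hd : Measurable (Function.uncurry d))
    (htri : ∀ a b c, d a c ≤ d a b + d b c) (hsymm : ∀ a b, d a b = d b a)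
    (hx : ∫⁻ z, d x z ^ p / edist x z ^ (n + σ * p) ∂μ ≠ ⊤) :
    ∫⁻ z, k 0 z * d x z ∂μ ≤
      .ofReal ((B * B * 2 ^ n * (3 * R) ^ (n + σ * p)) ^ (1 / p) * r ^ (σ - n / p)) *
        (∫⁻ z, ∫⁻ z', d z z' ^ p / edist z z' ^ (n + σ * p) ∂μ ∂μ) ^ (1 / p) *
          geomConst (σ - n / p) := by
  have hp0 : 0 < p := by linarith
  have hσ0 : 0 < σ := lt_trans (by positivity) hσ
  refine average_dist_le_of_chain hk hd htri hsymm (fun j => ?_) ?_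
  -- Two consecutive dyadic scales with the same centre. The increments form a geometric sequence of
  -- ratio `2 ^ (-(σ - n / p))`, less than one because `σ > n / p`.
  · refine ((hk j).pair_le hB hR hn hp hσ0 (by positivity) (le_of_eq ?_) ?_ (hk (j + 1))
      (by simp) hd).trans (le_of_eq ?_)
    · rw [pow_succ]; field_simp
    · gcongr <;> simp
    · rw [ofReal_half_pow_rpow hr _ (by positivity)]
      ring
  -- The remainder is the average of the distance to the centre itself. It vanishes because the
  -- Slobodeckii functional at `x` is finite.
  · refine tendsto_of_tendsto_of_tendsto_of_le_of_le tendsto_const_nhds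
      (tendsto_half_pow_rpow hr hσ0 ((B * R ^ (n + σ * p)) ^ (1 / p)) (by positivity)
        (ENNReal.rpow_ne_top_of_nonneg (y := 1 / p) (by positivity) hx))
      (fun _ => zero_le) fun j => (hk j).center_le hB hR hn hp hσ0 (by positivity) hd

end Kernels

end StefanTrace

namespace StefanTrace

noncomputable section

/-! ### Mollification on the cube -/

section Mollifier

variable {m : ℕ}

theorem isOpen_cube (m : ℕ) : IsOpen (cube m) := by
  have : cube m = ⋂ i, (fun x : Euc m => x i) ⁻¹' Ioo (-1 : ℝ) 1 := by
    ext x; simp [cube]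
  rw [this]
  exact isOpen_iInter_of_finite fun i => isOpen_Ioo.preimage (by fun_prop)

theorem measurableSet_cube (m : ℕ) : MeasurableSet (cube m) := (isOpen_cube m).measurableSet

theorem convex_cube (m : ℕ) : Convex ℝ (cube m) := by
  have : cube m = ⋂ i, (fun x : Euc m => x i) ⁻¹' Ioo (-1 : ℝ) 1 := by
    ext x; simp [cube]
  rw [this]
  exact convex_iInter fun i => (convex_Ioo (-1 : ℝ) 1).is_linear_preimage
    (f := fun x : Euc m => x i) ⟨fun _ _ => rfl, fun _ _ => rfl⟩

theorem norm_le_of_mem_cube {x : Euc m} (hx : x ∈ cube m) : ‖x‖ ≤ m := by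
  rw [EuclideanSpace.norm_eq]
  refine Real.sqrt_le_iff.2 ⟨by positivity, ?_⟩
  calc ∑ i, ‖x i‖ ^ 2 ≤ ∑ _i : Fin m, (1 : ℝ) := Finset.sum_le_sum fun i _ => by
        have := abs_lt.2 (hx i)
        rw [Real.norm_eq_abs, sq_le_one_iff_abs_le_one, abs_abs]
        exact this.le
    _ = m := by simp
    _ ≤ (m : ℝ) ^ 2 := by
        exact_mod_cast Nat.le_self_pow (by norm_num) m

theorem abs_apply_le_norm (x : Euc m) (i : Fin m) : |x i| ≤ ‖x‖ := by
  simpa using PiLp.norm_apply_le x i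

theorem cube_subset_closedBall (m : ℕ) : cube m ⊆ Metric.closedBall 0 m := fun x hx => by
  simpa using norm_le_of_mem_cube hx

instance isFiniteMeasure_cubeMeasure (m : ℕ) : IsFiniteMeasure (cubeMeasure m) := by
  refine ⟨?_⟩
  rw [cubeMeasure, Measure.restrict_apply_univ]
  exact (measure_mono (cube_subset_closedBall m)).trans_lt measure_closedBall_lt_top

theorem ae_cubeMeasure_mem (m : ℕ) : ∀ᵐ x ∂(cubeMeasure m), x ∈ cube m :=
  ae_restrict_mem (measurableSet_cube m)

/-- A smooth probability density supported in the ball of radius `1/2`. -/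
def bump (m : ℕ) : Euc m → ℝ :=
  ContDiffBump.normed (⟨1 / 4, 1 / 2, by norm_num, by norm_num⟩ : ContDiffBump (0 : Euc m)) volume

theorem contDiff_bump : ContDiff ℝ ∞ (bump m) := ContDiffBump.contDiff_normed _

theorem continuous_bump : Continuous (bump m) := contDiff_bump.continuous

theorem bump_nonneg (x : Euc m) : 0 ≤ bump m x := ContDiffBump.nonneg_normed _ _

theorem integral_bump : ∫ x, bump m x = 1 := ContDiffBump.integral_normed _

theorem hasCompactSupport_bump : HasCompactSupport (bump m) :=
  ContDiffBump.hasCompactSupport_normed _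

theorem support_bump : Function.support (bump m) = Metric.ball 0 (1 / 2) :=
  ContDiffBump.support_normed_eq _

/-- The partial derivatives of the bump. -/
def dbump (i : Fin m) (x : Euc m) : ℝ := fderiv ℝ (bump m) x (EuclideanSpace.single i 1)

theorem continuous_dbump (i : Fin m) : Continuous (dbump i) :=
  (contDiff_bump.continuous_fderiv (by simp)).clm_apply continuous_const

theorem hasCompactSupport_dbump (i : Fin m) : HasCompactSupport (dbump i) :=
  (hasCompactSupport_bump.fderiv (𝕜 := ℝ)).mono fun x hx => by
    intro h
    exact hx (by simp [dbump, h])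

theorem exists_bump_bound (m : ℕ) : ∃ B : ℝ, 1 ≤ B ∧ (∀ x, bump m x ≤ B) ∧
    (∀ i x, |dbump (m := m) i x| ≤ B) ∧ ∀ i, ∫ x, |dbump (m := m) i x| ≤ B := by
  obtain ⟨B1, h1⟩ := hasCompactSupport_bump.exists_bound_of_continuous (continuous_bump (m := m))
  choose B2 h2 using fun i : Fin m =>
    (hasCompactSupport_dbump i).exists_bound_of_continuous (continuous_dbump i)
  have hs : ∀ i, 0 ≤ B2 i := fun i => (norm_nonneg _).trans (h2 i 0)
  have hI : ∀ i : Fin m, 0 ≤ ∫ x, |dbump i x| := fun i => integral_nonneg fun x => abs_nonneg _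
  have hB1 : 0 ≤ B1 := (norm_nonneg _).trans (h1 0)
  have a1 : ∀ i, B2 i ≤ ∑ i, B2 i := fun i =>
    Finset.single_le_sum (fun j _ => hs j) (Finset.mem_univ i)
  have a2 : ∀ i : Fin m, ∫ x, |dbump i x| ≤ ∑ i : Fin m, ∫ x, |dbump i x| := fun i =>
    Finset.single_le_sum (f := fun i : Fin m => ∫ x, |dbump i x|) (fun j _ => hI j) (Finset.mem_univ i)
  have s1 : 0 ≤ ∑ i, B2 i := Finset.sum_nonneg fun i _ => hs i
  have s2 : 0 ≤ ∑ i : Fin m, ∫ x, |dbump i x| := Finset.sum_nonneg fun i _ => hI i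
  refine ⟨1 + B1 + ∑ i, B2 i + ∑ i : Fin m, ∫ x, |dbump i x|, by linarith, fun x => ?_,
    fun i x => ?_, fun i => ?_⟩
  · have := (le_abs_self _).trans (h1 x); linarith
  · have := h2 i x; rw [Real.norm_eq_abs] at this; linarith [a1 i]
  · linarith [a2 i]

/-- A bound for the bump and its derivatives. -/
def bumpB (m : ℕ) : ℝ := (exists_bump_bound m).choose

theorem one_le_bumpB (m : ℕ) : 1 ≤ bumpB m := (exists_bump_bound m).choose_spec.1

theorem bump_le (x : Euc m) : bump m x ≤ bumpB m := (exists_bump_bound m).choose_spec.2.1 x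

theorem abs_dbump_le (i : Fin m) (x : Euc m) : |dbump i x| ≤ bumpB m :=
  (exists_bump_bound m).choose_spec.2.2.1 i x

theorem integral_abs_dbump_le (i : Fin m) : ∫ x, |dbump i x| ≤ bumpB m :=
  (exists_bump_bound m).choose_spec.2.2.2 i

/-- The rescaled bump. -/
def rbump (m : ℕ) (r : ℝ) (y : Euc m) : ℝ := r ^ (-(m : ℝ)) * bump m (r⁻¹ • y)

theorem contDiff_rbump (r : ℝ) : ContDiff ℝ ∞ (rbump m r) :=
  contDiff_const.mul (contDiff_bump.comp (contDiff_const_smul _))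

theorem continuous_rbump (r : ℝ) : Continuous (rbump m r) := (contDiff_rbump r).continuous

theorem rbump_nonneg {r : ℝ} (hr : 0 < r) (y : Euc m) : 0 ≤ rbump m r y :=
  mul_nonneg (by positivity) (bump_nonneg _)

theorem rbump_le {r : ℝ} (hr : 0 < r) (y : Euc m) : rbump m r y ≤ bumpB m * r ^ (-(m : ℝ)) := by
  rw [rbump, mul_comm]
  exact mul_le_mul_of_nonneg_right (bump_le _) (by positivity)

theorem integral_rescale {r : ℝ} (hr : 0 < r) (f : Euc m → ℝ) :
    ∫ y, r ^ (-(m : ℝ)) * f (r⁻¹ • y) = ∫ y, f y := by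
  rw [integral_const_mul, Measure.integral_comp_smul]
  simp only [finrank_euclideanSpace, Fintype.card_fin, smul_eq_mul]
  rw [← mul_assoc, inv_pow, inv_inv, abs_of_pos (by positivity), Real.rpow_neg hr.le,
    Real.rpow_natCast, inv_mul_cancel₀ (by positivity), one_mul]

theorem integral_rbump {r : ℝ} (hr : 0 < r) : ∫ y, rbump m r y = 1 :=
  (integral_rescale hr (bump m)).trans integral_bump

theorem norm_le_of_rbump_ne_zero {r : ℝ} (hr : 0 < r) {y : Euc m} (h : rbump m r y ≠ 0) :
    ‖y‖ ≤ r / 2 := by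
  have : r⁻¹ • y ∈ Function.support (bump m) := fun h' => h (by simp [rbump, h'])
  rw [support_bump, mem_ball_zero_iff, norm_smul, norm_inv, Real.norm_of_nonneg hr.le,
    inv_mul_lt_iff₀ hr] at this
  linarith

theorem hasCompactSupport_rbump {r : ℝ} (hr : 0 < r) : HasCompactSupport (rbump m r) :=
  HasCompactSupport.of_support_subset_isCompact (isCompact_closedBall 0 (r / 2)) fun y hy => by
    simpa using norm_le_of_rbump_ne_zero hr hy

theorem fderiv_rbump {r : ℝ} (y : Euc m) (i : Fin m) :
    fderiv ℝ (rbump m r) y (EuclideanSpace.single i 1) =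
      r⁻¹ * (r ^ (-(m : ℝ)) * dbump i (r⁻¹ • y)) := by
  have h1 : HasFDerivAt (fun y : Euc m => r⁻¹ • y) (r⁻¹ • ContinuousLinearMap.id ℝ (Euc m)) y :=
    (hasFDerivAt_id y).const_smul r⁻¹
  have h2 : HasFDerivAt (bump m) (fderiv ℝ (bump m) (r⁻¹ • y)) (r⁻¹ • y) :=
    (contDiff_bump.differentiable (by simp) _).hasFDerivAt
  have h3 := (h2.comp y h1).const_mul (r ^ (-(m : ℝ)))
  have h4 : fderiv ℝ (rbump m r) y = _ := h3.fderiv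
  rw [h4]
  simp [dbump]
  ring

/-- The mollification kernel, contracted towards `x` so that it is supported in the cube. -/
def mol (r : ℝ) (x z : Euc m) : ℝ := rbump m r ((1 - r) • x - z)

theorem continuous_mol (r : ℝ) : Continuous (Function.uncurry (mol (m := m) r)) :=
  (continuous_rbump r).comp (by fun_prop)

theorem contDiff_mol (r : ℝ) (x : Euc m) : ContDiff ℝ ∞ (mol r x) :=
  (contDiff_rbump r).comp (contDiff_const.sub contDiff_id)

theorem mol_nonneg {r : ℝ} (hr : 0 < r) (x z : Euc m) : 0 ≤ mol r x z := rbump_nonneg hr _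

theorem mol_le {r : ℝ} (hr : 0 < r) (x z : Euc m) : mol r x z ≤ bumpB m * r ^ (-(m : ℝ)) :=
  rbump_le hr _

theorem tsupport_mol_subset {r : ℝ} (hr : 0 < r) (x : Euc m) :
    tsupport (mol r x) ⊆ Metric.closedBall ((1 - r) • x) (r / 2) :=
  closure_minimal (fun z hz => by
    have := norm_le_of_rbump_ne_zero hr hz
    rwa [Metric.mem_closedBall, dist_comm, dist_eq_norm]) Metric.isClosed_closedBall

/-- Each coordinate of `(1 - r) • x` has absolute value at most `1 - r`, which leaves room for a
radius `r / 2`. This makes the contracted kernel usable up to the boundary of the cube. -/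
theorem closedBall_subset_cube {r : ℝ} (hr : 0 < r) (hr1 : r ≤ 1) {x : Euc m} (hx : x ∈ cube m) :
    Metric.closedBall ((1 - r) • x) (r / 2) ⊆ cube m := fun z hz i => by
  rw [Metric.mem_closedBall, dist_eq_norm] at hz
  have h1 := abs_le.1 ((abs_apply_le_norm _ i).trans hz)
  have h2 := hx i
  simp only [PiLp.sub_apply, PiLp.smul_apply, smul_eq_mul] at h1
  constructor <;> nlinarith [h1.1, h1.2, h2.1, h2.2]

theorem mol_support_mem {r : ℝ} (hr : 0 < r) (hr1 : r ≤ 1) {x : Euc m} (hx : x ∈ cube m) :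
    tsupport (mol r x) ⊆ cube m :=
  (tsupport_mol_subset hr x).trans (closedBall_subset_cube hr hr1 hx)

theorem hasCompactSupport_mol {r : ℝ} (hr : 0 < r) (x : Euc m) : HasCompactSupport (mol r x) :=
  HasCompactSupport.of_support_subset_isCompact (isCompact_closedBall _ _)
    (subset_tsupport _ |>.trans (tsupport_mol_subset hr x))

theorem setIntegral_of_support {f : Euc m → ℝ} (h : Function.support f ⊆ cube m) :
    ∫ z in cube m, f z = ∫ z, f z := setIntegral_eq_integral_of_forall_compl_eq_zero fun z hz => by
  by_contra h'
  exact hz (h h')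

theorem integral_mol {r : ℝ} (hr : 0 < r) (hr1 : r ≤ 1) {x : Euc m} (hx : x ∈ cube m) :
    ∫ z in cube m, mol r x z = 1 := by
  rw [setIntegral_of_support ((subset_tsupport _).trans (mol_support_mem hr hr1 hx)),
    ← integral_rbump (m := m) hr]
  exact integral_sub_left_eq_self (rbump m r) volume _

/-- The radius of the bump contributes `r / 2`, and the contraction moves `x` by at most `m * r`
since points of the cube have norm at most `m`. -/
theorem edist_le_of_mol_ne_zero {r : ℝ} (hr : 0 < r) {x z : Euc m} (hx : x ∈ cube m)
    (h : mol r x z ≠ 0) : edist x z ≤ .ofReal ((m + 1) * r) := by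
  rw [edist_dist]
  refine ENNReal.ofReal_le_ofReal ?_
  have h1 : dist z ((1 - r) • x) ≤ r / 2 := tsupport_mol_subset hr x (subset_tsupport _ h)
  have h2 : dist ((1 - r) • x) x ≤ r * m := by
    rw [dist_eq_norm, show (1 - r) • x - x = -(r • x) by rw [sub_smul, one_smul]; abel, norm_neg,
      norm_smul, Real.norm_of_nonneg hr.le]
    exact mul_le_mul_of_nonneg_left (norm_le_of_mem_cube hx) hr.le
  rw [dist_comm]
  linarith [dist_triangle z ((1 - r) • x) x]

theorem isKernel_mol {r : ℝ} (hr : 0 < r) (hr1 : r ≤ 1) {x : Euc m} (hx : x ∈ cube m) :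
    IsKernel (cubeMeasure m) x (.ofReal (bumpB m * r ^ (-(m : ℝ)))) (.ofReal ((m + 1) * r))
      (fun z => .ofReal (mol r x z)) where
  meas := ((contDiff_mol r x).continuous.measurable).ennreal_ofReal
  mass := by
    rw [cubeMeasure, ← ofReal_integral_eq_lintegral_ofReal, integral_mol hr hr1 hx,
      ENNReal.ofReal_one]
    · exact ((contDiff_mol r x).continuous.integrable_of_hasCompactSupport
        (hasCompactSupport_mol hr x)).integrableOn
    · exact Eventually.of_forall fun z => mol_nonneg hr x z
  le z := ENNReal.ofReal_le_ofReal (mol_le hr x z)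
  supp z h := edist_le_of_mol_ne_zero hr hx fun h' => h (by simp [h'])

/-- The derivative of the mollification kernel. -/
theorem fderiv_mol (r : ℝ) (x z : Euc m) (i : Fin m) :
    fderiv ℝ (mol r x) z (EuclideanSpace.single i 1) =
      -(r⁻¹ * (r ^ (-(m : ℝ)) * dbump i (r⁻¹ • ((1 - r) • x - z)))) := by
  have h1 : HasFDerivAt (fun z : Euc m => (1 - r) • x - z) (-ContinuousLinearMap.id ℝ (Euc m)) z :=
    (hasFDerivAt_id z).const_sub _
  have h2 : HasFDerivAt (rbump m r) (fderiv ℝ (rbump m r) ((1 - r) • x - z)) ((1 - r) • x - z) :=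
    ((contDiff_rbump r).differentiable (by simp) _).hasFDerivAt
  have h4 : fderiv ℝ (mol r x) z = _ := (h2.comp z h1).fderiv
  rw [h4]
  simp only [ContinuousLinearMap.comp_apply, neg_apply, map_neg,
    ContinuousLinearMap.id_apply, fderiv_rbump]

/-- The average of `u` against the mollification kernel. -/
def avg (r : ℝ) (u : Euc m → ℝ) (x : Euc m) : ℝ := ∫ z, mol r x z * u z ∂(cubeMeasure m)

theorem integrable_mol_mul {r : ℝ} (hr : 0 < r) {u : Euc m → ℝ} (hu : Integrable u (cubeMeasure m))
    (x : Euc m) : Integrable (fun z => mol r x z * u z) (cubeMeasure m) :=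
  hu.bdd_mul (c := bumpB m * r ^ (-(m : ℝ))) (contDiff_mol r x).continuous.aestronglyMeasurable
    (Eventually.of_forall fun z => by
      rw [Real.norm_of_nonneg (mol_nonneg hr x z)]; exact mol_le hr x z)

theorem avg_const {r : ℝ} (hr : 0 < r) (hr1 : r ≤ 1) {x : Euc m} (hx : x ∈ cube m) (c : ℝ) :
    avg r (fun _ => c) x = c := by
  have := integral_mol hr hr1 hx
  simp only [avg, cubeMeasure, integral_mul_const, this, one_mul]

theorem enorm_avg_le {r : ℝ} (hr : 0 < r) (u : Euc m → ℝ) (x : Euc m) :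
    ‖avg r u x‖ₑ ≤ ∫⁻ z, .ofReal (mol r x z) * ‖u z‖ₑ ∂(cubeMeasure m) := by
  refine (enorm_integral_le_lintegral_enorm _).trans (le_of_eq ?_)
  simp only [enorm_mul, Real.enorm_of_nonneg (mol_nonneg hr x _)]

theorem enorm_sub_avg_le {r : ℝ} (hr : 0 < r) (hr1 : r ≤ 1) {u : Euc m → ℝ}
    (hu : Integrable u (cubeMeasure m)) {x : Euc m} (hx : x ∈ cube m) (c : ℝ) :
    ‖c - avg r u x‖ₑ ≤ ∫⁻ z, .ofReal (mol r x z) * ‖c - u z‖ₑ ∂(cubeMeasure m) := by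
  have h : c - avg r u x = avg r (fun z => c - u z) x := by
    have h1 := integrable_mol_mul hr hu x
    have h2 := integrable_mol_mul hr (integrable_const (μ := cubeMeasure m) c) x
    have h3 := avg_const hr hr1 hx c
    simp only [avg] at h3 ⊢
    simp only [mul_sub]
    rw [integral_sub h2 h1, h3]
  rw [h]
  exact enorm_avg_le hr _ x

/-- The mollification as a convolution. -/
theorem avg_eq_convolution (r : ℝ) (u : Euc m → ℝ) (x : Euc m) :
    avg r u x = convolution ((cube m).indicator u) (rbump m r)
      (ContinuousLinearMap.lsmul ℝ ℝ) volume ((1 - r) • x) := by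
  rw [convolution, avg, cubeMeasure, ← integral_indicator (measurableSet_cube m)]
  congr 1
  ext z
  by_cases hz : z ∈ cube m <;> simp [hz, mol, mul_comm]

theorem locallyIntegrable_indicator {u : Euc m → ℝ} (hu : Integrable u (cubeMeasure m)) :
    LocallyIntegrable ((cube m).indicator u) volume :=
  ((integrable_indicator_iff (measurableSet_cube m)).2 hu).locallyIntegrable

theorem contDiff_avg {r : ℝ} (hr : 0 < r) {u : Euc m → ℝ} (hu : Integrable u (cubeMeasure m)) :
    ContDiff ℝ ∞ (avg r u) := by
  have h := (hasCompactSupport_rbump hr).contDiff_convolution_right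
    (ContinuousLinearMap.lsmul ℝ ℝ) (locallyIntegrable_indicator hu) (contDiff_rbump (m := m) r)
  have : avg r u = fun x => _ := funext (avg_eq_convolution r u)
  rw [this]
  exact h.comp (contDiff_const_smul (1 - r))

/-- The kernel as a function of `z` is an admissible test function: the contraction gives it compact
support inside the cube. This moves the derivative from `u` onto the kernel. -/
theorem IsWeakPartial.integral_mol {u g : Euc m → ℝ} {i : Fin m} (h : IsWeakPartial i u g) {r : ℝ}
    (hr : 0 < r) (hr1 : r ≤ 1) {x : Euc m} (hx : x ∈ cube m) :
    avg r g x = ∫ z, u z * (r⁻¹ * (r ^ (-(m : ℝ)) * dbump i (r⁻¹ • ((1 - r) • x - z))))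
      ∂(cubeMeasure m) := by
  have := h.integral_eq (mol r x) (contDiff_mol r x) (hasCompactSupport_mol hr x)
    (mol_support_mem hr hr1 hx)
  simp only [fderiv_mol, mul_neg, integral_neg, neg_inj] at this
  rw [avg, cubeMeasure, this]
  simp only [mul_comm]

/-- Differentiation passes to the convolution kernel and from there to the weak derivative. The
factor `1 - r` is the chain rule for the contraction. -/
theorem fderiv_avg {u g : Euc m → ℝ} {i : Fin m} (h : IsWeakPartial i u g)
    (hu : Integrable u (cubeMeasure m)) {r : ℝ}
    (hr : 0 < r) (hr1 : r ≤ 1) {x : Euc m} (hx : x ∈ cube m) :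
    fderiv ℝ (avg r u) x (EuclideanSpace.single i 1) = (1 - r) * avg r g x := by
  have h1 := (hasCompactSupport_rbump hr).hasFDerivAt_convolution_right
    (ContinuousLinearMap.lsmul ℝ ℝ) (locallyIntegrable_indicator hu)
    ((contDiff_rbump (m := m) r).of_le (by simp)) ((1 - r) • x)
  have h2 : HasFDerivAt (fun x : Euc m => (1 - r) • x)
      ((1 - r) • ContinuousLinearMap.id ℝ (Euc m)) x := (hasFDerivAt_id x).const_smul (1 - r)
  have h3 := h1.comp x h2
  have h5 := (h3.congr_of_eventuallyEq (Eventually.of_forall fun y => avg_eq_convolution r u y)).fderiv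
  rw [h5]
  simp only [ContinuousLinearMap.comp_apply, smul_apply,
    ContinuousLinearMap.id_apply, map_smul, smul_eq_mul]
  congr 1
  rw [convolution_precompR_apply _ (locallyIntegrable_indicator hu)
    ((hasCompactSupport_rbump hr).fderiv (𝕜 := ℝ))
    ((contDiff_rbump (m := m) r).continuous_fderiv (by simp)), h.integral_mol hr hr1 hx,
    convolution, cubeMeasure, ← integral_indicator (measurableSet_cube m)]
  congr 1
  ext z
  by_cases hz : z ∈ cube m <;> simp [hz, fderiv_rbump]

end Mollifier

/-! ### Pointwise estimates on the cube -/

section Slices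

variable {m : ℕ}

theorem cubeLp_eq {p : ℝ} (hp : 0 < p) (u : Euc m → ℝ) :
    cubeLp p u = (∫⁻ x, ‖u x‖ₑ ^ p ∂(cubeMeasure m)) ^ (1 / p) := by
  rw [cubeLp, eLpNorm_eq_lintegral_rpow_enorm_toReal (by simpa using hp) ENNReal.ofReal_ne_top,
    ENNReal.toReal_ofReal hp.le]

theorem cubeLp_congr {p : ℝ} {u v : Euc m → ℝ} (h : u =ᵐ[cubeMeasure m] v) :
    cubeLp p u = cubeLp p v := eLpNorm_congr_ae h

theorem cubeSeminorm_congr {p s : ℝ} {u v : Euc m → ℝ} (h : u =ᵐ[cubeMeasure m] v) :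
    cubeSeminorm p s u = cubeSeminorm p s v := by
  unfold cubeSeminorm
  congr 1
  refine lintegral_congr_ae ?_
  filter_upwards [h] with x hx
  refine lintegral_congr_ae ?_
  filter_upwards [h] with y hy
  rw [hx, hy]

theorem integrable_of_cubeLp {p : ℝ} (hp : 1 ≤ p) {u : Euc m → ℝ}
    (hu : AEStronglyMeasurable u (cubeMeasure m)) (h : cubeLp p u < ⊤) :
    Integrable u (cubeMeasure m) :=
  MemLp.integrable (q := ENNReal.ofReal p) (by simpa using hp) ⟨hu, h⟩

/-- The averaged Morrey inequality for the pseudo-metric `|u x - u z|` and the dyadic contracted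
mollifiers. A finite seminorm makes the pointwise functional finite at almost every `x`, and these
are the points where the telescoping is run. -/
theorem exists_const_ae_sub_avg_le {p s : ℝ} (hm : 1 ≤ m) (hp : 1 ≤ p) (hs : (m : ℝ) / p < s) :
    ∃ C : ℝ≥0, ∀ u : Euc m → ℝ, Measurable u → Integrable u (cubeMeasure m) →
      ∀ r : ℝ, 0 < r → r ≤ 1 → ∀ᵐ x ∂(cubeMeasure m),
        ‖u x - avg r u x‖ₑ ≤ C * (.ofReal (r ^ (s - m / p)) * cubeSeminorm p s u) := by
  have hm0 : (0 : ℝ) < m := by exact_mod_cast hm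
  have hp0 : 0 < p := by linarith
  set C1 : ℝ := (bumpB m * bumpB m * 2 ^ (m : ℝ) * (3 * ((m : ℝ) + 1)) ^ ((m : ℝ) + s * p)) ^ (1 / p)
  have hb := one_le_bumpB m
  have hC1 : 0 < C1 := by positivity
  have hg := geomConst_ne_top (γ := s - m / p) (by linarith)
  -- The summand `1` keeps the constant nonzero, so that the right-hand side is infinite when the
  -- seminorm is.
  refine ⟨(ENNReal.ofReal C1 * geomConst (s - m / p)).toNNReal + 1, fun u hu hi r hr hr1 => ?_⟩
  rw [ENNReal.coe_add, ENNReal.coe_toNNReal (ENNReal.mul_ne_top ENNReal.ofReal_ne_top hg)]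
  rcases eq_or_ne (cubeSeminorm p s u) ⊤ with htop | htop
  · refine Eventually.of_forall fun x => ?_
    have : 0 < r ^ (s - m / p) := by positivity
    rw [htop, ENNReal.mul_top (by simpa using this), ENNReal.mul_top (by simp)]
    exact le_top
  have hd : Measurable (Function.uncurry fun x z => ‖u x - u z‖ₑ) :=
    ((hu.comp measurable_fst).sub (hu.comp measurable_snd)).enorm
  have hmeas := (measurable_rpow_div_edist (p := p) (e := (m : ℝ) + s * p) hd).lintegral_prod_right'
    (ν := cubeMeasure m)
  have hfin : ∫⁻ x, ∫⁻ z, ‖u x - u z‖ₑ ^ p / edist x z ^ ((m : ℝ) + s * p) ∂(cubeMeasure m)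
      ∂(cubeMeasure m) ≠ ⊤ := by
    intro h
    simp only [edist_eq_enorm_sub] at h
    exact htop (by rw [cubeSeminorm, h, ENNReal.top_rpow_of_pos (by positivity)])
  filter_upwards [ae_lt_top hmeas hfin, ae_cubeMeasure_mem m] with x hx hxm
  refine (enorm_sub_avg_le hr hr1 hi hxm (u x)).trans ?_
  have hle : ∀ j : ℕ, r / 2 ^ j ≤ 1 := fun j =>
    (div_le_self hr.le (one_le_pow₀ (by norm_num))).trans hr1
  have key := average_dist_le_morrey (μ := cubeMeasure m) (x := x)
    (k := fun j z => .ofReal (mol (r / 2 ^ j) x z)) hb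
    (by linarith : (1 : ℝ) ≤ (m : ℝ) + 1) hm0 hp hs hr
    (fun j => isKernel_mol (by positivity) (hle j) hxm) hd
    (fun a b c => by simpa using enorm_add_le (u a - u b) (u b - u c))
    (fun a b => by rw [← enorm_neg, neg_sub]) hx.ne
  simp only [pow_zero, div_one, edist_eq_enorm_sub] at key
  refine key.trans ?_
  rw [ENNReal.ofReal_mul hC1.le]
  calc _ = ENNReal.ofReal C1 * geomConst (s - m / p) *
        (.ofReal (r ^ (s - m / p)) * cubeSeminorm p s u) := by rw [cubeSeminorm]; ring
    _ ≤ _ := by gcongr; exact le_self_add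

/-- An interpolated Morrey inequality on the cube. -/
theorem exists_const_ae_enorm_le {p s : ℝ} (hm : 1 ≤ m) (hp : 1 ≤ p) (hs : (m : ℝ) / p < s) :
    ∃ C : ℝ≥0, ∀ u : Euc m → ℝ, Measurable u → cubeLp p u < ⊤ →
      ∀ r : ℝ, 0 < r → r ≤ 1 → ∀ᵐ x ∂(cubeMeasure m),
        ‖u x‖ₑ ≤ C * (.ofReal (r ^ (s - m / p)) * cubeSeminorm p s u +
          .ofReal (r ^ (-((m : ℝ) / p))) * cubeLp p u) := by
  obtain ⟨C, hC⟩ := exists_const_ae_sub_avg_le hm hp hs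
  have hp0 : 0 < p := by linarith
  have hb := one_le_bumpB m
  refine ⟨C + Real.toNNReal (bumpB m ^ (1 / p)), fun u hu hfin r hr hr1 => ?_⟩
  filter_upwards [hC u hu (integrable_of_cubeLp hp hu.aestronglyMeasurable hfin) r hr hr1,
    ae_cubeMeasure_mem m] with x hx hxm
  have h2 : ‖avg r u x‖ₑ ≤
      .ofReal (bumpB m ^ (1 / p)) * (.ofReal (r ^ (-((m : ℝ) / p))) * cubeLp p u) := by
    refine (enorm_avg_le hr u x).trans
      (((isKernel_mol hr hr1 hxm).lintegral_le_Lp hp hu.enorm.aemeasurable).trans (le_of_eq ?_))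
    rw [ENNReal.mul_rpow_of_nonneg _ _ (by positivity), ← cubeLp_eq hp0,
      ENNReal.ofReal_rpow_of_pos (by positivity), Real.mul_rpow (by positivity) (by positivity),
      ← Real.rpow_mul hr.le, ENNReal.ofReal_mul (by positivity), mul_assoc]
    congr 4
    field_simp
  calc ‖u x‖ₑ = ‖(u x - avg r u x) + avg r u x‖ₑ := by simp
    _ ≤ _ := enorm_add_le _ _
    _ ≤ _ := add_le_add hx h2
    _ ≤ _ := by
      push_cast
      rw [mul_add]
      gcongr
      · exact le_self_add
      · exact le_add_self

/-- The mollified weak derivative is controlled by the function. -/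
theorem IsWeakPartial.enorm_avg_le {p : ℝ} (hp : 1 ≤ p) {u g : Euc m → ℝ} {i : Fin m}
    (h : IsWeakPartial i u g) (hu : AEStronglyMeasurable u (cubeMeasure m)) {r : ℝ}
    (hr : 0 < r) (hr1 : r ≤ 1) {x : Euc m} (hx : x ∈ cube m) :
    ‖avg r g x‖ₑ ≤ .ofReal (bumpB m * r ^ (-1 - (m : ℝ) / p)) * cubeLp p u := by
  have hp0 : 0 < p := by linarith
  have hb := one_le_bumpB m
  set D : Euc m → ℝ := fun z => r⁻¹ * (r ^ (-(m : ℝ)) * dbump i (r⁻¹ • ((1 - r) • x - z))) with hD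
  have hDc : Continuous D := by
    have := continuous_dbump i
    fun_prop
  have hDle : ∀ z, ‖D z‖ₑ ≤ .ofReal (bumpB m * (r⁻¹ * r ^ (-(m : ℝ)))) := fun z => by
    rw [← ofReal_norm]
    refine ENNReal.ofReal_le_ofReal ?_
    rw [hD]
    simp only [norm_mul, norm_inv, Real.norm_eq_abs, abs_of_pos hr,
      abs_of_pos (Real.rpow_pos_of_pos hr (-(m : ℝ)))]
    have := abs_dbump_le i (r⁻¹ • ((1 - r) • x - z))
    calc _ = |dbump i (r⁻¹ • ((1 - r) • x - z))| * (r⁻¹ * r ^ (-(m : ℝ))) := by ring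
      _ ≤ _ := by gcongr
  -- The differentiated kernel has mass of order `r⁻¹` and height of order `r ^ (-1 - m)`. Weighted
  -- Hölder with exponents `1 - 1/p` and `1/p` then yields `r ^ (-1 - m / p)`.
  have hmass : ∫⁻ z, ‖D z‖ₑ ∂(cubeMeasure m) ≤ .ofReal (bumpB m * r⁻¹) := by
    have e : ∀ z, ‖D z‖ = r⁻¹ * (fun y => r ^ (-(m : ℝ)) * |dbump i (r⁻¹ • y)|) ((1 - r) • x - z) := by
      intro z
      simp [hD, abs_of_pos hr]
    have hI : Integrable (fun z => ‖D z‖) := by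
      have h1 : Integrable (fun z : Euc m => ‖dbump i z‖) :=
        ((continuous_dbump i).integrable_of_hasCompactSupport (hasCompactSupport_dbump i)).norm
      have h2 : Integrable (fun y : Euc m => ‖dbump i (r⁻¹ • y)‖) :=
        h1.comp_smul (inv_ne_zero hr.ne')
      have h3 := ((h2.const_mul (r ^ (-(m : ℝ)))).comp_sub_left ((1 - r) • x)).const_mul r⁻¹
      exact h3.congr (Eventually.of_forall fun z => by simpa using (e z).symm)
    calc ∫⁻ z, ‖D z‖ₑ ∂(cubeMeasure m) ≤ ∫⁻ z, ‖D z‖ₑ := setLIntegral_le_lintegral _ _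
      _ = ∫⁻ z, .ofReal ‖D z‖ := by simp only [ofReal_norm]
      _ = .ofReal (∫ z, ‖D z‖) :=
        (ofReal_integral_eq_lintegral_ofReal hI (Eventually.of_forall fun z => norm_nonneg _)).symm
      _ ≤ _ := by
        refine ENNReal.ofReal_le_ofReal ?_
        simp only [e]
        rw [integral_const_mul, integral_sub_left_eq_self
          (fun y => r ^ (-(m : ℝ)) * |dbump i (r⁻¹ • y)|),
          integral_rescale hr (fun y => |dbump i y|), mul_comm]
        exact mul_le_mul_of_nonneg_right (integral_abs_dbump_le i) (by positivity)
  rw [h.integral_mol hr hr1 hx]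
  calc ‖∫ z, u z * D z ∂(cubeMeasure m)‖ₑ
      ≤ ∫⁻ z, ‖u z * D z‖ₑ ∂(cubeMeasure m) := enorm_integral_le_lintegral_enorm _
    _ = ∫⁻ z, ‖D z‖ₑ * ‖u z‖ₑ ∂(cubeMeasure m) := by simp only [enorm_mul, mul_comm]
    _ ≤ _ := lintegral_mul_le_mass_mul hp hDc.measurable.enorm.aemeasurable hu.enorm
    _ ≤ (.ofReal (bumpB m * r⁻¹)) ^ (1 - 1 / p) *
        (.ofReal (bumpB m * (r⁻¹ * r ^ (-(m : ℝ)))) * ∫⁻ z, ‖u z‖ₑ ^ p ∂(cubeMeasure m)) ^ (1 / p) := by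
        have : 0 ≤ 1 - 1 / p := by rw [sub_nonneg, div_le_one hp0]; exact hp
        rw [← lintegral_const_mul'' _ (hu.enorm.pow_const p)]
        gcongr
        exact hDle _
    _ = _ := by
        rw [ENNReal.mul_rpow_of_nonneg _ _ (by positivity), ← cubeLp_eq hp0, ← mul_assoc,
          ENNReal.ofReal_rpow_of_pos (by positivity), ENNReal.ofReal_rpow_of_pos (by positivity),
          ← ENNReal.ofReal_mul (by positivity), ← mul_assoc (bumpB m),
          Real.mul_rpow (z := 1 / p) (by positivity) (by positivity), ← mul_assoc,
          ← Real.rpow_add (by positivity), ← Real.rpow_mul hr.le, sub_add_cancel, Real.rpow_one,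
          mul_assoc (bumpB m), ← Real.rpow_neg_one, ← Real.rpow_add hr]
        congr 4
        field_simp
        ring

/-- The oscillation of `g` around its average is a Morrey term in `g`, whereas the average itself is
controlled by `u` after integration by parts. Hence the `L_p`-norm on the right is that of `u`, with
one more negative power of `r`. -/
theorem exists_const_ae_enorm_weakPartial_le {p s : ℝ} (hm : 1 ≤ m) (hp : 1 ≤ p)
    (hs : (m : ℝ) / p < s) :
    ∃ C : ℝ≥0, ∀ (i : Fin m) (u g : Euc m → ℝ), Measurable u → Measurable g →
      IsWeakPartial i u g → cubeLp p g < ⊤ →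
      ∀ r : ℝ, 0 < r → r ≤ 1 → ∀ᵐ x ∂(cubeMeasure m),
        ‖g x‖ₑ ≤ C * (.ofReal (r ^ (s - m / p)) * cubeSeminorm p s g +
          .ofReal (r ^ (-1 - (m : ℝ) / p)) * cubeLp p u) := by
  obtain ⟨C, hC⟩ := exists_const_ae_sub_avg_le hm hp hs
  have hb := one_le_bumpB m
  refine ⟨C + Real.toNNReal (bumpB m), fun i u g hu hg h hfin r hr hr1 => ?_⟩
  filter_upwards [hC g hg (integrable_of_cubeLp hp hg.aestronglyMeasurable hfin) r hr hr1,
    ae_cubeMeasure_mem m] with x hx hxm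
  have h2 := h.enorm_avg_le hp hu.aestronglyMeasurable hr hr1 hxm
  rw [ENNReal.ofReal_mul (by positivity), mul_assoc] at h2
  calc ‖g x‖ₑ = ‖(g x - avg r g x) + avg r g x‖ₑ := by simp
    _ ≤ _ := enorm_add_le _ _
    _ ≤ _ := add_le_add hx h2
    _ ≤ _ := by
      push_cast
      rw [mul_add]
      gcongr
      · exact le_self_add
      · exact le_add_self

/-- Mollifications converge almost everywhere. -/
theorem ae_tendsto_avg {u : Euc m → ℝ} (hu : Integrable u (cubeMeasure m)) :
    ∀ᵐ x ∂(cubeMeasure m), Tendsto (fun n : ℕ => avg (1 / 2 ^ n) u x) atTop (𝓝 (u x)) := by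
  -- Lebesgue points along balls that are not centred at `x`: the kernel lives on the ball of radius
  -- `r / 2` around `(1 - r) • x`, at distance at most `m * r` from `x`. This explains the dilation
  -- factor `2 * m`.
  have h := IsUnifLocDoublingMeasure.ae_tendsto_average_norm_sub (μ := (volume : Measure (Euc m)))
    (locallyIntegrable_indicator hu) (2 * m)
  filter_upwards [ae_restrict_of_ae (s := cube m) h, ae_cubeMeasure_mem m] with x hx hxm
  set r : ℕ → ℝ := fun n => 1 / 2 ^ n with hr
  have hr0 : ∀ n, 0 < r n := fun n => by positivity
  have hr1 : ∀ n, r n ≤ 1 := fun n => by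
    rw [hr]; exact div_le_one_of_le₀ (one_le_pow₀ (by norm_num)) (by positivity)
  have hrlim : Tendsto r atTop (𝓝 0) := by
    have := tendsto_pow_atTop_nhds_zero_of_lt_one (r := (1 / 2 : ℝ)) (by norm_num) (by norm_num)
    simpa [hr] using this
  have hδ : Tendsto (fun n => r n / 2) atTop (𝓝[>] 0) :=
    tendsto_nhdsWithin_iff.2 ⟨by simpa using hrlim.div_const 2,
      Eventually.of_forall fun n => half_pos (hr0 n)⟩
  have hlim := hx (fun n => (1 - r n) • x) (fun n => r n / 2) hδ (Eventually.of_forall fun n => by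
    rw [Metric.mem_closedBall, dist_eq_norm,
      show x - (1 - r n) • x = r n • x by rw [sub_smul, one_smul]; abel, norm_smul,
      Real.norm_of_nonneg (hr0 n).le]
    nlinarith [norm_le_of_mem_cube hxm, hr0 n])
  -- The height of the kernel times the volume of its ball; the powers of the radius cancel.
  set c : ℝ := bumpB m * ((1 / 2) ^ m * (volume (Metric.ball (0 : Euc m) 1)).toReal) with hc0
  rw [tendsto_iff_norm_sub_tendsto_zero]
  refine squeeze_zero (fun n => norm_nonneg _) (fun n => ?_) (by simpa using hlim.const_mul c)
  set Bn := Metric.closedBall ((1 - r n) • x) (r n / 2) with hBn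
  have hsub : Bn ⊆ cube m := closedBall_subset_cube (hr0 n) (hr1 n) hxm
  have hvol : (volume Bn).toReal = r n ^ (m : ℝ) * ((1 / 2) ^ m * (volume (Metric.ball (0 : Euc m) 1)).toReal) := by
    rw [hBn, Measure.addHaar_closedBall _ _ (half_pos (hr0 n)).le, ENNReal.toReal_mul,
      ENNReal.toReal_ofReal (by have := hr0 n; positivity), Real.rpow_natCast]
    simp only [finrank_euclideanSpace, Fintype.card_fin]
    ring
  have hvol0 : 0 < (volume Bn).toReal :=
    ENNReal.toReal_pos (Metric.measure_closedBall_pos _ _ (half_pos (hr0 n))).ne'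
      measure_closedBall_lt_top.ne
  set U := (cube m).indicator u with hU
  have hUx : U x = u x := indicator_of_mem hxm u
  have h1 := integrable_mol_mul (hr0 n) hu x
  have h2 := integrable_mol_mul (hr0 n) (integrable_const (μ := cubeMeasure m) (u x)) x
  have e1 : avg (r n) u x - u x = ∫ z, mol (r n) x z * (u z - u x) ∂(cubeMeasure m) := by
    have h3 := avg_const (hr0 n) (hr1 n) hxm (u x)
    simp only [avg] at h3 ⊢
    simp only [mul_sub]
    rw [integral_sub h1 h2, h3]
  have e2 : ∫ z, mol (r n) x z * (u z - u x) ∂(cubeMeasure m) =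
      ∫ z in Bn, mol (r n) x z * (U z - U x) := by
    refine (setIntegral_eq_of_subset_of_forall_sdiff_eq_zero (measurableSet_cube m) hsub ?_).trans ?_
    rotate_left
    · refine setIntegral_congr_fun Metric.isClosed_closedBall.measurableSet fun z hz => ?_
      rw [hUx]
      simp only [hU, indicator_of_mem (hsub hz)]
    · intro z hz
      have : mol (r n) x z = 0 := by
        by_contra h'
        exact hz.2 (tsupport_mol_subset (hr0 n) x (subset_tsupport _ h'))
      simp [this]
  have hUi : IntegrableOn (fun z => U z - U x) Bn := by
    refine Integrable.sub ?_ ?_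
    · exact ((integrable_indicator_iff (measurableSet_cube m)).2 hu).integrableOn
    · exact integrableOn_const (measure_closedBall_lt_top.ne)
  rw [e1, e2, setAverage_eq, smul_eq_mul]
  calc ‖∫ z in Bn, mol (r n) x z * (U z - U x)‖
      ≤ ∫ z in Bn, bumpB m * r n ^ (-(m : ℝ)) * ‖U z - U x‖ := by
        refine norm_integral_le_of_norm_le (hUi.norm.const_mul _) (Eventually.of_forall fun z => ?_)
        rw [norm_mul, Real.norm_of_nonneg (mol_nonneg (hr0 n) x z)]
        exact mul_le_mul_of_nonneg_right (mol_le (hr0 n) x z) (norm_nonneg _)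
    _ = bumpB m * r n ^ (-(m : ℝ)) * ∫ z in Bn, ‖U z - U x‖ := integral_const_mul _ _
    _ = c * ((volume.real Bn)⁻¹ * ∫ z in Bn, ‖U z - U x‖) := by
        have hc : c = bumpB m * r n ^ (-(m : ℝ)) * (volume Bn).toReal := by
          rw [hvol, Real.rpow_neg (hr0 n).le]
          have : r n ^ (m : ℝ) ≠ 0 := (Real.rpow_pos_of_pos (hr0 n) _).ne'
          rw [hc0]
          field_simp
        rw [hc, Measure.real]
        field_simp

theorem norm_le_sum_apply_single (L : Euc m →L[ℝ] ℝ) :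
    ‖L‖ ≤ ∑ i, |L (EuclideanSpace.single i 1)| := by
  refine L.opNorm_le_bound (Finset.sum_nonneg fun i _ => abs_nonneg _) fun v => ?_
  have : L v = ∑ i, v i * L (EuclideanSpace.single i 1) := by
    conv_lhs => rw [← (EuclideanSpace.basisFun (Fin m) ℝ).sum_repr v]
    simp
  rw [this, Finset.sum_mul]
  refine (norm_sum_le _ _).trans (Finset.sum_le_sum fun i _ => ?_)
  rw [norm_mul, mul_comm, Real.norm_eq_abs, Real.norm_eq_abs]
  exact mul_le_mul_of_nonneg_left (abs_apply_le_norm v i) (abs_nonneg _)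

/-- A function with bounded weak gradient is Lipschitz continuous. -/
theorem ae_lipschitz_of_weakPartial {u : Euc m → ℝ} {g : Fin m → Euc m → ℝ}
    (hu : Integrable u (cubeMeasure m)) (h : ∀ i, IsWeakPartial i u (g i)) {L : ℝ≥0}
    (hg : ∀ i, ∀ᵐ x ∂(cubeMeasure m), ‖g i x‖ₑ ≤ L) :
    ∀ᵐ x ∂(cubeMeasure m), ∀ᵐ y ∂(cubeMeasure m), ‖u x - u y‖ₑ ≤ m * L * ‖x - y‖ₑ := by
  have hgr : ∀ r : ℝ, 0 < r → r ≤ 1 → ∀ x ∈ cube m, ∀ i, |avg r (g i) x| ≤ L := by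
    intro r hr hr1 x hx i
    have h1 : ‖avg r (g i) x‖ₑ ≤ L := by
      refine (enorm_avg_le hr (g i) x).trans ?_
      rw [← (isKernel_mol hr hr1 hx).lintegral_mul_const (L : ℝ≥0∞)]
      refine lintegral_mono_ae ?_
      filter_upwards [hg i] with z hz
      gcongr
    rw [← ofReal_norm, ENNReal.ofReal_le_iff_le_toReal ENNReal.coe_ne_top] at h1
    simpa using h1
  -- The mean value inequality on the convex cube, applied to the mollifications with a constant
  -- uniform in `r`. The bound passes to the limit at points of convergence.
  have hlip : ∀ r : ℝ, 0 < r → r ≤ 1 → ∀ x ∈ cube m, ∀ y ∈ cube m,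
      ‖avg r u x - avg r u y‖ ≤ m * L * ‖x - y‖ := by
    intro r hr hr1 x hx y hy
    refine (convex_cube m).norm_image_sub_le_of_norm_fderiv_le (𝕜 := ℝ)
      (fun z _ => (contDiff_avg hr hu).differentiable (by simp) z) (fun z hz => ?_) hy hx
    calc ‖fderiv ℝ (avg r u) z‖ ≤ ∑ i, |fderiv ℝ (avg r u) z (EuclideanSpace.single i 1)| :=
          norm_le_sum_apply_single _
      _ ≤ ∑ _i : Fin m, (L : ℝ) := Finset.sum_le_sum fun i _ => by
          rw [fderiv_avg (h i) hu hr hr1 hz, abs_mul, abs_of_nonneg (by linarith)]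
          nlinarith [hgr r hr hr1 z hz i, abs_nonneg (avg r (g i) z)]
      _ = m * L := by simp
  filter_upwards [ae_tendsto_avg hu, ae_cubeMeasure_mem m] with x hx hxm
  filter_upwards [ae_tendsto_avg hu, ae_cubeMeasure_mem m] with y hy hym
  have hlim := le_of_tendsto' (hx.sub hy).norm fun n =>
    hlip (1 / 2 ^ n) (by positivity)
      (div_le_one_of_le₀ (one_le_pow₀ (by norm_num)) (by positivity)) x hxm y hym
  have e : (m : ℝ≥0∞) * L * ‖x - y‖ₑ = .ofReal (m * L * ‖x - y‖) := by
    rw [ENNReal.ofReal_mul (by positivity), ENNReal.ofReal_mul (by positivity), ofReal_norm,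
      ENNReal.ofReal_coe_nnreal, ENNReal.ofReal_natCast]
  rw [e, ← ofReal_norm]
  exact ENNReal.ofReal_le_ofReal hlim

end Slices

/-! ### Weighted mixed norms -/

section WeightedNorm

variable {X Y : Type*} [MeasurableSpace X] [MeasurableSpace Y]

/-- A weighted `L_p`-norm on a product, written as an iterated integral. -/
def wNorm (p : ℝ) (μ : Measure X) (ν : Measure Y) (w F : X → Y → ℝ≥0∞) : ℝ≥0∞ :=
  (∫⁻ x, ∫⁻ y, F x y ^ p / w x y ∂ν ∂μ) ^ (1 / p)

variable {μ : Measure X} {ν : Measure Y} {w F G H : X → Y → ℝ≥0∞} {p : ℝ}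

theorem wNorm_mono (hp : 0 < p) (h : ∀ᵐ x ∂μ, ∀ᵐ y ∂ν, F x y ≤ G x y) :
    wNorm p μ ν w F ≤ wNorm p μ ν w G := by
  refine ENNReal.rpow_le_rpow (lintegral_mono_ae ?_) (by positivity)
  filter_upwards [h] with x hx
  refine lintegral_mono_ae ?_
  filter_upwards [hx] with y hy
  gcongr

theorem wNorm_const_mul (hp : 0 < p) (c : ℝ≥0) :
    wNorm p μ ν w (fun x y => c * F x y) = c * wNorm p μ ν w F := by
  have h : ∀ x y, ((c : ℝ≥0∞) * F x y) ^ p / w x y = (c : ℝ≥0∞) ^ p * (F x y ^ p / w x y) :=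
    fun x y => by rw [ENNReal.mul_rpow_of_nonneg _ _ hp.le, mul_div_assoc]
  have hc : (c : ℝ≥0∞) ^ p ≠ ⊤ := ENNReal.rpow_ne_top_of_nonneg hp.le ENNReal.coe_ne_top
  simp only [wNorm, h, lintegral_const_mul' _ _ hc]
  rw [ENNReal.mul_rpow_of_nonneg _ _ (by positivity), ← ENNReal.rpow_mul, mul_one_div_cancel hp.ne',
    ENNReal.rpow_one]

/-- Minkowski's inequality on the product space after absorbing the weight as `F / w ^ (1 / p)`. No
measurability of `H` is needed, since it enters only through the pointwise bound. -/
theorem wNorm_le_add [SFinite ν] (hp : 1 ≤ p) (hw : Measurable (Function.uncurry w))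
    (hF : AEMeasurable (Function.uncurry F) (μ.prod ν))
    (hG : AEMeasurable (Function.uncurry G) (μ.prod ν))
    (h : ∀ᵐ x ∂μ, ∀ᵐ y ∂ν, H x y ≤ F x y + G x y) :
    wNorm p μ ν w H ≤ wNorm p μ ν w F + wNorm p μ ν w G := by
  have hp0 : 0 < p := by linarith
  refine (wNorm_mono hp0 h).trans ?_
  have e : ∀ K : X → Y → ℝ≥0∞, AEMeasurable (Function.uncurry K) (μ.prod ν) →
      wNorm p μ ν w K =
        (∫⁻ z, (Function.uncurry K z / Function.uncurry w z ^ (1 / p)) ^ p ∂(μ.prod ν)) ^ (1 / p) := by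
    intro K hK
    have hd : AEMeasurable (fun z => Function.uncurry K z / Function.uncurry w z ^ (1 / p))
        (μ.prod ν) := hK.div (hw.pow_const (1 / p)).aemeasurable
    rw [lintegral_prod _ (hd.pow_const p), wNorm]
    simp only [Function.uncurry_apply_pair, ENNReal.div_rpow_of_nonneg _ _ hp0.le,
      ← ENNReal.rpow_mul, one_div_mul_cancel hp0.ne', ENNReal.rpow_one]
  rw [e F hF, e G hG, e (fun x y => F x y + G x y) (hF.add hG)]
  have key := ENNReal.lintegral_Lp_add_le (hF.div (hw.pow_const (1 / p)).aemeasurable)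
    (hG.div (hw.pow_const (1 / p)).aemeasurable) hp
  refine le_trans (le_of_eq ?_) key
  congr 2
  ext z
  simp [Function.uncurry, ENNReal.add_div]

end WeightedNorm

/-! ### Products on the cube -/

section Products

variable {m : ℕ}

theorem cubeSeminorm_eq_wNorm (p s : ℝ) (u : Euc m → ℝ) :
    cubeSeminorm p s u = wNorm p (cubeMeasure m) (cubeMeasure m)
      (fun x y => ‖x - y‖ₑ ^ ((m : ℝ) + s * p)) (fun x y => ‖u x - u y‖ₑ) := rfl

theorem measurable_cube_weight (a : ℝ) :
    Measurable (Function.uncurry fun x y : Euc m => ‖x - y‖ₑ ^ a) :=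
  (measurable_fst.sub measurable_snd).enorm.pow_const a

theorem aemeasurable_diff {u : Euc m → ℝ} (hu : AEStronglyMeasurable u (cubeMeasure m)) :
    AEMeasurable (Function.uncurry fun x y => ‖u x - u y‖ₑ)
      ((cubeMeasure m).prod (cubeMeasure m)) :=
  (hu.comp_fst.sub hu.comp_snd).enorm

theorem cubeSeminorm_add_le {p s : ℝ} (hp : 1 ≤ p) {u v : Euc m → ℝ}
    (hu : AEStronglyMeasurable u (cubeMeasure m)) (hv : AEStronglyMeasurable v (cubeMeasure m)) :
    cubeSeminorm p s (u + v) ≤ cubeSeminorm p s u + cubeSeminorm p s v := by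
  simp only [cubeSeminorm_eq_wNorm]
  refine wNorm_le_add hp (measurable_cube_weight _) (aemeasurable_diff hu) (aemeasurable_diff hv)
    (Eventually.of_forall fun x => Eventually.of_forall fun y => ?_)
  have : (u + v) x - (u + v) y = (u x - u y) + (v x - v y) := by
    simp only [Pi.add_apply]; ring
  rw [this]
  exact enorm_add_le _ _

theorem cubeSeminorm_neg (p s : ℝ) (u : Euc m → ℝ) :
    cubeSeminorm p s (-u) = cubeSeminorm p s u := by
  simp only [cubeSeminorm]
  congr! 7 with x y
  rw [← enorm_neg]
  congr 1
  simp only [Pi.neg_apply]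
  ring

theorem cubeSeminorm_sub_le {p s : ℝ} (hp : 1 ≤ p) {u v : Euc m → ℝ}
    (hu : AEStronglyMeasurable u (cubeMeasure m)) (hv : AEStronglyMeasurable v (cubeMeasure m)) :
    cubeSeminorm p s (u - v) ≤ cubeSeminorm p s u + cubeSeminorm p s v := by
  rw [sub_eq_add_neg, ← cubeSeminorm_neg p s v]
  exact cubeSeminorm_add_le hp hu hv.neg

/-- The first factor is evaluated at the first point and the second factor at the second. Thus a
bound on each factor in its own variable suffices for the iterated integrals. -/
theorem enorm_mul_sub_mul_le (a b c d : ℝ) :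
    ‖a * b - c * d‖ₑ ≤ ‖a‖ₑ * ‖b - d‖ₑ + ‖d‖ₑ * ‖a - c‖ₑ := by
  rw [show a * b - c * d = a * (b - d) + d * (a - c) by ring]
  exact (enorm_add_le _ _).trans (by rw [enorm_mul, enorm_mul])

theorem cubeSeminorm_mul_le {p s : ℝ} (hp : 1 ≤ p) {u v : Euc m → ℝ}
    (hu : AEStronglyMeasurable u (cubeMeasure m)) (hv : AEStronglyMeasurable v (cubeMeasure m))
    {a b : ℝ≥0} (ha : ∀ᵐ x ∂(cubeMeasure m), ‖u x‖ₑ ≤ a) (hb : ∀ᵐ x ∂(cubeMeasure m), ‖v x‖ₑ ≤ b) :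
    cubeSeminorm p s (u * v) ≤ a * cubeSeminorm p s v + b * cubeSeminorm p s u := by
  simp only [cubeSeminorm_eq_wNorm]
  rw [← wNorm_const_mul (by linarith) a, ← wNorm_const_mul (by linarith) b]
  refine wNorm_le_add hp (measurable_cube_weight _) ((aemeasurable_diff hv).const_mul _)
    ((aemeasurable_diff hu).const_mul _) ?_
  filter_upwards [ha] with x hx
  filter_upwards [hb] with y hy
  refine (enorm_mul_sub_mul_le _ _ _ _).trans ?_
  gcongr

theorem cubeLp_mul_le {p : ℝ} {u v : Euc m → ℝ} {a : ℝ≥0}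
    (ha : ∀ᵐ x ∂(cubeMeasure m), ‖u x‖ₑ ≤ a) : cubeLp p (u * v) ≤ a * cubeLp p v := by
  refine eLpNorm_le_nnreal_smul_eLpNorm_of_ae_le_mul (c := a) ?_ _
  filter_upwards [ha] with x hx
  rw [Pi.mul_apply, nnnorm_mul]
  gcongr
  exact_mod_cast hx

theorem cubeLp_add_le {p : ℝ} (hp : 1 ≤ p) {u v : Euc m → ℝ}
    (hu : AEStronglyMeasurable u (cubeMeasure m)) (hv : AEStronglyMeasurable v (cubeMeasure m)) :
    cubeLp p (u + v) ≤ cubeLp p u + cubeLp p v :=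
  eLpNorm_add_le hu hv (by simpa using hp)

/-- In polar coordinates the integrand is the power `p - s * p - 1` of the radius, integrable at
zero because `s < 1`. Differences of points of the cube stay in a fixed ball, so the bound is
uniform in `x`. -/
theorem exists_const_lintegral_weight_le {p s : ℝ} (hm : 1 ≤ m) (hp : 0 < p) (hs : s < 1) :
    ∃ K : ℝ≥0, ∀ x ∈ cube m,
      ∫⁻ y, ‖x - y‖ₑ ^ p / ‖x - y‖ₑ ^ ((m : ℝ) + s * p) ∂(cubeMeasure m) ≤ K := by
  have hm0 : (0 : ℝ) < m := by exact_mod_cast hm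
  have : Nontrivial (Euc m) := by
    have : Nonempty (Fin m) := ⟨⟨0, hm⟩⟩
    infer_instance
  have h1 : IntegrableOn (fun y : Euc m => ‖y‖ ^ (p - (m + s * p))) (Metric.ball 0 (2 * m + 1)) := by
    rw [integrableOn_fun_norm_addHaar (μ := volume) (f := fun y : ℝ => y ^ (p - (m + s * p)))]
    have h2 : IntegrableOn (fun y : ℝ => y ^ (p - s * p - 1)) (Ioo 0 (2 * m + 1)) :=
      (intervalIntegral.integrableOn_Ioo_rpow_iff (by positivity)).2 (by nlinarith)
    refine h2.congr_fun (fun y hy => ?_) measurableSet_Ioo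
    simp only [finrank_euclideanSpace, Fintype.card_fin, smul_eq_mul]
    rw [← Real.rpow_natCast, ← Real.rpow_add hy.1, Nat.cast_sub hm]
    congr 1
    push_cast
    ring
  have h3 := h1.hasFiniteIntegral
  rw [HasFiniteIntegral] at h3
  refine ⟨(∫⁻ y in Metric.ball (0 : Euc m) (2 * m + 1), ‖‖y‖ ^ (p - (m + s * p))‖ₑ).toNNReal,
    fun x hx => ?_⟩
  rw [ENNReal.coe_toNNReal h3.ne]
  have e : ∀ y : Euc m, y ≠ 0 → ‖y‖ₑ ^ p / ‖y‖ₑ ^ ((m : ℝ) + s * p) = ‖‖y‖ ^ (p - (m + s * p))‖ₑ := by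
    intro y hy
    have h0 : 0 < ‖y‖ := norm_pos_iff.2 hy
    rw [Real.enorm_of_nonneg (by positivity), ← ENNReal.ofReal_rpow_of_pos h0, ofReal_norm,
      ENNReal.rpow_sub _ _ (by simpa using hy) (by simp)]
  set f : Euc m → ℝ≥0∞ := (Metric.ball (0 : Euc m) (2 * m + 1)).indicator
    fun y => ‖‖y‖ ^ (p - (m + s * p))‖ₑ with hf
  calc ∫⁻ y, ‖x - y‖ₑ ^ p / ‖x - y‖ₑ ^ ((m : ℝ) + s * p) ∂(cubeMeasure m)
      ≤ ∫⁻ y, f (x - y) ∂(cubeMeasure m) := by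
        refine lintegral_mono_ae ?_
        filter_upwards [ae_cubeMeasure_mem m] with y hy
        rcases eq_or_ne (x - y) 0 with h0 | h0
        · rw [h0]
          simp [hp]
        · have hb : x - y ∈ Metric.ball (0 : Euc m) (2 * m + 1) := by
            rw [mem_ball_zero_iff]
            linarith [norm_sub_le x y, norm_le_of_mem_cube hx, norm_le_of_mem_cube hy]
          rw [hf, indicator_of_mem hb, e _ h0]
    _ ≤ ∫⁻ y, f (x - y) := setLIntegral_le_lintegral _ _
    _ = ∫⁻ y, f y := lintegral_sub_left_eq_self f x
    _ = _ := lintegral_indicator Metric.isOpen_ball.measurableSet _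

/-- The Lipschitz part of the seminorm of a product. -/
theorem exists_const_wNorm_lipschitz_le {p s : ℝ} (hm : 1 ≤ m) (hp : 1 ≤ p) (hs : s < 1) :
    ∃ K : ℝ≥0, ∀ (u v : Euc m → ℝ) (l : ℝ≥0), AEStronglyMeasurable u (cubeMeasure m) →
      (∀ᵐ x ∂(cubeMeasure m), ∀ᵐ y ∂(cubeMeasure m), ‖v x - v y‖ₑ ≤ l * ‖x - y‖ₑ) →
      wNorm p (cubeMeasure m) (cubeMeasure m) (fun x y => ‖x - y‖ₑ ^ ((m : ℝ) + s * p))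
        (fun x y => ‖u x‖ₑ * ‖v x - v y‖ₑ) ≤ K * l * cubeLp p u := by
  have hp0 : 0 < p := by linarith
  obtain ⟨K, hK⟩ := exists_const_lintegral_weight_le hm hp0 hs
  refine ⟨K ^ (1 / p), fun u v l hu hv => ?_⟩
  calc _ ≤ wNorm p (cubeMeasure m) (cubeMeasure m) (fun x y => ‖x - y‖ₑ ^ ((m : ℝ) + s * p))
        (fun x y => l * (‖u x‖ₑ * ‖x - y‖ₑ)) := by
        refine wNorm_mono hp0 ?_
        filter_upwards [hv] with x hx
        filter_upwards [hx] with y hy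
        calc _ ≤ ‖u x‖ₑ * (l * ‖x - y‖ₑ) := by gcongr
          _ = _ := by ring
    _ = l * wNorm p (cubeMeasure m) (cubeMeasure m) (fun x y => ‖x - y‖ₑ ^ ((m : ℝ) + s * p))
        (fun x y => ‖u x‖ₑ * ‖x - y‖ₑ) := wNorm_const_mul hp0 l
    _ ≤ l * ((K : ℝ≥0∞) ^ (1 / p) * cubeLp p u) := by
        gcongr
        rw [cubeLp_eq hp0, ← ENNReal.mul_rpow_of_nonneg _ _ (by positivity), wNorm]
        refine ENNReal.rpow_le_rpow ?_ (by positivity)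
        rw [← lintegral_const_mul'' _ (hu.enorm.pow_const p)]
        refine lintegral_mono_ae ?_
        filter_upwards [ae_cubeMeasure_mem m] with x hx
        have : ∀ y, (‖u x‖ₑ * ‖x - y‖ₑ) ^ p / ‖x - y‖ₑ ^ ((m : ℝ) + s * p) =
            ‖u x‖ₑ ^ p * (‖x - y‖ₑ ^ p / ‖x - y‖ₑ ^ ((m : ℝ) + s * p)) := fun y => by
          rw [ENNReal.mul_rpow_of_nonneg _ _ hp0.le, mul_div_assoc]
        simp only [this]
        rw [lintegral_const_mul' _ _ (ENNReal.rpow_ne_top_of_nonneg hp0.le enorm_ne_top), mul_comm]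
        exact mul_le_mul_left (hK x hx) _
    _ = _ := by
        rw [ENNReal.coe_rpow_of_nonneg _ (by positivity)]
        ring

/-- The factor `u` is not assumed bounded: where it multiplies a difference of `v`, the Lipschitz
bound makes the weight integrable and leaves only the `L_p`-norm of `u`. This serves for the
unbounded factor in the products below. -/
theorem exists_const_cubeSeminorm_mul_lipschitz_le {p s : ℝ} (hm : 1 ≤ m) (hp : 1 ≤ p) (hs : s < 1) :
    ∃ K : ℝ≥0, ∀ (u v : Euc m → ℝ) (b l : ℝ≥0), AEStronglyMeasurable u (cubeMeasure m) →
      AEStronglyMeasurable v (cubeMeasure m) → (∀ᵐ x ∂(cubeMeasure m), ‖v x‖ₑ ≤ b) →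
      (∀ᵐ x ∂(cubeMeasure m), ∀ᵐ y ∂(cubeMeasure m), ‖v x - v y‖ₑ ≤ l * ‖x - y‖ₑ) →
      cubeSeminorm p s (u * v) ≤ b * cubeSeminorm p s u + K * l * cubeLp p u := by
  obtain ⟨K, hK⟩ := exists_const_wNorm_lipschitz_le hm hp hs
  refine ⟨K, fun u v b l hu hv hb hl => ?_⟩
  rw [add_comm]
  refine le_trans ?_ (add_le_add_left (hK u v l hu hl) _)
  simp only [cubeSeminorm_eq_wNorm]
  rw [← wNorm_const_mul (by linarith) b]
  refine wNorm_le_add hp (measurable_cube_weight _) ?_ ((aemeasurable_diff hu).const_mul _) ?_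
  · exact hu.comp_fst.enorm.mul (aemeasurable_diff hv)
  · refine Eventually.of_forall fun x => ?_
    filter_upwards [hb] with y hy
    refine (enorm_mul_sub_mul_le _ _ _ _).trans ?_
    gcongr

theorem exists_const_cubeSeminorm_lipschitz_le {p s : ℝ} (hm : 1 ≤ m) (hp : 1 ≤ p) (hs : s < 1) :
    ∃ K : ℝ≥0, ∀ (v : Euc m → ℝ) (l : ℝ≥0),
      (∀ᵐ x ∂(cubeMeasure m), ∀ᵐ y ∂(cubeMeasure m), ‖v x - v y‖ₑ ≤ l * ‖x - y‖ₑ) →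
      cubeSeminorm p s v ≤ K * l := by
  obtain ⟨K, hK⟩ := exists_const_wNorm_lipschitz_le hm hp hs
  have h1 : cubeLp p (fun _ : Euc m => (1 : ℝ)) ≠ ⊤ :=
    (memLp_const (μ := cubeMeasure m) (p := ENNReal.ofReal p) (1 : ℝ)).2.ne
  refine ⟨K * (cubeLp p (fun _ : Euc m => (1 : ℝ))).toNNReal, fun v l hl => ?_⟩
  have := hK (fun _ => 1) v l aestronglyMeasurable_const hl
  simp only [enorm_one, one_mul] at this
  rw [cubeSeminorm_eq_wNorm]
  refine this.trans (le_of_eq ?_)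
  rw [ENNReal.coe_mul, ENNReal.coe_toNNReal h1]
  ring

end Products

/-! ### Weak derivatives of products -/

section WeakDerivatives

variable {m : ℕ} {i : Fin m}

theorem exists_test_bound {φ : Euc m → ℝ} (hφ : ContDiff ℝ ∞ φ) (hc : HasCompactSupport φ) :
    ∃ B : ℝ, (∀ x, ‖φ x‖ ≤ B) ∧ ∀ i x, ‖fderiv ℝ φ x (EuclideanSpace.single i 1)‖ ≤ B := by
  obtain ⟨B1, h1⟩ := hc.exists_bound_of_continuous hφ.continuous
  obtain ⟨B2, h2⟩ := (hc.fderiv (𝕜 := ℝ)).exists_bound_of_continuous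
    (hφ.continuous_fderiv (by simp))
  refine ⟨max B1 B2, fun x => (h1 x).trans (le_max_left _ _), fun i x => ?_⟩
  refine ((fderiv ℝ φ x).le_opNorm _).trans ?_
  simpa using (h2 x).trans (le_max_right _ _)

theorem continuous_fderiv_test {φ : Euc m → ℝ} (hφ : ContDiff ℝ ∞ φ) (i : Fin m) :
    Continuous fun x => fderiv ℝ φ x (EuclideanSpace.single i 1) :=
  (hφ.continuous_fderiv (by simp)).clm_apply continuous_const

theorem integrable_mul_test {u φ : Euc m → ℝ} (hu : Integrable u (cubeMeasure m))
    (hφ : ContDiff ℝ ∞ φ) (hc : HasCompactSupport φ) :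
    Integrable (fun x => u x * φ x) (cubeMeasure m) := by
  obtain ⟨B, h1, -⟩ := exists_test_bound hφ hc
  exact hu.mul_bdd (c := B) hφ.continuous.aestronglyMeasurable (Eventually.of_forall h1)

theorem integrable_mul_fderiv_test {u φ : Euc m → ℝ} (hu : Integrable u (cubeMeasure m))
    (hφ : ContDiff ℝ ∞ φ) (hc : HasCompactSupport φ) (i : Fin m) :
    Integrable (fun x => u x * fderiv ℝ φ x (EuclideanSpace.single i 1)) (cubeMeasure m) := by
  obtain ⟨B, -, h1⟩ := exists_test_bound hφ hc
  exact hu.mul_bdd (c := B) (continuous_fderiv_test hφ i).aestronglyMeasurable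
    (Eventually.of_forall (h1 i))

theorem locallyIntegrableOn_of_integrable {u : Euc m → ℝ} (hu : Integrable u (cubeMeasure m)) :
    LocallyIntegrableOn u (cube m) volume := IntegrableOn.locallyIntegrableOn hu

/-- The fundamental lemma of the calculus of variations applied to `g - g'`. It shows that the
infimum in `cubeW1` is attained by any weak gradient. -/
theorem IsWeakPartial.ae_unique {u g g' : Euc m → ℝ} (h : IsWeakPartial i u g)
    (h' : IsWeakPartial i u g') : g =ᵐ[cubeMeasure m] g' := by
  have key := (isOpen_cube m).ae_eq_zero_of_integral_contDiff_smul_eq_zero (μ := volume)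
    (h.locInt_deriv.sub h'.locInt_deriv) fun φ hφ hc hs => ?_
  · rw [cubeMeasure, Filter.EventuallyEq, ae_restrict_iff' (measurableSet_cube m)]
    filter_upwards [key] with x hx hxm
    exact sub_eq_zero.1 (hx hxm)
  · have e : ∀ f : Euc m → ℝ, LocallyIntegrableOn f (cube m) volume →
        IntegrableOn (fun x => f x * φ x) (cube m) := fun f hf => by
      have h1 : IntegrableOn f (tsupport φ) := hf.integrableOn_compact_subset hs hc
      obtain ⟨B, hB, -⟩ := exists_test_bound hφ hc
      have h2 : IntegrableOn (fun x => f x * φ x) (tsupport φ) :=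
        Integrable.mul_bdd (c := B) h1 hφ.continuous.aestronglyMeasurable (Eventually.of_forall hB)
      refine ((integrableOn_iff_integrable_of_support_subset ?_).1 h2).integrableOn
      exact fun x hx => subset_tsupport φ fun h0 => hx (by simp [h0])
    have e1 := e g h.locInt_deriv
    have e2 := e g' h'.locInt_deriv
    have e3 : ∫ x in cube m, g x * φ x = ∫ x in cube m, g' x * φ x := by
      have := (h.integral_eq φ hφ hc hs).symm.trans (h'.integral_eq φ hφ hc hs)
      exact neg_inj.1 this
    have hsup : Function.support (fun x => φ x • (g - g') x) ⊆ cube m := fun x hx =>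
      hs (subset_tsupport φ fun h0 => hx (by simp [h0]))
    rw [← setIntegral_of_support hsup]
    have : ∀ x, φ x • (g - g') x = g x * φ x - g' x * φ x := fun x => by
      simp only [Pi.sub_apply, smul_eq_mul]; ring
    simp only [this]
    rw [integral_sub e1 e2, e3, sub_self]

theorem IsWeakPartial.congr {u u' g : Euc m → ℝ} (h : IsWeakPartial i u g)
    (hu : u =ᵐ[cubeMeasure m] u') : IsWeakPartial i u' g where
  locInt := h.locInt.congr hu
  locInt_deriv := h.locInt_deriv
  integral_eq φ hφ hc hs := by
    rw [← h.integral_eq φ hφ hc hs]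
    refine integral_congr_ae ?_
    filter_upwards [hu] with x hx
    rw [hx]

theorem IsWeakPartial.congr_deriv {u g g' : Euc m → ℝ} (h : IsWeakPartial i u g)
    (hg : g =ᵐ[cubeMeasure m] g') : IsWeakPartial i u g' where
  locInt := h.locInt
  locInt_deriv := h.locInt_deriv.congr hg
  integral_eq φ hφ hc hs := by
    rw [h.integral_eq φ hφ hc hs]
    congr 1
    refine integral_congr_ae ?_
    filter_upwards [hg] with x hx
    rw [hx]

theorem IsWeakPartial.sub {u u' g g' : Euc m → ℝ} (h : IsWeakPartial i u g)
    (h' : IsWeakPartial i u' g') (hu : Integrable u (cubeMeasure m))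
    (hu' : Integrable u' (cubeMeasure m)) (hg : Integrable g (cubeMeasure m))
    (hg' : Integrable g' (cubeMeasure m)) : IsWeakPartial i (u - u') (g - g') where
  locInt := h.locInt.sub h'.locInt
  locInt_deriv := h.locInt_deriv.sub h'.locInt_deriv
  integral_eq φ hφ hc hs := by
    simp only [Pi.sub_apply, sub_mul]
    have h1 := integral_sub (integrable_mul_fderiv_test hu hφ hc i)
      (integrable_mul_fderiv_test hu' hφ hc i)
    have h2 := integral_sub (integrable_mul_test hg hφ hc) (integrable_mul_test hg' hφ hc)
    rw [cubeMeasure] at h1 h2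
    rw [h1, h2, h.integral_eq φ hφ hc hs, h'.integral_eq φ hφ hc hs]
    ring

theorem norm_le_of_enorm_le {a : ℝ} {b : ℝ≥0} (h : ‖a‖ₑ ≤ b) : ‖a‖ ≤ b := by
  rw [← coe_nnnorm]
  exact_mod_cast (show (‖a‖₊ : ℝ≥0∞) ≤ b from h)

theorem abs_avg_le_of_ae_le {r : ℝ} (hr : 0 < r) (hr1 : r ≤ 1) {x : Euc m} (hx : x ∈ cube m)
    {u : Euc m → ℝ} {b : ℝ≥0} (hb : ∀ᵐ x ∂(cubeMeasure m), ‖u x‖ₑ ≤ b) : ‖avg r u x‖ ≤ b := by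
  refine norm_le_of_enorm_le ((enorm_avg_le hr u x).trans ?_)
  rw [← (isKernel_mol hr hr1 hx).lintegral_mul_const (b : ℝ≥0∞)]
  refine lintegral_mono_ae ?_
  filter_upwards [hb] with z hz
  gcongr

theorem integrable_of_ae_le {u : Euc m → ℝ} (hu : AEStronglyMeasurable u (cubeMeasure m))
    {b : ℝ≥0} (hb : ∀ᵐ x ∂(cubeMeasure m), ‖u x‖ₑ ≤ b) : Integrable u (cubeMeasure m) :=
  Integrable.of_bound hu b (by filter_upwards [hb] with x hx using norm_le_of_enorm_le hx)

/-- The product rule for weak derivatives of bounded functions. -/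
theorem IsWeakPartial.mul {u v g h : Euc m → ℝ} (hu : IsWeakPartial i u g)
    (hv : IsWeakPartial i v h) (mu : AEStronglyMeasurable u (cubeMeasure m))
    (mv : AEStronglyMeasurable v (cubeMeasure m)) (mh : AEStronglyMeasurable h (cubeMeasure m))
    (ig : Integrable g (cubeMeasure m)) {a b c : ℝ≥0}
    (ha : ∀ᵐ x ∂(cubeMeasure m), ‖u x‖ₑ ≤ a) (hb : ∀ᵐ x ∂(cubeMeasure m), ‖v x‖ₑ ≤ b)
    (hc : ∀ᵐ x ∂(cubeMeasure m), ‖h x‖ₑ ≤ c) :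
    IsWeakPartial i (u * v) (u * h + v * g) := by
  have iu := integrable_of_ae_le mu ha
  have iv := integrable_of_ae_le mv hb
  have ih := integrable_of_ae_le mh hc
  have iuv : Integrable (u * v) (cubeMeasure m) := iu.mul_bdd (c := b) mv
    (by filter_upwards [hb] with x hx using norm_le_of_enorm_le hx)
  have iuh : Integrable (u * h) (cubeMeasure m) := iu.mul_bdd (c := c) mh
    (by filter_upwards [hc] with x hx using norm_le_of_enorm_le hx)
  have ivg : Integrable (v * g) (cubeMeasure m) := ig.bdd_mul (c := b) mv
    (by filter_upwards [hb] with x hx using norm_le_of_enorm_le hx)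
  refine ⟨locallyIntegrableOn_of_integrable iuv,
    locallyIntegrableOn_of_integrable (iuh.add ivg), fun φ hφ hcs hs => ?_⟩
  obtain ⟨B, hB1, hB2⟩ := exists_test_bound hφ hcs
  have hB0 : 0 ≤ B := (norm_nonneg _).trans (hB1 0)
  set r : ℕ → ℝ := fun n => 1 / 2 ^ n with hr
  have hr0 : ∀ n, 0 < r n := fun n => by positivity
  have hr1 : ∀ n, r n ≤ 1 := fun n => by
    rw [hr]; exact div_le_one_of_le₀ (one_le_pow₀ (by norm_num)) (by positivity)
  have hrlim : Tendsto r atTop (𝓝 0) := by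
    have := tendsto_pow_atTop_nhds_zero_of_lt_one (r := (1 / 2 : ℝ)) (by norm_num) (by norm_num)
    simpa [hr] using this
  have hw : ∀ n, ContDiff ℝ ∞ (avg (r n) v) := fun n => contDiff_avg (hr0 n) iv
  -- The weak derivative of `u` is tested against `φ` times a mollification of `v`, which is smooth
  -- and supported where `φ` is. The product rule for `u * v` is the limit of these identities.
  have eq : ∀ n, ∫ x, (u x * (φ x * ((1 - r n) * avg (r n) h x)) +
      u x * (avg (r n) v x * fderiv ℝ φ x (EuclideanSpace.single i 1))) ∂(cubeMeasure m) =
      - ∫ x, g x * (φ x * avg (r n) v x) ∂(cubeMeasure m) := fun n => by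
    have := hu.integral_eq (fun x => φ x * avg (r n) v x) (hφ.mul (hw n)) hcs.mul_right
      ((tsupport_mul_subset_left).trans hs)
    rw [cubeMeasure, ← this]
    refine setIntegral_congr_fun (measurableSet_cube m) fun x hx => ?_
    have h1 : fderiv ℝ (fun x => φ x * avg (r n) v x) x =
        φ x • fderiv ℝ (avg (r n) v) x + avg (r n) v x • fderiv ℝ φ x :=
      fderiv_fun_mul (hφ.differentiable (by simp) x) ((hw n).differentiable (by simp) x)
    simp only [h1, add_apply, smul_apply, smul_eq_mul, fderiv_avg hv iv (hr0 n) (hr1 n) hx]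
    ring
  have lim1 : Tendsto (fun n => ∫ x, (u x * (φ x * ((1 - r n) * avg (r n) h x)) +
      u x * (avg (r n) v x * fderiv ℝ φ x (EuclideanSpace.single i 1))) ∂(cubeMeasure m)) atTop
      (𝓝 (∫ x, (u x * (φ x * h x) + u x * (v x * fderiv ℝ φ x (EuclideanSpace.single i 1)))
        ∂(cubeMeasure m))) := by
    refine tendsto_integral_of_dominated_convergence
      (fun _ => a * (B * c) + a * (b * B)) (fun n => ?_) (integrable_const _) (fun n => ?_) ?_
    · have c1 := (contDiff_avg (hr0 n) ih).continuous
      have c2 := (hw n).continuous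
      have c3 := continuous_fderiv_test hφ i
      have c4 := hφ.continuous
      exact (mu.mul (by fun_prop : Continuous fun x => φ x * ((1 - r n) * avg (r n) h x)).aestronglyMeasurable).add
        (mu.mul (c2.mul c3).aestronglyMeasurable)
    · filter_upwards [ha, ae_cubeMeasure_mem m] with x hx hxm
      have h1 := norm_le_of_enorm_le hx
      have h2 := abs_avg_le_of_ae_le (hr0 n) (hr1 n) hxm hb
      have h3 := abs_avg_le_of_ae_le (hr0 n) (hr1 n) hxm hc
      have h4 : ‖1 - r n‖ ≤ 1 := by
        rw [Real.norm_eq_abs, abs_le]; constructor <;> linarith [hr0 n, hr1 n]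
      refine (norm_add_le _ _).trans ?_
      simp only [norm_mul]
      have h5 : ‖1 - r n‖ * ‖avg (r n) h x‖ ≤ c := by
        nlinarith [norm_nonneg (avg (r n) h x), norm_nonneg (1 - r n)]
      gcongr
      · exact hB1 x
      · exact hB2 i x
    · filter_upwards [ae_tendsto_avg iv, ae_tendsto_avg ih] with x h1 h2
      have h3 : Tendsto (fun n => 1 - r n) atTop (𝓝 1) := by
        simpa using hrlim.const_sub 1
      have h4 := h3.mul h2
      rw [one_mul] at h4
      exact ((h4.const_mul _).const_mul _).add ((h1.mul_const _).const_mul _)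
  -- Only integrability of `g` is available here; the dominating function is a multiple of `‖g‖`,
  -- because the mollifications of `v` inherit its bound.
  have lim2 : Tendsto (fun n => - ∫ x, g x * (φ x * avg (r n) v x) ∂(cubeMeasure m)) atTop
      (𝓝 (- ∫ x, g x * (φ x * v x) ∂(cubeMeasure m))) := by
    refine (tendsto_integral_of_dominated_convergence
      (fun x => ‖g x‖ * (B * b)) (fun n => ?_) (ig.norm.mul_const _) (fun n => ?_) ?_).neg
    · exact ig.aestronglyMeasurable.mul (hφ.continuous.mul (hw n).continuous).aestronglyMeasurable
    · filter_upwards [ae_cubeMeasure_mem m] with x hxm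
      have h2 := abs_avg_le_of_ae_le (hr0 n) (hr1 n) hxm hb
      simp only [norm_mul]
      gcongr
      exact hB1 x
    · filter_upwards [ae_tendsto_avg iv] with x h1
      exact (h1.const_mul _).const_mul _
  have key := tendsto_nhds_unique (lim1.congr eq) lim2
  have j1 : Integrable (fun x => u x * (φ x * h x)) (cubeMeasure m) :=
    (integrable_mul_test iuh hφ hcs).congr (Eventually.of_forall fun x => by
      simp only [Pi.mul_apply]; ring)
  have j2 : Integrable (fun x => u x * (v x * fderiv ℝ φ x (EuclideanSpace.single i 1)))
      (cubeMeasure m) :=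
    (integrable_mul_fderiv_test iuv hφ hcs i).congr (Eventually.of_forall fun x => by
      simp only [Pi.mul_apply]; ring)
  have j3 : Integrable (fun x => g x * (φ x * v x)) (cubeMeasure m) :=
    (integrable_mul_test ivg hφ hcs).congr (Eventually.of_forall fun x => by
      simp only [Pi.mul_apply]; ring)
  rw [integral_add j1 j2] at key
  have e1 : ∀ x, (u * v) x * fderiv ℝ φ x (EuclideanSpace.single i 1) =
      u x * (v x * fderiv ℝ φ x (EuclideanSpace.single i 1)) := fun x => by
    simp only [Pi.mul_apply]; ring
  have e2 : ∀ x, (u * h + v * g) x * φ x = u x * (φ x * h x) + g x * (φ x * v x) := fun x => by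
    simp only [Pi.mul_apply, Pi.add_apply]; ring
  have j4 := integral_add j1 j3
  rw [cubeMeasure] at key j4
  simp only [e1, e2]
  rw [j4]
  linarith

end WeakDerivatives

/-! ### The norm of order `1 + s` -/

section OrderOnePlus

variable {m : ℕ}

/-- The norm of order `1 + s` for a given weak gradient. -/
def gradNorm (p s : ℝ) (u : Euc m → ℝ) (g : Fin m → Euc m → ℝ) : ℝ≥0∞ :=
  cubeLp p u + ∑ i, cubeLp p (g i) + ∑ i, cubeSeminorm p s (g i)

theorem cubeW1_eq_gradNorm {p s : ℝ} {u : Euc m → ℝ} {g : Fin m → Euc m → ℝ}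
    (h : ∀ i, IsWeakPartial i u (g i)) : cubeW1 p s u = gradNorm p s u g := by
  refine le_antisymm (iInf₂_le g h) (le_iInf₂ fun g' h' => le_of_eq ?_)
  have e1 : ∀ i, cubeLp p (g i) = cubeLp p (g' i) := fun i =>
    cubeLp_congr ((h i).ae_unique (h' i))
  have e2 : ∀ i, cubeSeminorm p s (g i) = cubeSeminorm p s (g' i) := fun i =>
    cubeSeminorm_congr ((h i).ae_unique (h' i))
  simp only [gradNorm, e1, e2]

theorem cubeLp_le_gradNorm (p s : ℝ) (u : Euc m → ℝ) (g : Fin m → Euc m → ℝ) :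
    cubeLp p u ≤ gradNorm p s u g := le_self_add.trans le_self_add

theorem cubeLp_grad_le_gradNorm (p s : ℝ) (u : Euc m → ℝ) (g : Fin m → Euc m → ℝ) (i : Fin m) :
    cubeLp p (g i) ≤ gradNorm p s u g :=
  (Finset.single_le_sum (f := fun i => cubeLp p (g i)) (fun _ _ => zero_le)
    (Finset.mem_univ i)).trans (le_add_self.trans le_self_add)

theorem cubeSeminorm_le_gradNorm (p s : ℝ) (u : Euc m → ℝ) (g : Fin m → Euc m → ℝ) (i : Fin m) :
    cubeSeminorm p s (g i) ≤ gradNorm p s u g :=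
  (Finset.single_le_sum (f := fun i => cubeSeminorm p s (g i)) (fun _ _ => zero_le)
    (Finset.mem_univ i)).trans le_add_self

/-- Functions of order `s > m / p` are bounded. -/
theorem exists_const_ae_enorm_le_cubeW {p s : ℝ} (hm : 1 ≤ m) (hp : 1 ≤ p) (hs : (m : ℝ) / p < s) :
    ∃ C : ℝ≥0, ∀ u : Euc m → ℝ, Measurable u → cubeW p s u < ⊤ →
      ∀ᵐ x ∂(cubeMeasure m), ‖u x‖ₑ ≤ C * cubeW p s u := by
  obtain ⟨C, hC⟩ := exists_const_ae_enorm_le hm hp hs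
  refine ⟨C, fun u hu hfin => ?_⟩
  filter_upwards [hC u hu (lt_of_le_of_lt le_self_add hfin) 1 one_pos le_rfl] with x hx
  simpa [cubeW, add_comm] using hx

/-- Functions of order `1 + s`, `s > m / p`, have a bounded gradient. -/
theorem exists_const_ae_enorm_grad_le {p s : ℝ} (hm : 1 ≤ m) (hp : 1 ≤ p) (hs : (m : ℝ) / p < s) :
    ∃ C : ℝ≥0, ∀ (u : Euc m → ℝ) (g : Fin m → Euc m → ℝ), Measurable u → (∀ i, Measurable (g i)) →
      (∀ i, IsWeakPartial i u (g i)) → gradNorm p s u g < ⊤ →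
      ∀ i, ∀ᵐ x ∂(cubeMeasure m), ‖g i x‖ₑ ≤ C * gradNorm p s u g := by
  obtain ⟨C, hC⟩ := exists_const_ae_enorm_le hm hp hs
  refine ⟨2 * C, fun u g hu hg h hfin i => ?_⟩
  filter_upwards [hC (g i) (hg i) ((cubeLp_grad_le_gradNorm p s u g i).trans_lt hfin)
    1 one_pos le_rfl] with x hx
  refine hx.trans ?_
  simp only [Real.one_rpow, ENNReal.ofReal_one, one_mul]
  calc (C : ℝ≥0∞) * (cubeSeminorm p s (g i) + cubeLp p (g i))
      ≤ C * (gradNorm p s u g + gradNorm p s u g) := by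
        gcongr
        · exact cubeSeminorm_le_gradNorm p s u g i
        · exact cubeLp_grad_le_gradNorm p s u g i
    _ = _ := by push_cast; ring

/-- The embedding of order `1 + s` into order `s`. -/
theorem exists_const_cubeSeminorm_le_gradNorm {p s : ℝ} (hm : 1 ≤ m) (hp : 1 ≤ p)
    (hs : (m : ℝ) / p < s) (hs1 : s < 1) :
    ∃ C : ℝ≥0, ∀ (u : Euc m → ℝ) (g : Fin m → Euc m → ℝ), Measurable u → (∀ i, Measurable (g i)) →
      (∀ i, IsWeakPartial i u (g i)) → gradNorm p s u g < ⊤ →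
      cubeSeminorm p s u ≤ C * gradNorm p s u g := by
  obtain ⟨C, hC⟩ := exists_const_ae_enorm_grad_le hm hp hs
  obtain ⟨K, hK⟩ := exists_const_cubeSeminorm_lipschitz_le (p := p) hm hp hs1
  refine ⟨K * m * C, fun u g hu hg h hfin => ?_⟩
  have hL : ((C * (gradNorm p s u g).toNNReal : ℝ≥0) : ℝ≥0∞) = C * gradNorm p s u g := by
    rw [ENNReal.coe_mul, ENNReal.coe_toNNReal hfin.ne]
  have h1 := ae_lipschitz_of_weakPartial (L := C * (gradNorm p s u g).toNNReal)
    (integrable_of_cubeLp hp hu.aestronglyMeasurable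
      ((cubeLp_le_gradNorm p s u g).trans_lt hfin)) h
    (fun i => by rw [hL]; exact hC u g hu hg h hfin i)
  have h2 := hK u (m * (C * (gradNorm p s u g).toNNReal)) (by
    simpa only [ENNReal.coe_mul, ENNReal.coe_natCast] using h1)
  refine h2.trans (le_of_eq ?_)
  rw [ENNReal.coe_mul (m : ℝ≥0), hL]
  push_cast
  ring

/-- The product estimate of order `1 + s`. -/
theorem exists_const_gradNorm_mul_le {p s : ℝ} (hm : 1 ≤ m) (hp : 1 ≤ p)
    (hs : (m : ℝ) / p < s) (hs1 : s < 1) :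
    ∃ C : ℝ≥0, ∀ (u v : Euc m → ℝ) (g h : Fin m → Euc m → ℝ) (a b l : ℝ≥0),
      Measurable u → (∀ i, Measurable (g i)) → (∀ i, IsWeakPartial i u (g i)) →
      gradNorm p s u g < ⊤ →
      Measurable v → (∀ i, Measurable (h i)) → (∀ i, IsWeakPartial i v (h i)) →
      gradNorm p s v h < ⊤ →
      (∀ᵐ x ∂(cubeMeasure m), ‖u x‖ₑ ≤ a) → (∀ᵐ x ∂(cubeMeasure m), ‖v x‖ₑ ≤ b) →
      (∀ i, ∀ᵐ x ∂(cubeMeasure m), ‖h i x‖ₑ ≤ l) →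
      gradNorm p s (u * v) (fun i => u * h i + v * g i) ≤
        C * (a * gradNorm p s v h + (b + l) * gradNorm p s u g) := by
  obtain ⟨C, hC⟩ := exists_const_cubeSeminorm_le_gradNorm hm hp hs hs1
  obtain ⟨K, hK⟩ := exists_const_cubeSeminorm_mul_lipschitz_le (p := p) hm hp hs1
  refine ⟨1 + m + m * (1 + C + K * m), fun u v g h a b l mu mg hu fu mv mh hv fv ha hb hl => ?_⟩
  set U := gradNorm p s u g with hU
  set V := gradNorm p s v h with hV
  have iv := integrable_of_ae_le mv.aestronglyMeasurable hb
  have lipv := ae_lipschitz_of_weakPartial iv hv hl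
  have b1 : cubeLp p (u * v) ≤ a * V + (b + l) * U :=
    (cubeLp_mul_le ha).trans ((mul_le_mul_right (cubeLp_le_gradNorm p s v h) _).trans le_self_add)
  have b2 : ∀ i, cubeLp p (u * h i + v * g i) ≤ a * V + (b + l) * U := fun i => by
    refine (cubeLp_add_le hp (mu.mul (mh i)).aestronglyMeasurable
      (mv.mul (mg i)).aestronglyMeasurable).trans (add_le_add ?_ ?_)
    · exact (cubeLp_mul_le ha).trans (mul_le_mul_right (cubeLp_grad_le_gradNorm p s v h i) _)
    · exact (cubeLp_mul_le hb).trans (mul_le_mul' le_self_add (cubeLp_grad_le_gradNorm p s u g i))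
  have b3 : ∀ i, cubeSeminorm p s (u * h i + v * g i) ≤
      (1 + C + K * m) * (a * V + (b + l) * U) := fun i => by
    have c1 : cubeSeminorm p s (u * h i) ≤ a * V + l * (C * U) :=
      (cubeSeminorm_mul_le hp mu.aestronglyMeasurable (mh i).aestronglyMeasurable ha (hl i)).trans
        (by gcongr
            · exact cubeSeminorm_le_gradNorm p s v h i
            · exact hC u g mu mg hu fu)
    -- No uniform bound on the gradient of `u` is among the hypotheses. The Lipschitz continuity of
    -- `v` takes its place, so the sup of the gradient enters for one factor only.
    have c2 : cubeSeminorm p s (g i * v) ≤ b * U + K * (m * l) * U := by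
      have := hK (g i) v b (m * l) (mg i).aestronglyMeasurable mv.aestronglyMeasurable hb
        (by simpa using lipv)
      refine this.trans ?_
      push_cast
      gcongr
      · exact cubeSeminorm_le_gradNorm p s u g i
      · exact cubeLp_grad_le_gradNorm p s u g i
    rw [mul_comm v (g i)]
    refine (cubeSeminorm_add_le hp (mu.mul (mh i)).aestronglyMeasurable
      ((mg i).mul mv).aestronglyMeasurable).trans ((add_le_add c1 c2).trans ?_)
    calc (a * V + l * (C * U) + (b * U + K * (m * l) * U) : ℝ≥0∞)
        = 1 * (a * V + b * U) + C * (l * U) + K * m * (l * U) := by ring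
      _ ≤ 1 * (a * V + (b + l) * U) + C * (a * V + (b + l) * U) +
          K * m * (a * V + (b + l) * U) := by
          gcongr
          · exact le_self_add
          · exact le_add_left (mul_le_mul_left le_add_self _)
          · exact le_add_left (mul_le_mul_left le_add_self _)
      _ = _ := by ring
  calc _ ≤ (a * V + (b + l) * U) + ∑ _i : Fin m, (a * V + (b + l) * U) +
        ∑ _i : Fin m, (1 + C + K * m) * (a * V + (b + l) * U) :=
        add_le_add (add_le_add b1 (Finset.sum_le_sum fun i _ => b2 i))
          (Finset.sum_le_sum fun i _ => b3 i)
    _ = _ := by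
        simp only [Finset.sum_const, Finset.card_univ, Fintype.card_fin, nsmul_eq_mul]
        push_cast
        ring

end OrderOnePlus

/-! ### Kernels in time -/

section TimeKernel

/-- A continuous probability density on the unit interval. -/
def parab (τ : ℝ) : ℝ := max 0 (6 * (τ * (1 - τ)))

theorem continuous_parab : Continuous parab := by unfold parab; fun_prop

theorem parab_nonneg (τ : ℝ) : 0 ≤ parab τ := le_max_left _ _

theorem parab_le (τ : ℝ) : parab τ ≤ 2 :=
  max_le (by norm_num) (by nlinarith [sq_nonneg (τ - 1 / 2)])

theorem mem_Icc_of_parab_ne_zero {τ : ℝ} (h : parab τ ≠ 0) : τ ∈ Icc (0 : ℝ) 1 := by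
  by_contra h'
  refine h (max_eq_left ?_)
  rw [mem_Icc, not_and_or, not_le, not_le] at h'
  rcases h' with h' | h' <;> nlinarith

theorem integral_parab : ∫ τ, parab τ = 1 := by
  have h1 : ∫ τ, parab τ = ∫ τ in Icc (0 : ℝ) 1, parab τ :=
    (setIntegral_eq_integral_of_forall_compl_eq_zero fun τ hτ => by
      by_contra h'
      exact hτ (mem_Icc_of_parab_ne_zero h')).symm
  have h2 : ∫ τ in Icc (0 : ℝ) 1, parab τ = ∫ τ in Icc (0 : ℝ) 1, (6 * τ - 6 * τ ^ 2) := by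
    refine setIntegral_congr_fun measurableSet_Icc fun τ hτ => ?_
    simp only [parab]
    rw [max_eq_right (by nlinarith [hτ.1, hτ.2])]
    ring
  rw [h1, h2, integral_Icc_eq_integral_Ioc, ← intervalIntegral.integral_of_le zero_le_one,
    intervalIntegral.integral_sub (f := fun τ : ℝ => 6 * τ) (g := fun τ : ℝ => 6 * τ ^ 2)
      (Continuous.intervalIntegrable (by fun_prop) _ _)
      (Continuous.intervalIntegrable (by fun_prop) _ _),
    intervalIntegral.integral_const_mul, intervalIntegral.integral_const_mul, integral_id,
    integral_pow]
  norm_num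

/-- The averaging kernel at scale `h` around `t`, contracted to stay in `[0, T]`. -/
def tker (T h t z : ℝ) : ℝ := h⁻¹ * parab ((z - (1 - h / T) * t) / h)

theorem continuous_tker (T h : ℝ) : Continuous (Function.uncurry (tker T h)) := by
  have := continuous_parab
  unfold tker Function.uncurry
  fun_prop

variable {T h t : ℝ}

theorem tker_nonneg (hh : 0 < h) (z : ℝ) : 0 ≤ tker T h t z :=
  mul_nonneg (by positivity) (parab_nonneg _)

theorem tker_le (hh : 0 < h) (z : ℝ) : tker T h t z ≤ 2 * h ^ (-1 : ℝ) := by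
  rw [Real.rpow_neg_one, mul_comm]
  exact mul_le_mul_of_nonneg_left (parab_le _) (by positivity)

/-- The contraction by `1 - h / T` maps `[0, T]` onto `[0, T - h]`, and the kernel occupies the
interval of length `h` to the right of the image point. This works for every scale up to `h = T`, so
no constant depends on `T`. -/
theorem tker_support (hh : 0 < h) (hT : h ≤ T) (ht : t ∈ Icc 0 T) {z : ℝ} (hz : tker T h t z ≠ 0) :
    z ∈ Icc 0 T ∧ |t - z| ≤ h := by
  have hT0 : 0 < T := hh.trans_le hT
  have h1 := mem_Icc_of_parab_ne_zero (fun h0 => hz (by rw [tker, h0, mul_zero]))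
  rw [mem_Icc, le_div_iff₀ hh, div_le_iff₀ hh] at h1
  have h2 : h / T ≤ 1 := (div_le_one hT0).2 hT
  have h3 : h / T * t ≤ h := by
    rw [div_mul_eq_mul_div, div_le_iff₀ hT0]
    exact mul_le_mul_of_nonneg_left ht.2 hh.le
  have h4 : 0 ≤ h / T * t := mul_nonneg (by positivity) ht.1
  have h5 : (1 - h / T) * t ≤ (1 - h / T) * T :=
    mul_le_mul_of_nonneg_left ht.2 (by linarith)
  have h6 : (1 - h / T) * T = T - h := by field_simp
  have h7 : 0 ≤ (1 - h / T) * t := mul_nonneg (by linarith) ht.1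
  refine ⟨⟨by nlinarith, by nlinarith⟩, abs_le.2 ⟨by nlinarith, by nlinarith⟩⟩

theorem integral_tker (hh : 0 < h) (hT : h ≤ T) (ht : t ∈ Icc 0 T) :
    ∫ z in Icc 0 T, tker T h t z = 1 := by
  rw [setIntegral_eq_integral_of_forall_compl_eq_zero fun z hz => by
    by_contra h'
    exact hz (tker_support hh hT ht h').1]
  have h1 := integral_sub_right_eq_self (μ := volume) (fun z : ℝ => h⁻¹ * parab (z / h))
    ((1 - h / T) * t)
  simp only [tker]
  rw [h1, integral_const_mul, Measure.integral_comp_div, integral_parab, abs_of_pos hh]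
  simp [hh.ne']

theorem isKernel_tker (hh : 0 < h) (hT : h ≤ T) (ht : t ∈ Icc 0 T) :
    IsKernel (timeMeasure T) t (.ofReal (2 * h ^ (-1 : ℝ))) (.ofReal (1 * h))
      (fun z => .ofReal (tker T h t z)) where
  meas := ((continuous_tker T h).comp (by fun_prop : Continuous fun z => (t, z))).measurable.ennreal_ofReal
  mass := by
    have hc : Continuous fun z => tker T h t z :=
      (continuous_tker T h).comp (by fun_prop : Continuous fun z => (t, z))
    rw [timeMeasure, ← ofReal_integral_eq_lintegral_ofReal (hc.integrableOn_Icc)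
      (Eventually.of_forall fun z => tker_nonneg hh z), integral_tker hh hT ht, ENNReal.ofReal_one]
  le z := ENNReal.ofReal_le_ofReal (tker_le hh z)
  supp z hz := by
    rw [edist_dist, Real.dist_eq, one_mul]
    exact ENNReal.ofReal_le_ofReal (tker_support hh hT ht fun h0 => hz (by simp [h0])).2

theorem ae_timeMeasure_mem (T : ℝ) : ∀ᵐ t ∂(timeMeasure T), t ∈ Icc 0 T :=
  ae_restrict_mem measurableSet_Icc

instance isFiniteMeasure_timeMeasure (T : ℝ) : IsFiniteMeasure (timeMeasure T) := by
  unfold timeMeasure; infer_instance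

theorem ae_timeMeasure_ne (T t : ℝ) : ∀ᵐ r ∂(timeMeasure T), r ≠ t :=
  ae_restrict_of_ae (by simp [ae_iff])

end TimeKernel

/-! ### Morrey and interpolation estimates in time -/

section TimeAverages

/-- The `L_p`-norm of a nonnegative function of time. -/
def tLp (p T : ℝ) (N : ℝ → ℝ≥0∞) : ℝ≥0∞ := (∫⁻ t, N t ^ p ∂(timeMeasure T)) ^ (1 / p)

/-- The Slobodeckii functional of a pseudo-metric in time. -/
def tSem (p θ T : ℝ) (D : ℝ → ℝ → ℝ≥0∞) : ℝ≥0∞ :=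
  wNorm p (timeMeasure T) (timeMeasure T) (fun t r => ‖t - r‖ₑ ^ (1 + θ * p)) D

theorem tSem_eq (p θ T : ℝ) (D : ℝ → ℝ → ℝ≥0∞) :
    tSem p θ T D = (∫⁻ t, ∫⁻ r, D t r ^ p / edist t r ^ (1 + θ * p)
      ∂(timeMeasure T) ∂(timeMeasure T)) ^ (1 / p) := by
  simp only [tSem, wNorm, edist_eq_enorm_sub]

theorem ae_lt_top_of_tSem {p θ T : ℝ} (hp : 1 ≤ p) {D : ℝ → ℝ → ℝ≥0∞}
    (hD : Measurable (Function.uncurry D)) (h : tSem p θ T D < ⊤) :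
    ∀ᵐ t ∂(timeMeasure T), ∫⁻ r, D t r ^ p / edist t r ^ (1 + θ * p) ∂(timeMeasure T) ≠ ⊤ := by
  have hm := (measurable_rpow_div_edist (p := p) (e := 1 + θ * p) hD).lintegral_prod_right'
    (ν := timeMeasure T)
  have hfin : ∫⁻ t, ∫⁻ r, D t r ^ p / edist t r ^ (1 + θ * p) ∂(timeMeasure T) ∂(timeMeasure T)
      ≠ ⊤ := fun h' => by
    rw [tSem_eq, h', ENNReal.top_rpow_of_pos (by positivity)] at h
    exact lt_irrefl _ h
  filter_upwards [ae_lt_top hm hfin] with t ht using ht.ne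

/-- The integrand has the shape of the interpolation hypotheses below: a spatial term at two times
and a temporal term. It is used once for single averages and twice, nested, for double ones. -/
theorem IsKernel.lintegral_affine {X : Type*} [MeasurableSpace X] [PseudoEMetricSpace X]
    {μ : Measure X} {x : X} {K ρ : ℝ≥0∞} {k : X → ℝ≥0∞} (hk : IsKernel μ x K ρ k)
    {N F : X → ℝ≥0∞} (hN : Measurable N) (hF : Measurable F) (α β c : ℝ≥0∞) :
    ∫⁻ z, k z * (α * (c + N z) + β * F z) ∂μ =
      α * (c + ∫⁻ z, k z * N z ∂μ) + β * ∫⁻ z, k z * F z ∂μ := by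
  have e : ∀ z, k z * (α * (c + N z) + β * F z) =
      α * (k z * c + k z * N z) + β * (k z * F z) := fun z => by ring
  have m1 : Measurable fun z => k z * c := hk.meas.mul_const c
  have m2 : Measurable fun z => k z * N z := hk.meas.mul hN
  have m3 : Measurable fun z => k z * F z := hk.meas.mul hF
  have m12 : Measurable fun z => k z * c + k z * N z := m1.add m2
  have m4 : Measurable fun z => α * (k z * c + k z * N z) := m12.const_mul α
  simp only [e]
  rw [lintegral_add_left m4, lintegral_const_mul _ m12,
    lintegral_add_left m1, hk.lintegral_mul_const, lintegral_const_mul _ m3]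

theorem tker_average_le {p T h t : ℝ} (hp : 1 ≤ p) (hh : 0 < h) (hT : h ≤ T) (ht : t ∈ Icc 0 T)
    {N : ℝ → ℝ≥0∞} (hN : AEMeasurable N (timeMeasure T)) :
    ∫⁻ z, .ofReal (tker T h t z) * N z ∂(timeMeasure T) ≤
      2 * (.ofReal (h ^ (-(1 / p))) * tLp p T N) := by
  have hp0 : 0 < p := by linarith
  refine ((isKernel_tker hh hT ht).lintegral_le_Lp hp hN).trans ?_
  rw [ENNReal.mul_rpow_of_nonneg _ _ (by positivity), ENNReal.ofReal_rpow_of_pos (by positivity),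
    Real.mul_rpow (by norm_num) (by positivity), ← Real.rpow_mul hh.le,
    ENNReal.ofReal_mul (by positivity), ← mul_assoc, tLp, neg_one_mul]
  gcongr
  refine (ENNReal.ofReal_le_ofReal (?_ : _ ≤ (2 : ℝ))).trans (by simp)
  calc (2 : ℝ) ^ (1 / p) ≤ 2 ^ (1 : ℝ) :=
        Real.rpow_le_rpow_of_exponent_le (by norm_num) ((div_le_one hp0).2 hp)
    _ = 2 := by simp

/-- The Morrey inequality in time for pseudo-metrics. -/
theorem exists_const_time_holder {p θ : ℝ} (hp : 1 ≤ p) (hθ : 1 / p < θ) :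
    ∃ C : ℝ≥0, ∀ (T : ℝ) (D : ℝ → ℝ → ℝ≥0∞), Measurable (Function.uncurry D) →
      (∀ a b c, D a c ≤ D a b + D b c) → (∀ a b, D a b = D b a) → tSem p θ T D < ⊤ →
      ∀ᵐ t ∂(timeMeasure T), ∀ᵐ r ∂(timeMeasure T),
        D t r ≤ C * (.ofReal (|t - r| ^ (θ - 1 / p)) * tSem p θ T D) := by
  have hp0 : 0 < p := by linarith
  have hθ0 : 0 < θ := lt_trans (by positivity) hθ
  set C1 : ℝ := (2 * 2 * 2 ^ (1 : ℝ) * (3 * 1) ^ (1 + θ * p)) ^ (1 / p)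
  have hC1 : 0 < C1 := by positivity
  have hg := geomConst_ne_top (γ := θ - 1 / p) (by linarith)
  refine ⟨C1.toNNReal * (2 * (geomConst (θ - 1 / p)).toNNReal + 1),
    fun T D hD htri hsymm hfin => ?_⟩
  have hae := ae_lt_top_of_tSem hp hD hfin
  filter_upwards [hae, ae_timeMeasure_mem T] with t ht htT
  filter_upwards [hae, ae_timeMeasure_mem T, ae_timeMeasure_ne T t] with r hr hrT hne
  -- The distance of the two times serves as the common scale of the kernels around them; it never
  -- exceeds `T`.
  set h := |t - r| with hh
  have h0 : 0 < h := abs_pos.2 (sub_ne_zero.2 hne.symm)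
  have hT : h ≤ T := abs_le.2 ⟨by linarith [htT.1, hrT.2], by linarith [htT.2, hrT.1]⟩
  have hj : ∀ j : ℕ, h / 2 ^ j ≤ T := fun j =>
    (div_le_self h0.le (one_le_pow₀ (by norm_num))).trans hT
  have mor : ∀ y ∈ Icc 0 T, ∫⁻ z, D y z ^ p / edist y z ^ (1 + θ * p) ∂(timeMeasure T) ≠ ⊤ →
      ∫⁻ z, .ofReal (tker T h y z) * D y z ∂(timeMeasure T) ≤
        .ofReal (C1 * h ^ (θ - 1 / p)) * tSem p θ T D * geomConst (θ - 1 / p) := fun y hy hy' => by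
    have := average_dist_le_morrey (μ := timeMeasure T) (x := y) (n := 1)
      (k := fun j z => .ofReal (tker T (h / 2 ^ j) y z)) (by norm_num : (1 : ℝ) ≤ 2) le_rfl
      one_pos hp hθ h0 (fun j => isKernel_tker (by positivity) (hj j) hy) hD htri hsymm hy'
    simp only [pow_zero, div_one] at this
    rw [tSem_eq]
    exact this
  have kt := isKernel_tker h0 hT htT
  have kr := isKernel_tker h0 hT hrT
  have pair := kt.pair_le (n := 1) (σ := θ) (by norm_num : (1 : ℝ) ≤ 2) le_rfl one_pos hp hθ0 h0
    (by linarith : h / 2 ≤ h) le_rfl kr (by rw [edist_dist, Real.dist_eq]) hD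
  rw [← tSem_eq] at pair
  have step1 : D t r ≤ ∫⁻ z, .ofReal (tker T h t z) * D t z ∂(timeMeasure T) +
      ∫⁻ z, .ofReal (tker T h t z) * D r z ∂(timeMeasure T) := by
    have mD : Measurable fun z => .ofReal (tker T h t z) * D t z :=
      kt.meas.mul (hD.comp measurable_prodMk_left)
    rw [← kt.lintegral_mul_const (D t r), ← lintegral_add_left mD]
    refine lintegral_mono fun z => ?_
    rw [← mul_add]
    gcongr
    exact (htri t z r).trans (by rw [hsymm z r])
  have step2 := kt.average_triangle kr hD htri hsymm r
  -- From `t` to the average around `t`, on to the average around `r`, and then to `r`: two Morrey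
  -- sums and one comparison of averages at equal scale.
  calc D t r ≤ .ofReal (C1 * h ^ (θ - 1 / p)) * tSem p θ T D * geomConst (θ - 1 / p) +
        (.ofReal (C1 * h ^ (θ - 1 / p)) * tSem p θ T D * geomConst (θ - 1 / p) +
          .ofReal (C1 * h ^ (θ - 1 / p)) * tSem p θ T D) :=
        step1.trans (add_le_add (mor t htT ht) (step2.trans (add_le_add (mor r hrT hr) pair)))
    _ = _ := by
        rw [ENNReal.ofReal_mul hC1.le]
        push_cast
        rw [ENNReal.coe_toNNReal hg, ENNReal.ofReal]
        ring

/-- Averaged oscillation in time by interpolation between spatial and temporal regularity. -/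
theorem exists_const_time_average_le {p θ a b : ℝ} (hp : 1 ≤ p) (ha : 1 / p < a) (hθ : 0 < θ)
    (hab : a ≤ θ - b) (C₀ : ℝ≥0) :
    ∃ C : ℝ≥0, ∀ (T : ℝ) (d D : ℝ → ℝ → ℝ≥0∞) (N : ℝ → ℝ≥0∞), Measurable (Function.uncurry d) →
      Measurable (Function.uncurry D) → Measurable N →
      (∀ a b c, d a c ≤ d a b + d b c) → (∀ a b, d a b = d b a) →
      tLp p T N < ⊤ → tSem p θ T D < ⊤ →
      (∀ h : ℝ, 0 < h → h ≤ 1 → ∀ᵐ t ∂(timeMeasure T), ∀ᵐ r ∂(timeMeasure T),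
        d t r ≤ C₀ * (.ofReal (h ^ a) * (N t + N r) + .ofReal (h ^ (-b)) * D t r)) →
      ∀ h : ℝ, 0 < h → h ≤ 1 → h ≤ T → ∀ᵐ t ∂(timeMeasure T),
        ∫⁻ z, .ofReal (tker T h t z) * d t z ∂(timeMeasure T) ≤
          C * (.ofReal (h ^ (a - 1 / p)) * (tLp p T N + tSem p θ T D)) := by
  have hp0 : 0 < p := by linarith
  have ha0 : 0 < a := lt_trans (by positivity) ha
  set C1 : ℝ := (2 * 2 * 2 ^ (1 : ℝ) * (3 * 1) ^ (1 + θ * p)) ^ (1 / p) with hC1d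
  set C2 : ℝ := (2 * 1 ^ (1 + θ * p)) ^ (1 / p)
  have hC1 : 0 < C1 := by positivity
  have hC2 : 0 < C2 := by positivity
  have hg := geomConst_ne_top (γ := a - 1 / p) (by linarith)
  -- The `6` is `2 + 4`, from the averages of `N` at the scales `η` and `η / 2`; `C1` comes from the
  -- double average of `D`.
  refine ⟨C₀ * (6 + C1.toNNReal) * (geomConst (a - 1 / p)).toNNReal,
    fun T d D N hd hD hN htri hsymm hfN hfD hest h hh hh1 hhT => ?_⟩
  set MN := tLp p T N
  set MD := tSem p θ T D
  have hj0 : ∀ j : ℕ, 0 < h / 2 ^ j := fun j => by positivity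
  have hjh : ∀ j : ℕ, h / 2 ^ j ≤ h := fun j => div_le_self hh.le (one_le_pow₀ (by norm_num))
  -- The exceptional set of the hypothesis depends on the scale. Only the countably many dyadic
  -- scales are used, so one null set of times suffices.
  have hest' : ∀ᵐ t ∂(timeMeasure T), ∀ j : ℕ, ∀ᵐ r ∂(timeMeasure T),
      d t r ≤ C₀ * (.ofReal ((h / 2 ^ j) ^ a) * (N t + N r) + .ofReal ((h / 2 ^ j) ^ (-b)) * D t r) :=
    ae_all_iff.2 fun j => hest _ (hj0 j) ((hjh j).trans hh1)
  have hNt : ∀ᵐ t ∂(timeMeasure T), N t < ⊤ := by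
    have hNfin : ∫⁻ t, N t ^ p ∂(timeMeasure T) ≠ ⊤ := fun h' => by
      simp only [MN, tLp, h'] at hfN
      rw [ENNReal.top_rpow_of_pos (by positivity)] at hfN
      exact lt_irrefl _ hfN
    filter_upwards [ae_lt_top (hN.pow_const p) hNfin] with t ht
    by_contra h'
    rw [not_lt, top_le_iff] at h'
    simp [h', ENNReal.top_rpow_of_pos hp0] at ht
  have rp : ∀ (j : ℕ) (e : ℝ), a ≤ e → (h / 2 ^ j) ^ e ≤ (h / 2 ^ j) ^ a := fun j e he =>
    Real.rpow_le_rpow_of_exponent_ge (hj0 j) ((hjh j).trans hh1) he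
  filter_upwards [ae_lt_top_of_tSem hp hD hfD, ae_timeMeasure_mem T, hest', hNt] with t hΦ htT het hNt
  set Φ := (∫⁻ r, D t r ^ p / edist t r ^ (1 + θ * p) ∂(timeMeasure T)) ^ (1 / p) with hΦd
  have hΦt : Φ ≠ ⊤ := ENNReal.rpow_ne_top_of_nonneg (by positivity) hΦ
  have ker := fun j => isKernel_tker (hj0 j) ((hjh j).trans hhT) htT
  have avN := fun j => tker_average_le hp (hj0 j) ((hjh j).trans hhT) htT hN.aemeasurable
  have key := average_dist_le_of_chain (μ := timeMeasure T) (x := t) (y := t)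
    (k := fun j z => .ofReal (tker T (h / 2 ^ j) t z)) ker hd htri hsymm
    (c := C₀ * (6 + ENNReal.ofReal C1) * (MN + MD) * .ofReal (1 * h ^ (a - 1 / p)))
    (q := .ofReal (2 ^ (-(a - 1 / p)))) (fun j => ?_) ?_
  · simp only [pow_zero, div_one, one_mul] at key
    refine key.trans (le_of_eq ?_)
    change C₀ * (6 + ENNReal.ofReal C1) * (MN + MD) * .ofReal (h ^ (a - 1 / p)) *
      geomConst (a - 1 / p) = _
    push_cast
    rw [ENNReal.coe_toNNReal hg, ENNReal.ofReal]
    ring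
  -- The interpolation parameter is taken equal to the current time scale `η`. The spatial part then
  -- decays like `η ^ (a - 1 / p)` and the temporal one like `η ^ (θ - b - 1 / p)`, which is no
  -- larger because `a ≤ θ - b` and `η ≤ 1`.
  · rw [mul_assoc, ← ofReal_half_pow_rpow hh 1 zero_le_one, one_mul]
    set η := h / 2 ^ j with hη
    have hη0 : 0 < η := hj0 j
    have hη' : h / 2 ^ (j + 1) = η / 2 := by rw [hη, pow_succ]; field_simp
    have mF : Measurable fun z => ∫⁻ z', .ofReal (tker T (h / 2 ^ (j + 1)) t z') * D z z'
        ∂(timeMeasure T) := (((ker (j + 1)).meas.comp measurable_snd).mul hD).lintegral_prod_right'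
    have pair := (ker j).pair_le (n := 1) (σ := θ) (by norm_num : (1 : ℝ) ≤ 2) le_rfl one_pos hp hθ
      hη0 hη'.ge (by rw [hη']; linarith) (ker (j + 1)) (by simp) hD
    rw [← tSem_eq] at pair
    have n2 : ∫⁻ z, .ofReal (tker T (h / 2 ^ (j + 1)) t z) * N z ∂(timeMeasure T) ≤
        4 * (.ofReal (η ^ (-(1 / p))) * MN) := by
      refine (avN (j + 1)).trans ?_
      rw [hη']
      have : (η / 2) ^ (-(1 / p)) ≤ 2 * η ^ (-(1 / p)) := by
        rw [Real.div_rpow hη0.le (by norm_num), Real.rpow_neg (by norm_num : (0 : ℝ) ≤ 2),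
          div_inv_eq_mul, mul_comm]
        gcongr
        calc (2 : ℝ) ^ (1 / p) ≤ 2 ^ (1 : ℝ) :=
              Real.rpow_le_rpow_of_exponent_le (by norm_num) ((div_le_one hp0).2 hp)
          _ = 2 := by simp
      calc _ ≤ 2 * (ENNReal.ofReal (2 * η ^ (-(1 / p))) * MN) := by gcongr
        _ = _ := by
          rw [ENNReal.ofReal_mul (by norm_num), ENNReal.ofReal_ofNat]
          ring
    have e1 : η ^ a * η ^ (-(1 / p)) = η ^ (a - 1 / p) := by
      rw [← Real.rpow_add hη0]; ring_nf
    have e2 : η ^ (-b) * η ^ (θ - 1 / p) ≤ η ^ (a - 1 / p) := by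
      rw [← Real.rpow_add hη0]
      exact Real.rpow_le_rpow_of_exponent_ge hη0 ((hjh j).trans hh1) (by linarith)
    calc _ ≤ ∫⁻ z, .ofReal (tker T η t z) * ∫⁻ z', .ofReal (tker T (h / 2 ^ (j + 1)) t z') *
          (C₀ * .ofReal (η ^ a) * (N z + N z') + C₀ * .ofReal (η ^ (-b)) * D z z')
            ∂(timeMeasure T) ∂(timeMeasure T) := by
          refine lintegral_mono_ae ?_
          filter_upwards [hest η hη0 ((hjh j).trans hh1)] with z hz
          refine mul_le_mul_right (lintegral_mono_ae ?_) _
          filter_upwards [hz] with z' hz'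
          gcongr
          exact hz'.trans (le_of_eq (by ring))
      _ = C₀ * .ofReal (η ^ a) *
            (∫⁻ z, .ofReal (tker T (h / 2 ^ (j + 1)) t z) * N z ∂(timeMeasure T) +
              ∫⁻ z, .ofReal (tker T η t z) * N z ∂(timeMeasure T)) +
          C₀ * .ofReal (η ^ (-b)) * ∫⁻ z, .ofReal (tker T η t z) *
            ∫⁻ z', .ofReal (tker T (h / 2 ^ (j + 1)) t z') * D z z'
              ∂(timeMeasure T) ∂(timeMeasure T) := by
          rw [← (ker j).lintegral_affine hN mF]
          refine lintegral_congr fun z => ?_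
          have mDz : Measurable fun z' => D z z' := hD.comp measurable_prodMk_left
          rw [(ker (j + 1)).lintegral_affine hN mDz, add_comm (N z)]
      _ ≤ C₀ * .ofReal (η ^ a) * (4 * (.ofReal (η ^ (-(1 / p))) * MN) +
            2 * (.ofReal (η ^ (-(1 / p))) * MN)) +
          C₀ * .ofReal (η ^ (-b)) * (.ofReal (C1 * η ^ (θ - 1 / p)) * MD) := by
          gcongr
          exact avN j
      _ = C₀ * (6 * .ofReal (η ^ a * η ^ (-(1 / p))) * MN +
          .ofReal C1 * .ofReal (η ^ (-b) * η ^ (θ - 1 / p)) * MD) := by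
          rw [ENNReal.ofReal_mul hC1.le, ENNReal.ofReal_mul (by positivity),
            ENNReal.ofReal_mul (by positivity)]
          ring
      _ ≤ C₀ * (6 * .ofReal (η ^ (a - 1 / p)) * MN + .ofReal C1 * .ofReal (η ^ (a - 1 / p)) * MD) := by
          rw [e1]; gcongr
      _ ≤ C₀ * ((6 + .ofReal C1) * .ofReal (η ^ (a - 1 / p)) * MN +
            (6 + .ofReal C1) * .ofReal (η ^ (a - 1 / p)) * MD) := by
          gcongr
          · exact le_self_add
          · exact le_add_self
      _ = _ := by ring
  -- The remainder has three pieces: `N` at the fixed time `t`, its average, and the Slobodeckii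
  -- functional at `t`. All three carry positive powers of the scale with finite coefficients.
  · have lim1 := tendsto_half_pow_rpow hh ha0 1 zero_le_one hNt.ne
    have lim2 := tendsto_half_pow_rpow hh (sub_pos.2 ha) 2 zero_le_two hfN.ne
    have lim3 := tendsto_half_pow_rpow hh ha0 C2 hC2.le hΦt
    have lim : Tendsto (fun j : ℕ => (C₀ : ℝ≥0∞) * (ENNReal.ofReal (1 * (h / 2 ^ j) ^ a) * N t +
        ENNReal.ofReal (2 * (h / 2 ^ j) ^ (a - 1 / p)) * MN +
        ENNReal.ofReal (C2 * (h / 2 ^ j) ^ a) * Φ)) atTop (𝓝 0) := by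
      have := ENNReal.Tendsto.const_mul (a := (C₀ : ℝ≥0∞)) ((lim1.add lim2).add lim3)
        (Or.inr ENNReal.coe_ne_top)
      simpa using this
    refine tendsto_of_tendsto_of_tendsto_of_le_of_le tendsto_const_nhds lim
      (fun _ => zero_le) fun j => ?_
    simp only
    set η := h / 2 ^ j with hη
    have hη0 : 0 < η := hj0 j
    have cen := (ker j).center_le (n := 1) (σ := θ) (by norm_num : (1 : ℝ) ≤ 2) le_rfl one_pos hp hθ
      hη0 hD
    have e1 : η ^ a * η ^ (-(1 / p)) = η ^ (a - 1 / p) := by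
      rw [← Real.rpow_add hη0]; ring_nf
    have e2 : η ^ (-b) * η ^ θ ≤ η ^ a := by
      rw [← Real.rpow_add hη0]
      exact rp j _ (by linarith)
    calc _ ≤ ∫⁻ z, .ofReal (tker T η t z) * (C₀ * .ofReal (η ^ a) * (N t + N z) +
            C₀ * .ofReal (η ^ (-b)) * D t z) ∂(timeMeasure T) := by
          refine lintegral_mono_ae ?_
          filter_upwards [het j] with z hz
          gcongr
          exact hz.trans (le_of_eq (by ring))
      _ = C₀ * .ofReal (η ^ a) * (N t + ∫⁻ z, .ofReal (tker T η t z) * N z ∂(timeMeasure T)) +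
          C₀ * .ofReal (η ^ (-b)) * ∫⁻ z, .ofReal (tker T η t z) * D t z ∂(timeMeasure T) :=
          (ker j).lintegral_affine hN (hD.comp measurable_prodMk_left) _ _ _
      _ ≤ C₀ * .ofReal (η ^ a) * (N t + 2 * (.ofReal (η ^ (-(1 / p))) * MN)) +
          C₀ * .ofReal (η ^ (-b)) * (.ofReal (C2 * η ^ θ) * Φ) := by
          gcongr
          exact avN j
      _ = C₀ * (.ofReal (η ^ a) * N t + 2 * .ofReal (η ^ a * η ^ (-(1 / p))) * MN +
          .ofReal C2 * .ofReal (η ^ (-b) * η ^ θ) * Φ) := by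
          rw [ENNReal.ofReal_mul hC2.le, ENNReal.ofReal_mul (by positivity),
            ENNReal.ofReal_mul (by positivity)]
          ring
      _ ≤ _ := by
          rw [e1, one_mul, ENNReal.ofReal_mul zero_le_two, ENNReal.ofReal_ofNat,
            ENNReal.ofReal_mul hC2.le]
          gcongr

end TimeAverages

/-! ### Functions on a cylinder -/

section Measurability

variable {m : ℕ} {Z : Type*} [MeasurableSpace Z]

theorem measurable_cubeLp {p : ℝ} (hp : 0 < p) {f : Z → Euc m → ℝ}
    (hf : Measurable (Function.uncurry f)) : Measurable fun t => cubeLp p (f t) := by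
  simp only [cubeLp_eq hp]
  exact (Measurable.lintegral_prod_right' (f := fun z : Z × Euc m => ‖f z.1 z.2‖ₑ ^ p)
    (hf.enorm.pow_const p)).pow_const _

theorem measurable_sub_uncurry {f : Z → Euc m → ℝ} (hf : Measurable (Function.uncurry f)) :
    Measurable (Function.uncurry fun (z : Z × Z) => f z.1 - f z.2) := by
  have h1 : Measurable fun q : (Z × Z) × Euc m => Function.uncurry f (q.1.1, q.2) :=
    hf.comp (by fun_prop)
  have h2 : Measurable fun q : (Z × Z) × Euc m => Function.uncurry f (q.1.2, q.2) :=
    hf.comp (by fun_prop)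
  exact h1.sub h2

theorem measurable_cubeLp_sub {p : ℝ} (hp : 0 < p) {f : Z → Euc m → ℝ}
    (hf : Measurable (Function.uncurry f)) :
    Measurable (Function.uncurry fun t r => cubeLp p (f t - f r)) :=
  measurable_cubeLp hp (measurable_sub_uncurry hf)

theorem measurable_cubeSeminorm {p s : ℝ} {f : Z → Euc m → ℝ}
    (hf : Measurable (Function.uncurry f)) : Measurable fun t => cubeSeminorm p s (f t) := by
  unfold cubeSeminorm
  have h1 : Measurable fun q : (Z × Euc m) × Euc m => Function.uncurry f (q.1.1, q.1.2) :=
    hf.comp (by fun_prop)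
  have h2 : Measurable fun q : (Z × Euc m) × Euc m => Function.uncurry f (q.1.1, q.2) :=
    hf.comp (by fun_prop)
  have h3 : Measurable fun q : (Z × Euc m) × Euc m =>
      ‖f q.1.1 q.1.2 - f q.1.1 q.2‖ₑ ^ p / ‖q.1.2 - q.2‖ₑ ^ ((m : ℝ) + s * p) :=
    ((h1.sub h2).enorm.pow_const p).div
      (((measurable_snd.comp measurable_fst).sub measurable_snd).enorm.pow_const _)
  have h4 : Measurable fun q : Z × Euc m => ∫⁻ y, ‖f q.1 q.2 - f q.1 y‖ₑ ^ p /
      ‖q.2 - y‖ₑ ^ ((m : ℝ) + s * p) ∂(cubeMeasure m) := h3.lintegral_prod_right'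
  exact (h4.lintegral_prod_right').pow_const _

/-- The essential supremum on the cube. -/
def cubeSup (u : Euc m → ℝ) : ℝ≥0∞ := essSup (fun x => ‖u x‖ₑ) (cubeMeasure m)

theorem ae_le_cubeSup (u : Euc m → ℝ) : ∀ᵐ x ∂(cubeMeasure m), ‖u x‖ₑ ≤ cubeSup u :=
  ENNReal.ae_le_essSup _

theorem cubeSup_le {u : Euc m → ℝ} {c : ℝ≥0∞} (h : ∀ᵐ x ∂(cubeMeasure m), ‖u x‖ₑ ≤ c) :
    cubeSup u ≤ c := essSup_le_of_ae_le _ h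

theorem cubeSup_add_le (u v : Euc m → ℝ) : cubeSup (u + v) ≤ cubeSup u + cubeSup v := by
  refine cubeSup_le ?_
  filter_upwards [ae_le_cubeSup u, ae_le_cubeSup v] with x hx hy
  exact (enorm_add_le _ _).trans (add_le_add hx hy)

theorem cubeSup_sub_le_add (u v w : Euc m → ℝ) :
    cubeSup (u - w) ≤ cubeSup (u - v) + cubeSup (v - w) := by
  simpa using cubeSup_add_le (u - v) (v - w)

theorem cubeSup_sub_comm (u v : Euc m → ℝ) : cubeSup (u - v) = cubeSup (v - u) := by
  unfold cubeSup
  congr! 2 with x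
  rw [← enorm_neg]; simp

/-- A sublevel set of the essential supremum consists of the parameters for which a section of `{‖f‖
> c}` is null, and the measure of sections depends measurably on the parameter. -/
theorem measurable_cubeSup {f : Z → Euc m → ℝ} (hf : Measurable (Function.uncurry f)) :
    Measurable fun t => cubeSup (f t) := by
  refine measurable_of_Iic fun c => ?_
  have e : (fun t => cubeSup (f t)) ⁻¹' Iic c =
      {t | cubeMeasure m (Prod.mk t ⁻¹' {z : Z × Euc m | c < ‖f z.1 z.2‖ₑ}) = 0} := by
    ext t
    have h0 : cubeMeasure m (Prod.mk t ⁻¹' {z : Z × Euc m | c < ‖f z.1 z.2‖ₑ}) = 0 ↔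
        ∀ᵐ x ∂(cubeMeasure m), ‖f t x‖ₑ ≤ c := by
      rw [ae_iff]; simp only [not_le]; rfl
    rw [mem_preimage, mem_Iic, mem_ofPred_eq, h0]
    refine ⟨fun h => ?_, fun h => cubeSup_le h⟩
    filter_upwards [ae_le_cubeSup (f t)] with x hx using hx.trans h
  rw [e]
  have hs : MeasurableSet {z : Z × Euc m | c < ‖f z.1 z.2‖ₑ} :=
    measurableSet_lt measurable_const hf.enorm
  exact (measurable_measure_prodMk_left hs) (measurableSet_singleton 0)

theorem cubeLp_sub_le_add {p : ℝ} (hp : 1 ≤ p) {u v w : Euc m → ℝ}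
    (hu : AEStronglyMeasurable u (cubeMeasure m)) (hv : AEStronglyMeasurable v (cubeMeasure m))
    (hw : AEStronglyMeasurable w (cubeMeasure m)) :
    cubeLp p (u - w) ≤ cubeLp p (u - v) + cubeLp p (v - w) := by
  simpa using cubeLp_add_le hp (hu.sub hv) (hv.sub hw)

theorem cubeLp_sub_comm (p : ℝ) (u v : Euc m → ℝ) : cubeLp p (u - v) = cubeLp p (v - u) :=
  eLpNorm_sub_comm _ _ _ _

end Measurability

/-! ### Sup bounds in space and time -/

section Cylinder

variable {m : ℕ}

/-- Interpolated sup-estimates for `w`, in terms of the spatial seminorm of `w` and the `L_p`-norm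
of `v`, for single times and for differences. -/
structure SupEst (C₀ : ℝ≥0) (p s β T : ℝ) (v w : ℝ → Euc m → ℝ) : Prop where
  single : ∀ ε : ℝ, 0 < ε → ε ≤ 1 → ∀ᵐ t ∂(timeMeasure T), cubeSup (w t) ≤
    C₀ * (.ofReal (ε ^ (s - m / p)) * cubeSeminorm p s (w t) + .ofReal (ε ^ (-β)) * cubeLp p (v t))
  diff : ∀ ε : ℝ, 0 < ε → ε ≤ 1 → ∀ᵐ t ∂(timeMeasure T), ∀ᵐ r ∂(timeMeasure T),
    cubeSup (w t - w r) ≤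
      C₀ * (.ofReal (ε ^ (s - m / p)) * (cubeSeminorm p s (w t) + cubeSeminorm p s (w r)) +
        .ofReal (ε ^ (-β)) * cubeLp p (v t - v r))

theorem ae_cubeLp_lt_top {p T : ℝ} (hp : 1 ≤ p) {f : ℝ → Euc m → ℝ}
    (hf : Measurable (Function.uncurry f)) (h : tLp p T (fun t => cubeLp p (f t)) < ⊤) :
    ∀ᵐ t ∂(timeMeasure T), cubeLp p (f t) < ⊤ := by
  have hp0 : 0 < p := by linarith
  have hfin : ∫⁻ t, cubeLp p (f t) ^ p ∂(timeMeasure T) ≠ ⊤ := fun h' => by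
    simp only [tLp, h'] at h
    rw [ENNReal.top_rpow_of_pos (by positivity)] at h
    exact lt_irrefl _ h
  filter_upwards [ae_lt_top ((measurable_cubeLp hp0 hf).pow_const p) hfin] with t ht
  by_contra h'
  rw [not_lt, top_le_iff] at h'
  simp [h', ENNReal.top_rpow_of_pos hp0] at ht

theorem measurable_slice {Z : Type*} [MeasurableSpace Z] {f : Z → Euc m → ℝ}
    (hf : Measurable (Function.uncurry f)) (t : Z) :
    Measurable (f t) := hf.comp measurable_prodMk_left

/-- For the function itself the `L_p`-term costs `β = m / p` powers of the spatial scale. -/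
theorem exists_const_supEst {p s : ℝ} (hm : 1 ≤ m) (hp : 1 ≤ p) (hs : (m : ℝ) / p < s) :
    ∃ C₀ : ℝ≥0, ∀ (T : ℝ) (f : ℝ → Euc m → ℝ), Measurable (Function.uncurry f) →
      tLp p T (fun t => cubeLp p (f t)) < ⊤ → SupEst C₀ p s (m / p) T f f := by
  obtain ⟨C, hC⟩ := exists_const_ae_enorm_le hm hp hs
  refine ⟨C, fun T f hf hfin => ⟨fun ε h0 h1 => ?_, fun ε h0 h1 => ?_⟩⟩
  · filter_upwards [ae_cubeLp_lt_top hp hf hfin] with t ht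
    exact cubeSup_le (hC _ (measurable_slice hf t) ht ε h0 h1)
  · filter_upwards [ae_cubeLp_lt_top hp hf hfin] with t ht
    filter_upwards [ae_cubeLp_lt_top hp hf hfin] with r hr
    have mt := measurable_slice hf t
    have mr := measurable_slice hf r
    have hd : cubeLp p (f t - f r) < ⊤ :=
      (eLpNorm_sub_le mt.aestronglyMeasurable mr.aestronglyMeasurable (by simpa using hp)).trans_lt
        (ENNReal.add_lt_top.2 ⟨ht, hr⟩)
    refine (cubeSup_le (hC _ (mt.sub mr) hd ε h0 h1)).trans ?_
    gcongr
    exact cubeSeminorm_sub_le hp mt.aestronglyMeasurable mr.aestronglyMeasurable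

/-- For a derivative one more power is lost, so `β = 1 + m / p`. The difference estimate uses that a
difference of weak derivatives is the weak derivative of the difference. -/
theorem exists_const_supEst_grad {p s : ℝ} (hm : 1 ≤ m) (hp : 1 ≤ p) (hs : (m : ℝ) / p < s) :
    ∃ C₀ : ℝ≥0, ∀ (T : ℝ) (f g : ℝ → Euc m → ℝ) (i : Fin m), Measurable (Function.uncurry f) →
      Measurable (Function.uncurry g) → tLp p T (fun t => cubeLp p (f t)) < ⊤ →
      tLp p T (fun t => cubeLp p (g t)) < ⊤ →
      (∀ᵐ t ∂(timeMeasure T), IsWeakPartial i (f t) (g t)) → SupEst C₀ p s (1 + m / p) T f g := by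
  obtain ⟨C, hC⟩ := exists_const_ae_enorm_weakPartial_le hm hp hs
  refine ⟨C, fun T f g i hf hg hfin hgin hw => ⟨fun ε h0 h1 => ?_, fun ε h0 h1 => ?_⟩⟩
  · filter_upwards [ae_cubeLp_lt_top hp hg hgin, hw] with t ht hwt
    refine cubeSup_le ?_
    rw [neg_add, ← sub_eq_add_neg]
    exact hC i _ _ (measurable_slice hf t) (measurable_slice hg t) hwt ht ε h0 h1
  · filter_upwards [ae_cubeLp_lt_top hp hf hfin, ae_cubeLp_lt_top hp hg hgin, hw] with t ft ht hwt
    filter_upwards [ae_cubeLp_lt_top hp hf hfin, ae_cubeLp_lt_top hp hg hgin, hw] with r fr hr hwr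
    have mt := measurable_slice hg t
    have mr := measurable_slice hg r
    have nt := measurable_slice hf t
    have nr := measurable_slice hf r
    have hd : cubeLp p (g t - g r) < ⊤ :=
      (eLpNorm_sub_le mt.aestronglyMeasurable mr.aestronglyMeasurable (by simpa using hp)).trans_lt
        (ENNReal.add_lt_top.2 ⟨ht, hr⟩)
    have hwd := hwt.sub hwr (integrable_of_cubeLp hp nt.aestronglyMeasurable ft)
      (integrable_of_cubeLp hp nr.aestronglyMeasurable fr)
      (integrable_of_cubeLp hp mt.aestronglyMeasurable ht)
      (integrable_of_cubeLp hp mr.aestronglyMeasurable hr)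
    rw [neg_add, ← sub_eq_add_neg]
    refine (cubeSup_le (hC i _ _ (nt.sub nr) (mt.sub mr) hwd hd ε h0 h1)).trans ?_
    gcongr
    exact cubeSeminorm_sub_le hp mt.aestronglyMeasurable mr.aestronglyMeasurable

/-- The `L_p`-distance of two time slices. -/
def sliceDist (p : ℝ) (v : ℝ → Euc m → ℝ) (t r : ℝ) : ℝ≥0∞ := cubeLp p (v t - v r)

/-- Parabolic scaling: time scale `h` is paired with space scale `√h`, which halves all spatial
exponents. -/
theorem sqrt_rpow {h : ℝ} (hh : 0 < h) (e : ℝ) : (h ^ (1 / 2 : ℝ)) ^ e = h ^ (e / 2) := by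
  rw [← Real.rpow_mul hh.le]; ring_nf

/-- The interpolation in time for the sup-distance of slices of `w`, with the `L_p`-distance of
slices of `v` as temporal term and exponents `a = (s - m / p) / 2`, `b = β / 2`. -/
theorem exists_const_sup_average_le {p s θ β : ℝ} (hp : 1 ≤ p) (hs : 1 / p < (s - m / p) / 2)
    (hθ : 0 < θ) (hβ : (s - m / p) / 2 ≤ θ - β / 2) (C₀ : ℝ≥0) :
    ∃ C : ℝ≥0, ∀ (T : ℝ) (v w : ℝ → Euc m → ℝ), Measurable (Function.uncurry v) →
      Measurable (Function.uncurry w) → SupEst C₀ p s β T v w →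
      tLp p T (fun t => cubeSeminorm p s (w t)) < ⊤ → tSem p θ T (sliceDist p v) < ⊤ →
      ∀ h : ℝ, 0 < h → h ≤ 1 → h ≤ T → ∀ᵐ t ∂(timeMeasure T),
        ∫⁻ z, .ofReal (tker T h t z) * cubeSup (w t - w z) ∂(timeMeasure T) ≤
          C * (.ofReal (h ^ ((s - m / p) / 2 - 1 / p)) *
            (tLp p T (fun t => cubeSeminorm p s (w t)) + tSem p θ T (sliceDist p v))) := by
  have hp0 : 0 < p := by linarith
  obtain ⟨C, hC⟩ := exists_const_time_average_le hp hs hθ hβ C₀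
  refine ⟨C, fun T v w hv hw est h1 h2 => hC T (fun t r => cubeSup (w t - w r)) (sliceDist p v)
    (fun t => cubeSeminorm p s (w t)) (measurable_cubeSup (measurable_sub_uncurry hw))
    (measurable_cubeLp_sub hp0 hv) (measurable_cubeSeminorm hw)
    (fun a b c => cubeSup_sub_le_add _ _ _) (fun a b => cubeSup_sub_comm _ _) h1 h2
    fun h hh hh1 => ?_⟩
  have := est.diff (h ^ (1 / 2 : ℝ)) (by positivity) (Real.rpow_le_one hh.le hh1 (by norm_num))
  simpa only [sqrt_rpow hh, neg_div, sliceDist] using this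

/-- Vanishing of the time trace in `L_p`. -/
def SliceZeroTrace (p T : ℝ) (v : ℝ → Euc m → ℝ) : Prop :=
  ∀ ε : ℝ≥0, 0 < ε → ∃ δ : ℝ, 0 < δ ∧ ∀ᵐ r ∂(timeMeasure T), r < δ → cubeLp p (v r) ≤ ε

theorem exists_mem_of_ae_timeMeasure {T δ : ℝ} (hδ : 0 < δ) (hT : δ ≤ T) {P : ℝ → Prop}
    (h : ∀ᵐ r ∂(timeMeasure T), P r) : ∃ r, 0 < r ∧ r < δ ∧ P r := by
  by_contra! hcon
  have h1 : ∀ᵐ r ∂(volume.restrict (Ioo 0 δ)), P r :=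
    ae_restrict_of_ae_restrict_of_subset
      (fun r hr => ⟨hr.1.le, hr.2.le.trans hT⟩ : Ioo 0 δ ⊆ Icc 0 T) h
  have h2 : ∀ᵐ r ∂(volume.restrict (Ioo 0 δ)), False := by
    filter_upwards [h1, ae_restrict_mem measurableSet_Ioo] with r hr hm
    exact hcon r hm.1 hm.2 hr
  have h3 := ae_eq_bot.1 (eventually_false_iff_eq_bot.1 h2)
  have h4 : (volume.restrict (Ioo 0 δ)) univ = 0 := by rw [h3]; simp
  rw [Measure.restrict_apply_univ, Real.volume_Ioo, ENNReal.ofReal_eq_zero] at h4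
  linarith

theorem sliceDist_triangle {p : ℝ} (hp : 1 ≤ p) {v : ℝ → Euc m → ℝ}
    (hv : Measurable (Function.uncurry v)) (a b c : ℝ) :
    sliceDist p v a c ≤ sliceDist p v a b + sliceDist p v b c :=
  cubeLp_sub_le_add hp (measurable_slice hv a).aestronglyMeasurable
    (measurable_slice hv b).aestronglyMeasurable (measurable_slice hv c).aestronglyMeasurable

theorem sliceDist_comm (p : ℝ) (v : ℝ → Euc m → ℝ) (a b : ℝ) :
    sliceDist p v a b = sliceDist p v b a := cubeLp_sub_comm _ _ _

theorem exists_const_slice_holder {p θ : ℝ} (hp : 1 ≤ p) (hθ : 1 / p < θ) :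
    ∃ C : ℝ≥0, ∀ (T : ℝ) (v : ℝ → Euc m → ℝ), Measurable (Function.uncurry v) →
      tSem p θ T (sliceDist p v) < ⊤ →
      ∀ᵐ t ∂(timeMeasure T), ∀ᵐ r ∂(timeMeasure T), sliceDist p v t r ≤
        C * (.ofReal (|t - r| ^ (θ - 1 / p)) * tSem p θ T (sliceDist p v)) := by
  obtain ⟨C, hC⟩ := exists_const_time_holder hp hθ
  exact ⟨C, fun T v hv hfin => hC T _ (measurable_cubeLp_sub (by linarith) hv)
    (sliceDist_triangle hp hv) (sliceDist_comm p v) hfin⟩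

/-- Hölder continuity in time between `t` and some `r < t` so close to zero that the slice at `r` is
small. The decay at `t = 0` makes the later sup bound uniform for short intervals. -/
theorem exists_const_slice_le_of_zeroTrace {p θ : ℝ} (hp : 1 ≤ p) (hθ : 1 / p < θ) :
    ∃ C : ℝ≥0, ∀ (T : ℝ) (v : ℝ → Euc m → ℝ), Measurable (Function.uncurry v) →
      tSem p θ T (sliceDist p v) < ⊤ → SliceZeroTrace p T v →
      ∀ᵐ t ∂(timeMeasure T), cubeLp p (v t) ≤
        C * (.ofReal (t ^ (θ - 1 / p)) * tSem p θ T (sliceDist p v)) := by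
  obtain ⟨C, hC⟩ := exists_const_slice_holder (m := m) hp hθ
  refine ⟨C, fun T v hv hfin hz => ?_⟩
  filter_upwards [hC T v hv hfin, ae_timeMeasure_mem T, ae_timeMeasure_ne T 0] with t ht htT ht0
  have htpos : 0 < t := lt_of_le_of_ne htT.1 ht0.symm
  refine ENNReal.le_of_forall_pos_le_add fun ε hε _ => ?_
  obtain ⟨δ, hδ, hr⟩ := hz ε hε
  obtain ⟨r, hr0, hrδ, h1, h2⟩ := exists_mem_of_ae_timeMeasure (lt_min hδ htpos)
    ((min_le_right _ _).trans htT.2) (ht.and hr)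
  have hrt : r < t := hrδ.trans_le (min_le_right _ _)
  have h3 : cubeLp p (v t) ≤ sliceDist p v t r + cubeLp p (v r) := by
    have := cubeLp_add_le hp ((measurable_slice hv t).sub (measurable_slice hv r)).aestronglyMeasurable
      (measurable_slice hv r).aestronglyMeasurable
    rwa [sub_add_cancel] at this
  refine h3.trans (add_le_add (h1.trans ?_) (h2 (hrδ.trans_le (min_le_left _ _))))
  gcongr
  rw [abs_of_pos (by linarith)]
  linarith

/-- The uniform sup-bound for functions of vanishing trace. -/
theorem exists_const_sup_le {p s θ β : ℝ} (hp : 1 ≤ p) (hs : 1 / p < (s - m / p) / 2)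
    (hβ0 : 0 ≤ β) (hβ : (s - m / p) / 2 ≤ θ - β / 2) (C₀ : ℝ≥0) :
    ∃ C : ℝ≥0, ∀ T : ℝ, 0 < T → ∀ (v w : ℝ → Euc m → ℝ), Measurable (Function.uncurry v) →
      Measurable (Function.uncurry w) → SupEst C₀ p s β T v w →
      tLp p T (fun t => cubeSeminorm p s (w t)) < ⊤ → tSem p θ T (sliceDist p v) < ⊤ →
      SliceZeroTrace p T v →
      ∀ᵐ t ∂(timeMeasure T), cubeSup (w t) ≤
        C * (tLp p T (fun t => cubeSeminorm p s (w t)) + tSem p θ T (sliceDist p v) +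
          tLp p T (fun t => cubeLp p (v t))) := by
  have hp0 : 0 < p := by linarith
  have hθ : 1 / p < θ := by linarith
  have hθ0 : 0 < θ := lt_trans (by positivity) hθ
  obtain ⟨C1, hC1⟩ := exists_const_sup_average_le (m := m) hp hs hθ0 hβ C₀
  obtain ⟨C2, hC2⟩ := exists_const_slice_le_of_zeroTrace (m := m) hp hθ
  refine ⟨C1 + C₀ * 2 + C₀ * 2 + C₀ * C2, fun T hT v w hv hw est hN hD hz => ?_⟩
  set MN := tLp p T (fun t => cubeSeminorm p s (w t))
  set MD := tSem p θ T (sliceDist p v)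
  set ME := tLp p T (fun t => cubeLp p (v t))
  -- The largest admissible scale: the kernels must fit into `[0, T]`, and the interpolation needs
  -- `h ≤ 1`.
  set h := min 1 T with hh
  have h0 : 0 < h := lt_min one_pos hT
  have h1 : h ≤ 1 := min_le_left _ _
  have h2 : h ≤ T := min_le_right _ _
  have mN := measurable_cubeSeminorm (p := p) (s := s) hw
  have mE := measurable_cubeLp hp0 hv
  have mS := measurable_cubeSup hw
  have pow_le : ∀ e : ℝ, 0 ≤ e → ENNReal.ofReal (h ^ e) ≤ 1 := fun e he => by
    rw [ENNReal.ofReal_le_one]; exact Real.rpow_le_one h0.le h1 he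
  filter_upwards [hC1 T v w hv hw est hN hD h h0 h1 h2, ae_timeMeasure_mem T] with t ht htT
  have kt := isKernel_tker h0 h2 htT
  have mSt : Measurable fun z => .ofReal (tker T h t z) * cubeSup (w t - w z) := by
    refine kt.meas.mul (measurable_cubeSup (f := fun z => w t - w z) ?_)
    exact ((measurable_slice hw t).comp measurable_snd).sub hw
  have step1 : cubeSup (w t) ≤ ∫⁻ z, .ofReal (tker T h t z) * cubeSup (w t - w z) ∂(timeMeasure T) +
      ∫⁻ z, .ofReal (tker T h t z) * cubeSup (w z) ∂(timeMeasure T) := by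
    rw [← kt.lintegral_mul_const (cubeSup (w t)), ← lintegral_add_left mSt]
    refine lintegral_mono fun z => ?_
    rw [← mul_add]
    gcongr
    simpa using cubeSup_add_le (w t - w z) (w z)
  have avE : ENNReal.ofReal (h ^ (-β / 2)) *
      ∫⁻ z, .ofReal (tker T h t z) * cubeLp p (v z) ∂(timeMeasure T) ≤ C2 * MD + 2 * ME := by
    -- If `T ≥ 1` then `h = 1` and the `L_p`-norm of `v` suffices. If `T ≤ 1` then `h = T`, and the
    -- singular factor `h ^ (-β / 2)` is absorbed by the decay `h ^ (θ - 1 / p)` coming from the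
    -- vanishing trace, since `θ - β / 2 > 1 / p`.
    rcases le_total 1 T with h1T | hT1
    · have hh1 : h = 1 := min_eq_left h1T
      have := tker_average_le hp h0 h2 htT mE.aemeasurable
      simp only [hh1, Real.one_rpow, ENNReal.ofReal_one, one_mul] at this ⊢
      exact this.trans le_add_self
    · have hhT : h = T := min_eq_right hT1
      have h3 : ∫⁻ z, .ofReal (tker T h t z) * cubeLp p (v z) ∂(timeMeasure T) ≤
          C2 * (.ofReal (h ^ (θ - 1 / p)) * MD) := by
        rw [← kt.lintegral_mul_const (C2 * (.ofReal (h ^ (θ - 1 / p)) * MD))]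
        refine lintegral_mono_ae ?_
        filter_upwards [hC2 T v hv hD hz, ae_timeMeasure_mem T] with z hz hzT
        gcongr
        refine hz.trans ?_
        gcongr
        · exact hzT.1
        · exact hzT.2.trans hhT.ge
      calc _ ≤ ENNReal.ofReal (h ^ (-β / 2)) * (C2 * (.ofReal (h ^ (θ - 1 / p)) * MD)) := by gcongr
        _ = .ofReal (h ^ (-β / 2 + (θ - 1 / p))) * (C2 * MD) := by
          rw [Real.rpow_add h0, ENNReal.ofReal_mul (by positivity)]; ring
        _ ≤ 1 * (C2 * MD) := by
          gcongr
          exact pow_le _ (by linarith)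
        _ ≤ _ := by rw [one_mul]; exact le_self_add
  have step2 : ∫⁻ z, .ofReal (tker T h t z) * cubeSup (w z) ∂(timeMeasure T) ≤
      C₀ * (2 * MN) + C₀ * (C2 * MD + 2 * ME) := by
    have e := est.single (h ^ (1 / 2 : ℝ)) (by positivity)
      (Real.rpow_le_one h0.le h1 (by norm_num))
    simp only [sqrt_rpow h0] at e
    calc _ ≤ ∫⁻ z, .ofReal (tker T h t z) *
          (C₀ * .ofReal (h ^ ((s - m / p) / 2)) * (0 + cubeSeminorm p s (w z)) +
            C₀ * .ofReal (h ^ (-β / 2)) * cubeLp p (v z)) ∂(timeMeasure T) := by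
          refine lintegral_mono_ae ?_
          filter_upwards [e] with z hz
          gcongr
          refine hz.trans (le_of_eq ?_)
          rw [zero_add]; ring
      _ = C₀ * .ofReal (h ^ ((s - m / p) / 2)) *
            (0 + ∫⁻ z, .ofReal (tker T h t z) * cubeSeminorm p s (w z) ∂(timeMeasure T)) +
          C₀ * .ofReal (h ^ (-β / 2)) *
            ∫⁻ z, .ofReal (tker T h t z) * cubeLp p (v z) ∂(timeMeasure T) :=
          kt.lintegral_affine mN mE _ _ _
      _ ≤ C₀ * .ofReal (h ^ ((s - m / p) / 2)) * (2 * (.ofReal (h ^ (-(1 / p))) * MN)) +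
          C₀ * (C2 * MD + 2 * ME) := by
          rw [zero_add, mul_assoc (C₀ : ℝ≥0∞) (.ofReal (h ^ (-β / 2)))]
          gcongr
          exact tker_average_le hp h0 h2 htT mN.aemeasurable
      _ = C₀ * (.ofReal (h ^ ((s - m / p) / 2 + -(1 / p))) * (2 * MN)) +
          C₀ * (C2 * MD + 2 * ME) := by
          rw [Real.rpow_add h0, ENNReal.ofReal_mul (by positivity)]; ring
      _ ≤ C₀ * (1 * (2 * MN)) + C₀ * (C2 * MD + 2 * ME) := by
          gcongr
          exact pow_le _ (by linarith)
      _ = _ := by rw [one_mul]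
  calc cubeSup (w t) ≤ C1 * (1 * (MN + MD)) + (C₀ * (2 * MN) + C₀ * (C2 * MD + 2 * ME)) := by
        refine step1.trans (add_le_add (ht.trans ?_) step2)
        gcongr
        exact pow_le _ (by linarith)
    _ = C1 * (MN + MD) + C₀ * 2 * MN + C₀ * 2 * ME + C₀ * C2 * MD := by ring
    _ ≤ C1 * (MN + MD + ME) + C₀ * 2 * (MN + MD + ME) + C₀ * 2 * (MN + MD + ME) +
        C₀ * C2 * (MN + MD + ME) := by
        have q1 : MN ≤ MN + MD + ME := le_self_add.trans le_self_add
        have q2 : MD ≤ MN + MD + ME := le_add_self.trans le_self_add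
        have q3 : ME ≤ MN + MD + ME := le_add_self
        have q4 : MN + MD ≤ MN + MD + ME := le_self_add
        exact add_le_add (add_le_add (add_le_add (mul_le_mul_right q4 _) (mul_le_mul_right q1 _))
          (mul_le_mul_right q3 _)) (mul_le_mul_right q2 _)
    _ = _ := by push_cast; ring

end Cylinder

/-! ### Continuous representatives on a cylinder -/

section ContinuousRep

variable {m : ℕ}

theorem timeMeasure_prod_restrict (T : ℝ) (V : Set (Euc m)) :
    (timeMeasure T).prod (volume.restrict V) =
      (volume : Measure (ℝ × Euc m)).restrict (Icc 0 T ×ˢ V) := by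
  rw [timeMeasure, Measure.prod_restrict, Measure.volume_eq_prod]

/-- The set where the bound fails is relatively open. If nonempty it meets the dense open part with
`0 < t < T` in a nonempty open set, which has positive measure. -/
theorem le_of_ae_le_of_continuousOn {T : ℝ} (hT : 0 < T) {V : Set (Euc m)} (hV : IsOpen V)
    {g : ℝ × Euc m → ℝ} (hg : ContinuousOn g (Icc 0 T ×ˢ V)) {c : ℝ}
    (h : ∀ᵐ z ∂((timeMeasure T).prod (volume.restrict V)), g z ≤ c) :
    ∀ z ∈ Icc 0 T ×ˢ V, g z ≤ c := by
  intro z0 hz0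
  by_contra! hc
  obtain ⟨N, hN, hN2⟩ := (continuousOn_iff'.1 hg) (Ioi c) isOpen_Ioi
  have hz0N : z0 ∈ N := by
    have : z0 ∈ g ⁻¹' Ioi c ∩ Icc 0 T ×ˢ V := ⟨hc, hz0⟩
    rw [hN2] at this
    exact this.1
  have hcl : z0 ∈ closure (Ioo 0 T ×ˢ V) := by
    rw [closure_prod_eq, closure_Ioo hT.ne]
    exact ⟨hz0.1, subset_closure hz0.2⟩
  have hne : (N ∩ Ioo 0 T ×ˢ V).Nonempty := mem_closure_iff.1 hcl N hN hz0N
  have hop : IsOpen (N ∩ Ioo 0 T ×ˢ V) := hN.inter (isOpen_Ioo.prod hV)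
  have hpos := hop.measure_pos volume hne
  rw [timeMeasure_prod_restrict, ae_restrict_iff' (measurableSet_Icc.prod hV.measurableSet)] at h
  refine hpos.ne' (measure_mono_null (fun z hz => ?_) h)
  have hzD : z ∈ Icc 0 T ×ˢ V := ⟨Ioo_subset_Icc_self hz.2.1, hz.2.2⟩
  have : z ∈ g ⁻¹' Ioi c ∩ Icc 0 T ×ˢ V := by rw [hN2]; exact ⟨hz.1, hzD⟩
  simp only [mem_compl_iff, mem_ofPred_eq, not_forall, not_le]
  exact ⟨hzD, this.1⟩

/-- Continuous functions that are almost everywhere close are close everywhere, so the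
approximations are uniformly Cauchy on the cylinder. Their uniform limit is continuous and agrees
with `f` almost everywhere. -/
theorem exists_continuousOn_of_approx {T : ℝ} (hT : 0 < T) {f : ℝ × Euc m → ℝ}
    (F : ℕ → ℝ × Euc m → ℝ) (hF : ∀ n, Continuous (F n)) (δ : ℕ → ℝ)
    (hδ : Tendsto δ atTop (𝓝 0))
    (h : ∀ n, ∀ᵐ z ∂((timeMeasure T).prod (cubeMeasure m)), |f z - F n z| ≤ δ n) :
    ∃ G : ℝ × Euc m → ℝ, ContinuousOn G (Icc 0 T ×ˢ cube m) ∧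
      ∀ᵐ z ∂((timeMeasure T).prod (cubeMeasure m)), G z = f z := by
  set D := Icc 0 T ×ˢ cube m
  have hcl : ∀ n k, ∀ z ∈ D, |F n z - F k z| ≤ δ n + δ k := fun n k => by
    refine le_of_ae_le_of_continuousOn hT (isOpen_cube m)
      ((hF n).sub (hF k)).abs.continuousOn ?_
    filter_upwards [h n, h k] with z hn hk
    have e := abs_sub_le (F n z) (f z) (F k z)
    have e' := abs_sub_comm (F n z) (f z)
    change |F n z - F k z| ≤ _
    linarith
  have hcau : UniformCauchySeqOn F atTop D := by
    rw [Metric.uniformCauchySeqOn_iff]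
    intro ε hε
    obtain ⟨N, hN⟩ := eventually_atTop.1 (hδ.eventually (gt_mem_nhds (half_pos hε)))
    refine ⟨N, fun n hn k hk z hz => ?_⟩
    rw [Real.dist_eq]
    linarith [hcl n k z hz, hN n hn, hN k hk]
  have hlim : ∀ z ∈ D, ∃ y, Tendsto (fun n => F n z) atTop (𝓝 y) := fun z hz =>
    cauchySeq_tendsto_of_complete (hcau.cauchySeq hz)
  choose! G hG using hlim
  refine ⟨G, (hcau.tendstoUniformlyOn_of_tendsto hG).continuousOn
    (Frequently.of_forall fun n => (hF n).continuousOn), ?_⟩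
  have hmem : ∀ᵐ z ∂((timeMeasure T).prod (cubeMeasure m)), z ∈ D := by
    rw [cubeMeasure, timeMeasure_prod_restrict]
    exact ae_restrict_mem (measurableSet_Icc.prod (measurableSet_cube m))
  filter_upwards [ae_all_iff.2 h, hmem] with z hz hzD
  refine tendsto_nhds_unique (hG z hzD) ?_
  rw [tendsto_iff_norm_sub_tendsto_zero]
  refine squeeze_zero (fun n => norm_nonneg _) (fun n => ?_) hδ
  rw [Real.norm_eq_abs, abs_sub_comm]
  exact hz n

theorem integrable_of_tLp {p T : ℝ} (hp : 1 ≤ p) {f : ℝ → Euc m → ℝ}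
    (hf : Measurable (Function.uncurry f)) (h : tLp p T (fun t => cubeLp p (f t)) < ⊤) :
    Integrable (Function.uncurry f) ((timeMeasure T).prod (cubeMeasure m)) := by
  have hp0 : 0 < p := by linarith
  refine MemLp.integrable (q := ENNReal.ofReal p) (by simpa using hp)
    ⟨hf.aestronglyMeasurable, ?_⟩
  rw [eLpNorm_eq_lintegral_rpow_enorm_toReal (by simpa using hp0) ENNReal.ofReal_ne_top,
    ENNReal.toReal_ofReal hp0.le, lintegral_prod _ (hf.enorm.pow_const p).aemeasurable]
  refine lt_of_eq_of_lt ?_ h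
  rw [tLp]
  congr 1
  refine lintegral_congr fun t => ?_
  rw [cubeLp_eq hp0, ← ENNReal.rpow_mul, one_div_mul_cancel hp0.ne', ENNReal.rpow_one]
  rfl

/-- Averages in time and space. -/
def cylAvg (T h r : ℝ) (f : ℝ → Euc m → ℝ) (q : ℝ × Euc m) : ℝ :=
  ∫ z, tker T h q.1 z.1 * (mol r q.2 z.2 * f z.1 z.2) ∂((timeMeasure T).prod (cubeMeasure m))

theorem norm_cylAvg_integrand_le {T h r : ℝ} (hh : 0 < h) (hr : 0 < r) (f : ℝ → Euc m → ℝ)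
    (q z : ℝ × Euc m) : ‖tker T h q.1 z.1 * (mol r q.2 z.2 * f z.1 z.2)‖ ≤
      2 * h ^ (-1 : ℝ) * (bumpB m * r ^ (-(m : ℝ)) * ‖f z.1 z.2‖) := by
  rw [norm_mul, norm_mul, Real.norm_of_nonneg (tker_nonneg hh _),
    Real.norm_of_nonneg (mol_nonneg hr _ _)]
  have := mul_nonneg (mol_nonneg hr q.2 z.2) (norm_nonneg (f z.1 z.2))
  gcongr
  · exact tker_le hh _
  · exact mol_le hr _ _

theorem continuous_mol_comp {X : Type*} [TopologicalSpace X] {a b : X → Euc m} (r : ℝ)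
    (ha : Continuous a) (hb : Continuous b) : Continuous fun z => mol r (a z) (b z) :=
  Continuous.comp (g := Function.uncurry (mol r)) (f := fun z => (a z, b z)) (continuous_mol r)
    (ha.prodMk hb)

theorem continuous_tker_comp {X : Type*} [TopologicalSpace X] {a b : X → ℝ} (T h : ℝ)
    (ha : Continuous a) (hb : Continuous b) : Continuous fun z => tker T h (a z) (b z) :=
  Continuous.comp (g := Function.uncurry (tker T h)) (f := fun z => (a z, b z))
    (continuous_tker T h) (ha.prodMk hb)

theorem aestronglyMeasurable_cylAvg_integrand {T h r : ℝ} {f : ℝ → Euc m → ℝ}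
    (hf : Measurable (Function.uncurry f)) (q : ℝ × Euc m) :
    AEStronglyMeasurable (fun z : ℝ × Euc m => tker T h q.1 z.1 * (mol r q.2 z.2 * f z.1 z.2))
      ((timeMeasure T).prod (cubeMeasure m)) := by
  have h1 : Continuous fun z : ℝ × Euc m => tker T h q.1 z.1 :=
    continuous_tker_comp T h continuous_const continuous_fst
  have h2 : Continuous fun z : ℝ × Euc m => mol r q.2 z.2 :=
    continuous_mol_comp r continuous_const continuous_snd
  have h3 : Measurable fun z : ℝ × Euc m => f z.1 z.2 := hf
  exact (h1.measurable.mul (h2.measurable.mul h3)).aestronglyMeasurable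

theorem integrable_cylAvg_integrand {T h r : ℝ} (hh : 0 < h) (hr : 0 < r) {f : ℝ → Euc m → ℝ}
    (hf : Measurable (Function.uncurry f))
    (hi : Integrable (Function.uncurry f) ((timeMeasure T).prod (cubeMeasure m)))
    (q : ℝ × Euc m) :
    Integrable (fun z : ℝ × Euc m => tker T h q.1 z.1 * (mol r q.2 z.2 * f z.1 z.2))
      ((timeMeasure T).prod (cubeMeasure m)) :=
  ((hi.norm.const_mul _).const_mul _).mono' (aestronglyMeasurable_cylAvg_integrand hf q)
    (Eventually.of_forall fun z => norm_cylAvg_integrand_le hh hr f q z)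

theorem continuous_cylAvg {T h r : ℝ} (hh : 0 < h) (hr : 0 < r) {f : ℝ → Euc m → ℝ}
    (hf : Measurable (Function.uncurry f))
    (hi : Integrable (Function.uncurry f) ((timeMeasure T).prod (cubeMeasure m))) :
    Continuous (cylAvg T h r f) := by
  refine continuous_of_dominated (fun q => aestronglyMeasurable_cylAvg_integrand hf q)
    (fun q => Eventually.of_forall fun z => norm_cylAvg_integrand_le hh hr f q z)
    ((hi.norm.const_mul _).const_mul _) (Eventually.of_forall fun z => ?_)
  have h1 : Continuous fun q : ℝ × Euc m => tker T h q.1 z.1 :=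
    continuous_tker_comp T h continuous_fst continuous_const
  have h2 : Continuous fun q : ℝ × Euc m => mol r q.2 z.2 :=
    continuous_mol_comp r continuous_snd continuous_const
  exact h1.mul (h2.mul continuous_const)

theorem cylAvg_eq {T h r : ℝ} (hh : 0 < h) (hr : 0 < r) {f : ℝ → Euc m → ℝ}
    (hf : Measurable (Function.uncurry f))
    (hi : Integrable (Function.uncurry f) ((timeMeasure T).prod (cubeMeasure m)))
    (t : ℝ) (x : Euc m) :
    cylAvg T h r f (t, x) = ∫ z, tker T h t z * avg r (f z) x ∂(timeMeasure T) := by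
  rw [cylAvg, integral_prod _ (integrable_cylAvg_integrand hh hr hf hi (t, x))]
  simp only [integral_const_mul, avg]

theorem integrable_tker_avg {T h r : ℝ} (hh : 0 < h) (hr : 0 < r) {f : ℝ → Euc m → ℝ}
    (hf : Measurable (Function.uncurry f))
    (hi : Integrable (Function.uncurry f) ((timeMeasure T).prod (cubeMeasure m)))
    (t : ℝ) (x : Euc m) :
    Integrable (fun z => tker T h t z * avg r (f z) x) (timeMeasure T) := by
  have := (integrable_cylAvg_integrand hh hr hf hi (t, x)).integral_prod_left
  simpa only [integral_const_mul, avg] using this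

theorem enorm_sub_cylAvg_le {T h r : ℝ} (hh : 0 < h) (hT : h ≤ T) (hr : 0 < r)
    {f : ℝ → Euc m → ℝ} (hf : Measurable (Function.uncurry f))
    (hi : Integrable (Function.uncurry f) ((timeMeasure T).prod (cubeMeasure m)))
    {t : ℝ} (ht : t ∈ Icc 0 T) (x : Euc m) (c : ℝ) :
    ‖c - cylAvg T h r f (t, x)‖ₑ ≤
      ∫⁻ z, .ofReal (tker T h t z) * ‖c - avg r (f z) x‖ₑ ∂(timeMeasure T) := by
  have h1 : Integrable (fun z => tker T h t z * c) (timeMeasure T) := by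
    have hc : Continuous fun z => tker T h t z :=
      continuous_tker_comp T h continuous_const continuous_id
    exact (hc.integrableOn_Icc).mul_const c
  have h2 : ∫ z, tker T h t z * c ∂(timeMeasure T) = c := by
    have := integral_tker hh hT ht
    rw [integral_mul_const, timeMeasure, this, one_mul]
  have h3 : c - cylAvg T h r f (t, x) =
      ∫ z, tker T h t z * (c - avg r (f z) x) ∂(timeMeasure T) := by
    rw [cylAvg_eq hh hr hf hi]
    simp only [mul_sub]
    rw [integral_sub h1 (integrable_tker_avg hh hr hf hi t x), h2]
  rw [h3]
  refine (enorm_integral_le_lintegral_enorm _).trans (le_of_eq ?_)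
  simp only [enorm_mul, Real.enorm_of_nonneg (tker_nonneg hh _)]

theorem measurable_avg_uncurry {r : ℝ} {f : ℝ → Euc m → ℝ} (hf : Measurable (Function.uncurry f)) :
    Measurable fun q : ℝ × Euc m => avg r (f q.1) q.2 := by
  have h1 : Measurable fun q : (ℝ × Euc m) × Euc m => mol r q.1.2 q.2 * f q.1.1 q.2 := by
    refine Measurable.mul (continuous_mol_comp r (continuous_snd.comp continuous_fst)
      continuous_snd).measurable ?_
    exact hf.comp (by fun_prop : Measurable fun q : (ℝ × Euc m) × Euc m => (q.1.1, q.2))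
  exact (h1.stronglyMeasurable.integral_prod_right').measurable

/-- Functions with sufficient mixed regularity have a continuous representative. -/
theorem exists_continuousOn_rep {p s θ T : ℝ} (hm : 1 ≤ m) (hp : 1 ≤ p)
    (hs : 1 / p < (s - m / p) / 2) (hsθ : s / 2 ≤ θ) (hT : 0 < T) {f : ℝ → Euc m → ℝ}
    (hf : Measurable (Function.uncurry f)) (hE : tLp p T (fun t => cubeLp p (f t)) < ⊤)
    (hN : tLp p T (fun t => cubeSeminorm p s (f t)) < ⊤)
    (hD : tSem p θ T (sliceDist p f) < ⊤) :
    ∃ G : ℝ × Euc m → ℝ, ContinuousOn G (Icc 0 T ×ˢ cube m) ∧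
      ∀ᵐ z ∂((timeMeasure T).prod (cubeMeasure m)), G z = f z.1 z.2 := by
  have hp0 : 0 < p := by linarith
  have hp1 : 0 < 1 / p := by positivity
  have hmp : 0 ≤ (m : ℝ) / p := by positivity
  have hsm : (m : ℝ) / p < s := by linarith
  obtain ⟨C₀, hC₀⟩ := exists_const_supEst hm hp hsm
  -- For `β = m / p` the required exponent inequality is just `s / 2 ≤ θ`.
  obtain ⟨C1, hC1⟩ := exists_const_sup_average_le (m := m) (β := m / p) (θ := θ) hp hs
    (by linarith) (by linarith) C₀
  obtain ⟨C2, hC2⟩ := exists_const_ae_sub_avg_le hm hp hsm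
  set MN := tLp p T (fun t => cubeSeminorm p s (f t)) with hMN
  set MD := tSem p θ T (sliceDist p f) with hMD
  have hi := integrable_of_tLp hp hf hE
  have est := hC₀ T f hf hE
  set γ := (s - m / p) / 2 - 1 / p with hγ
  have hγ0 : 0 < γ := by linarith
  set M : ℝ≥0∞ := (C1 + 2 * C2) * (MN + MD) with hM
  have hMt : M ≠ ⊤ := by
    rw [hM]
    have h1 := hN.ne
    have h2 := hD.ne
    finiteness
  set h0 := min 1 T with hh0
  have h00 : 0 < h0 := lt_min one_pos hT
  -- Time scale of the `n`-th approximation; the spatial scale is its square root.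
  set h : ℕ → ℝ := fun n => h0 / 2 ^ n
  have hpos : ∀ n, 0 < h n := fun n => by positivity
  have hle : ∀ n, h n ≤ h0 := fun n => div_le_self h00.le (one_le_pow₀ (by norm_num))
  have hle1 : ∀ n, h n ≤ 1 := fun n => (hle n).trans (min_le_left _ _)
  have hleT : ∀ n, h n ≤ T := fun n => (hle n).trans (min_le_right _ _)
  have hr0 : ∀ n, 0 < h n ^ (1 / 2 : ℝ) := fun n => Real.rpow_pos_of_pos (hpos n) _
  have hr1 : ∀ n, h n ^ (1 / 2 : ℝ) ≤ 1 := fun n =>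
    Real.rpow_le_one (hpos n).le (hle1 n) (by norm_num)
  have hlim := tendsto_half_pow_rpow h00 hγ0 1 zero_le_one hMt
  have hfin : ∀ n, ENNReal.ofReal (1 * h n ^ γ) * M ≠ ⊤ := fun n =>
    ENNReal.mul_ne_top ENNReal.ofReal_ne_top hMt
  refine exists_continuousOn_of_approx hT (f := fun z => f z.1 z.2)
    (fun n => cylAvg T (h n) (h n ^ (1 / 2 : ℝ)) f)
    (fun n => continuous_cylAvg (hpos n) (hr0 n) hf hi)
    (fun n => (ENNReal.ofReal (1 * h n ^ γ) * M).toReal)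
    (by simpa only [ENNReal.toReal_zero] using!
      (ENNReal.tendsto_toReal ENNReal.zero_ne_top).comp hlim) fun n => ?_
  -- The error splits into the oscillation of `f` in time, measured in sup norm, and the spatial
  -- mollification error at the averaged times. Both are of order `h ^ γ`.
  have key : ∀ᵐ t ∂(timeMeasure T), ∀ᵐ x ∂(cubeMeasure m),
      ‖f t x - cylAvg T (h n) (h n ^ (1 / 2 : ℝ)) f (t, x)‖ₑ ≤ ENNReal.ofReal (1 * h n ^ γ) * M := by
    have mAvg := measurable_avg_uncurry (r := h n ^ (1 / 2 : ℝ)) hf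
    have mSem := measurable_cubeSeminorm (p := p) (s := s) hf
    have hB : ∀ᵐ x ∂(cubeMeasure m), ∀ᵐ z ∂(timeMeasure T),
        ‖f z x - avg (h n ^ (1 / 2 : ℝ)) (f z) x‖ₑ ≤
          C2 * (.ofReal (h n ^ ((s - m / p) / 2)) * cubeSeminorm p s (f z)) := by
      -- The spatial estimate holds for almost every time outside a null set of points that depends
      -- on the time. Fubini reverses the order, so that `x` can be fixed before averaging in time.
      rw [← Measure.ae_ae_comm]
      · filter_upwards [ae_cubeLp_lt_top hp hf hE] with z hz
        have := hC2 (f z) (measurable_slice hf z)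
          (integrable_of_cubeLp hp (measurable_slice hf z).aestronglyMeasurable hz) _ (hr0 n) (hr1 n)
        simpa only [sqrt_rpow (hpos n)] using this
      · exact measurableSet_le (hf.sub mAvg).enorm
          (((mSem.comp measurable_fst).const_mul _).const_mul _)
    filter_upwards [hC1 T f f hf hf est hN hD (h n) (hpos n) (hle1 n) (hleT n),
      ae_timeMeasure_mem T] with t ht htT
    have kt := isKernel_tker (hpos n) (hleT n) htT
    have mft : Measurable fun q : ℝ × Euc m => f t q.2 := (measurable_slice hf t).comp measurable_snd
    have mS : Measurable fun z => cubeSup (f t - f z) :=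
      measurable_cubeSup (f := fun z => f t - f z) (mft.sub hf)
    have hA : ∀ᵐ x ∂(cubeMeasure m), ∀ᵐ z ∂(timeMeasure T),
        ‖f t x - f z x‖ₑ ≤ cubeSup (f t - f z) := by
      rw [← Measure.ae_ae_comm]
      · exact Eventually.of_forall fun z => ae_le_cubeSup (f t - f z)
      · exact measurableSet_le (mft.sub hf).enorm (mS.comp measurable_fst)
    filter_upwards [hA, hB] with x hAx hBx
    refine (enorm_sub_cylAvg_le (hpos n) (hleT n) (hr0 n) hf hi htT x (f t x)).trans ?_
    calc _ ≤ ∫⁻ z, (.ofReal (tker T (h n) t z) * cubeSup (f t - f z) +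
          .ofReal (tker T (h n) t z) *
            (C2 * .ofReal (h n ^ ((s - m / p) / 2)) * cubeSeminorm p s (f z))) ∂(timeMeasure T) := by
          refine lintegral_mono_ae ?_
          filter_upwards [hAx, hBx] with z hz1 hz2
          rw [← mul_add]
          gcongr
          have e : f t x - avg (h n ^ (1 / 2 : ℝ)) (f z) x =
              (f t x - f z x) + (f z x - avg (h n ^ (1 / 2 : ℝ)) (f z) x) := by ring
          rw [e]
          exact (enorm_add_le _ _).trans (add_le_add hz1 (hz2.trans (le_of_eq (by ring))))
      _ = ∫⁻ z, .ofReal (tker T (h n) t z) * cubeSup (f t - f z) ∂(timeMeasure T) +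
          C2 * .ofReal (h n ^ ((s - m / p) / 2)) *
            ∫⁻ z, .ofReal (tker T (h n) t z) * cubeSeminorm p s (f z) ∂(timeMeasure T) := by
          have m1 : Measurable fun z => .ofReal (tker T (h n) t z) * cubeSup (f t - f z) :=
            kt.meas.mul mS
          have m2 : Measurable fun z => .ofReal (tker T (h n) t z) * cubeSeminorm p s (f z) :=
            kt.meas.mul mSem
          rw [lintegral_add_left m1, ← lintegral_const_mul _ m2]
          congr 1
          refine lintegral_congr fun z => by ring
      _ ≤ C1 * (.ofReal (h n ^ γ) * (MN + MD)) + C2 * .ofReal (h n ^ ((s - m / p) / 2)) *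
            (2 * (.ofReal (h n ^ (-(1 / p))) * MN)) :=
          add_le_add ht (mul_le_mul_right
            (tker_average_le hp (hpos n) (hleT n) htT mSem.aemeasurable) _)
      _ = C1 * (.ofReal (h n ^ γ) * (MN + MD)) + 2 * C2 * (.ofReal (h n ^ γ) * MN) := by
          rw [hγ, sub_eq_add_neg ((s - m / p) / 2), Real.rpow_add (hpos n),
            ENNReal.ofReal_mul (Real.rpow_nonneg (hpos n).le _)]
          ring
      _ ≤ C1 * (.ofReal (h n ^ γ) * (MN + MD)) + 2 * C2 * (.ofReal (h n ^ γ) * (MN + MD)) := by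
          gcongr
          exact le_self_add
      _ = _ := by rw [one_mul, hM]; ring
  have key2 : ∀ᵐ z ∂((timeMeasure T).prod (cubeMeasure m)),
      ‖f z.1 z.2 - cylAvg T (h n) (h n ^ (1 / 2 : ℝ)) f z‖ₑ ≤ ENNReal.ofReal (1 * h n ^ γ) * M := by
    rw [Measure.ae_prod_iff_ae_ae]
    · exact key
    · exact measurableSet_le (hf.sub (continuous_cylAvg (hpos n) (hr0 n) hf hi).measurable).enorm
        measurable_const
  filter_upwards [key2] with z hz
  rw [← Real.norm_eq_abs, ← ENNReal.ofReal_le_iff_le_toReal (hfin n), ofReal_norm]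
  exact hz

end ContinuousRep

/-! ### Products on a cylinder -/

section TimeNorms

variable {p T θ : ℝ} {N N' N'' : ℝ → ℝ≥0∞}

theorem tLp_mono (hp : 0 < p) (h : ∀ᵐ t ∂(timeMeasure T), N t ≤ N' t) :
    tLp p T N ≤ tLp p T N' := by
  refine ENNReal.rpow_le_rpow (lintegral_mono_ae ?_) (by positivity)
  filter_upwards [h] with t ht
  gcongr

theorem tLp_const_mul (hp : 0 < p) (c : ℝ≥0) : tLp p T (fun t => c * N t) = c * tLp p T N := by
  have hc : (c : ℝ≥0∞) ^ p ≠ ⊤ := ENNReal.rpow_ne_top_of_nonneg hp.le ENNReal.coe_ne_top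
  simp only [tLp, ENNReal.mul_rpow_of_nonneg _ _ hp.le]
  rw [lintegral_const_mul' _ _ hc, ENNReal.mul_rpow_of_nonneg _ _ (by positivity),
    ← ENNReal.rpow_mul, mul_one_div_cancel hp.ne', ENNReal.rpow_one]

theorem tLp_le_add (hp : 1 ≤ p) (hN : AEMeasurable N (timeMeasure T))
    (hN' : AEMeasurable N' (timeMeasure T)) (h : ∀ᵐ t ∂(timeMeasure T), N'' t ≤ N t + N' t) :
    tLp p T N'' ≤ tLp p T N + tLp p T N' :=
  (tLp_mono (by linarith) h).trans (ENNReal.lintegral_Lp_add_le hN hN' hp)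

theorem tLp_sum_le {ι : Type*} (hp : 1 ≤ p) (F : Finset ι) {N : ι → ℝ → ℝ≥0∞}
    (hN : ∀ i, AEMeasurable (N i) (timeMeasure T)) :
    tLp p T (fun t => ∑ i ∈ F, N i t) ≤ ∑ i ∈ F, tLp p T (N i) := by
  classical
  induction F using Finset.induction_on with
  | empty =>
    have hp0 : 0 < p := by linarith
    simp [tLp, ENNReal.zero_rpow_of_pos hp0, hp0]
  | insert i F hi ih =>
    rw [Finset.sum_insert hi]
    refine (tLp_le_add hp (hN i) (Finset.aemeasurable_fun_sum F fun j _ => hN j)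
      (Eventually.of_forall fun t => (Finset.sum_insert hi).le)).trans ?_
    gcongr

theorem measurable_time_weight (a : ℝ) :
    Measurable (Function.uncurry fun t r : ℝ => ‖t - r‖ₑ ^ a) :=
  (measurable_fst.sub measurable_snd).enorm.pow_const a

theorem tSem_sum_le {ι : Type*} (hp : 1 ≤ p) (F : Finset ι) {D : ι → ℝ → ℝ → ℝ≥0∞}
    (hD : ∀ i, AEMeasurable (Function.uncurry (D i)) ((timeMeasure T).prod (timeMeasure T))) :
    tSem p θ T (fun t r => ∑ i ∈ F, D i t r) ≤ ∑ i ∈ F, tSem p θ T (D i) := by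
  classical
  induction F using Finset.induction_on with
  | empty =>
    have hp0 : 0 < p := by linarith
    simp [tSem, wNorm, ENNReal.zero_rpow_of_pos hp0, hp0]
  | insert i F hi ih =>
    rw [Finset.sum_insert hi]
    have m1 : AEMeasurable (Function.uncurry fun t r => ∑ j ∈ F, D j t r)
        ((timeMeasure T).prod (timeMeasure T)) :=
      Finset.aemeasurable_fun_sum F (f := fun j => Function.uncurry (D j)) fun j _ => hD j
    refine (wNorm_le_add hp (measurable_time_weight _) (hD i) m1
      (Eventually.of_forall fun t => Eventually.of_forall fun r =>
        (Finset.sum_insert hi).le)).trans ?_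
    exact add_le_add_right ih _

/-- The kernel of the Slobodeckii functional, damped by a Hölder condition of higher order, is
integrable. -/
theorem exists_const_lintegral_holder_weight_le {γ : ℝ} (hp : 0 < p) (hθ : 0 < θ) (hγ : θ < γ) :
    ∃ K : ℝ≥0, ∀ t : ℝ,
      ∫⁻ r, .ofReal (min 1 (|t - r| ^ γ)) ^ p / ‖t - r‖ₑ ^ (1 + θ * p) ≤ (K : ℝ≥0∞) := by
  -- Near zero this is the power `γp - θp - 1`, integrable since `γ > θ`; at infinity the minimum
  -- leaves `-(1 + θp)`. Integrability on the whole half-line makes the constant independent of `T`.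
  set F : ℝ → ℝ := fun y => (min 1 (y ^ γ)) ^ p / y ^ (1 + θ * p) with hF
  have h1 : IntegrableOn F (Ioo 0 1) := by
    have h2 : IntegrableOn (fun y : ℝ => y ^ (γ * p - (1 + θ * p))) (Ioo 0 1) :=
      (intervalIntegral.integrableOn_Ioo_rpow_iff one_pos).2 (by nlinarith)
    refine h2.congr_fun (fun y hy => ?_) measurableSet_Ioo
    have : y ^ γ ≤ 1 := Real.rpow_le_one hy.1.le hy.2.le (by linarith)
    simp only [hF, min_eq_right this]
    rw [Real.rpow_sub hy.1, Real.rpow_mul hy.1.le]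
  have h3 : IntegrableOn F (Ici 1) := by
    have h2 : IntegrableOn (fun y : ℝ => y ^ (-(1 + θ * p))) (Ici 1) :=
      (integrableOn_Ici_iff_integrableOn_Ioi (by simp)).2
        (integrableOn_Ioi_rpow_of_lt (by nlinarith [mul_pos hθ hp]) one_pos)
    refine h2.congr_fun (fun y hy => ?_) measurableSet_Ici
    have hy0 : (0 : ℝ) < y := lt_of_lt_of_le one_pos hy
    have : 1 ≤ y ^ γ := Real.one_le_rpow hy (by linarith)
    simp only [hF, min_eq_left this, Real.one_rpow]
    rw [Real.rpow_neg hy0.le, one_div]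
  have h4 : IntegrableOn F (Ioi 0) := by
    rw [← Ioo_union_Ici_eq_Ioi (zero_lt_one' ℝ)]
    exact h1.union h3
  have h5 : Integrable (fun y : ℝ => F ‖y‖) := by
    rw [integrable_fun_norm_addHaar (μ := volume) (f := F)]
    simpa using h4
  refine ⟨(∫⁻ y : ℝ, ‖F ‖y‖‖ₑ).toNNReal, fun t => ?_⟩
  rw [ENNReal.coe_toNNReal h5.hasFiniteIntegral.ne,
    ← lintegral_sub_left_eq_self (fun y : ℝ => ‖F ‖y‖‖ₑ) t]
  refine lintegral_mono_ae ?_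
  have hne : ∀ᵐ r : ℝ, r ≠ t := by simp [ae_iff]
  filter_upwards [hne] with r hr
  have h0 : 0 < |t - r| := abs_pos.2 (sub_ne_zero.2 hr.symm)
  have hmin : 0 ≤ min 1 (|t - r| ^ γ) := le_min zero_le_one (by positivity)
  simp only [hF, Real.norm_eq_abs]
  have hF0 : 0 ≤ min 1 (|t - r| ^ γ) ^ p / |t - r| ^ (1 + θ * p) := by positivity
  rw [← ofReal_norm (t - r), Real.norm_eq_abs, Real.enorm_of_nonneg hF0,
    ENNReal.ofReal_div_of_pos (by positivity), ENNReal.ofReal_rpow_of_nonneg hmin hp.le,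
    ENNReal.ofReal_rpow_of_pos h0]

/-- As `N` depends on the first time only, it leaves the inner integral, whose kernel is integrable
uniformly in `t`. Near the diagonal the Hölder bound on `D` is used, far from it the uniform one. -/
theorem exists_const_tSem_holder_le {γ : ℝ} (hp : 1 ≤ p) (hθ : 0 < θ) (hγ : θ < γ) :
    ∃ K : ℝ≥0, ∀ (T : ℝ) (N : ℝ → ℝ≥0∞) (D : ℝ → ℝ → ℝ≥0∞) (M : ℝ≥0), Measurable N →
      (∀ᵐ t ∂(timeMeasure T), ∀ᵐ r ∂(timeMeasure T), D t r ≤ M) →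
      (∀ᵐ t ∂(timeMeasure T), ∀ᵐ r ∂(timeMeasure T), D t r ≤ M * .ofReal (|t - r| ^ γ)) →
      tSem p θ T (fun t r => N t * D t r) ≤ K * M * tLp p T N := by
  have hp0 : 0 < p := by linarith
  obtain ⟨K, hK⟩ := exists_const_lintegral_holder_weight_le (γ := γ) hp0 hθ hγ
  refine ⟨K ^ (1 / p), fun T N D M hN h1 h2 => ?_⟩
  calc _ ≤ tSem p θ T (fun t r => M * (N t * .ofReal (min 1 (|t - r| ^ γ)))) := by
        refine wNorm_mono hp0 ?_
        filter_upwards [h1, h2] with t ht1 ht2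
        filter_upwards [ht1, ht2] with r hr1 hr2
        calc N t * D t r ≤ N t * (M * .ofReal (min 1 (|t - r| ^ γ))) := by
              gcongr
              rw [ENNReal.ofReal_min, ENNReal.ofReal_one, mul_min, mul_one]
              exact le_min hr1 hr2
          _ = _ := by ring
    _ = M * tSem p θ T (fun t r => N t * .ofReal (min 1 (|t - r| ^ γ))) := wNorm_const_mul hp0 M
    _ ≤ M * ((K : ℝ≥0∞) ^ (1 / p) * tLp p T N) := by
        gcongr
        rw [tLp, ← ENNReal.mul_rpow_of_nonneg _ _ (by positivity), tSem, wNorm]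
        refine ENNReal.rpow_le_rpow ?_ (by positivity)
        rw [← lintegral_const_mul _ (hN.pow_const p)]
        refine lintegral_mono fun t => ?_
        have e : ∀ r, (N t * .ofReal (min 1 (|t - r| ^ γ))) ^ p / ‖t - r‖ₑ ^ (1 + θ * p) =
            N t ^ p * (.ofReal (min 1 (|t - r| ^ γ)) ^ p / ‖t - r‖ₑ ^ (1 + θ * p)) := fun r => by
          rw [ENNReal.mul_rpow_of_nonneg _ _ hp0.le, mul_div_assoc]
        simp only [e]
        have mk : Measurable fun r : ℝ =>
            ENNReal.ofReal (min 1 (|t - r| ^ γ)) ^ p / ‖t - r‖ₑ ^ (1 + θ * p) := by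
          fun_prop
        rw [lintegral_const_mul _ mk, mul_comm]
        gcongr
        exact (setLIntegral_le_lintegral _ _).trans (hK t)
    _ = _ := by
        rw [ENNReal.coe_rpow_of_nonneg _ (by positivity)]
        ring

end TimeNorms

/-! ### Product estimates on a cylinder -/

section CylinderProducts

variable {m : ℕ} {p s θ T : ℝ}

theorem ae_enorm_le_of_cubeSup_le {u : Euc m → ℝ} {a : ℝ≥0∞} (h : cubeSup u ≤ a) :
    ∀ᵐ x ∂(cubeMeasure m), ‖u x‖ₑ ≤ a := (ae_le_cubeSup u).mono fun _ hx => hx.trans h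

theorem tLp_cubeLp_mul_le (hp : 1 ≤ p) {u v : ℝ → Euc m → ℝ} {a : ℝ≥0}
    (ha : ∀ᵐ t ∂(timeMeasure T), cubeSup (u t) ≤ a) :
    tLp p T (fun t => cubeLp p ((u * v) t)) ≤ a * tLp p T (fun t => cubeLp p (v t)) := by
  rw [← tLp_const_mul (by linarith)]
  refine tLp_mono (by linarith) ?_
  filter_upwards [ha] with t ht using cubeLp_mul_le (ae_enorm_le_of_cubeSup_le ht)

theorem sliceDist_mul_le (hp : 1 ≤ p) {u v : ℝ → Euc m → ℝ} (hu : Measurable (Function.uncurry u))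
    (hv : Measurable (Function.uncurry v)) (t r : ℝ) :
    sliceDist p (u * v) t r ≤
      cubeLp p (u t * (v t - v r)) + cubeLp p (v r * (u t - u r)) := by
  have e : (u * v) t - (u * v) r = u t * (v t - v r) + v r * (u t - u r) := by
    simp only [Pi.mul_apply]; ring
  have m1 := measurable_slice hu
  have m2 := measurable_slice hv
  rw [sliceDist, e]
  exact cubeLp_add_le hp ((m1 t).mul ((m2 t).sub (m2 r))).aestronglyMeasurable
    ((m2 r).mul ((m1 t).sub (m1 r))).aestronglyMeasurable

theorem measurable_sliceDist (hp : 1 ≤ p) {v : ℝ → Euc m → ℝ}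
    (hv : Measurable (Function.uncurry v)) : Measurable (Function.uncurry (sliceDist p v)) :=
  measurable_cubeLp_sub (by linarith) hv

theorem tSem_sliceDist_mul_le (hp : 1 ≤ p) {u v : ℝ → Euc m → ℝ}
    (hu : Measurable (Function.uncurry u)) (hv : Measurable (Function.uncurry v)) {a b : ℝ≥0}
    (ha : ∀ᵐ t ∂(timeMeasure T), cubeSup (u t) ≤ a)
    (hb : ∀ᵐ t ∂(timeMeasure T), cubeSup (v t) ≤ b) :
    tSem p θ T (sliceDist p (u * v)) ≤
      a * tSem p θ T (sliceDist p v) + b * tSem p θ T (sliceDist p u) := by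
  rw [tSem, tSem, tSem, ← wNorm_const_mul (by linarith) a, ← wNorm_const_mul (by linarith) b]
  refine wNorm_le_add hp (measurable_time_weight _)
    ((measurable_sliceDist hp hv).const_mul _).aemeasurable
    ((measurable_sliceDist hp hu).const_mul _).aemeasurable ?_
  filter_upwards [ha] with t ht
  filter_upwards [hb] with r hr
  exact (sliceDist_mul_le hp hu hv t r).trans (add_le_add
    (cubeLp_mul_le (ae_enorm_le_of_cubeSup_le ht)) (cubeLp_mul_le (ae_enorm_le_of_cubeSup_le hr)))

/-- The norm of `W^{s/2}_p(J; L_p) ∩ L_p(J; W^s_p)` on a cylinder over the cube. -/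
def cylNorm (p s T : ℝ) (f : ℝ → Euc m → ℝ) : ℝ≥0∞ :=
  tLp p T (fun t => cubeLp p (f t)) + tSem p (s / 2) T (sliceDist p f) +
    tLp p T (fun t => cubeSeminorm p s (f t))

/-- The norm of `W^{(1+s)/2}_p(J; L_p) ∩ L_p(J; W^{1+s}_p)` on a cylinder over the cube, for a
function `f` with weak gradient `g`. -/
def cylNorm1 (p s T : ℝ) (f : ℝ → Euc m → ℝ) (g : Fin m → ℝ → Euc m → ℝ) : ℝ≥0∞ :=
  tLp p T (fun t => cubeLp p (f t)) + tSem p ((1 + s) / 2) T (sliceDist p f) +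
    tLp p T (fun t => gradNorm p s (f t) fun i => g i t)

theorem cylNorm_mul_le (hp : 1 ≤ p) {u v : ℝ → Euc m → ℝ}
    (hu : Measurable (Function.uncurry u)) (hv : Measurable (Function.uncurry v)) {a b : ℝ≥0}
    (ha : ∀ᵐ t ∂(timeMeasure T), cubeSup (u t) ≤ a)
    (hb : ∀ᵐ t ∂(timeMeasure T), cubeSup (v t) ≤ b) :
    cylNorm p s T (u * v) ≤ a * cylNorm p s T v + b * cylNorm p s T u := by
  have h1 := tLp_cubeLp_mul_le (v := v) hp ha
  have h2 := tSem_sliceDist_mul_le (θ := s / 2) hp hu hv ha hb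
  have h3 : tLp p T (fun t => cubeSeminorm p s ((u * v) t)) ≤
      a * tLp p T (fun t => cubeSeminorm p s (v t)) +
        b * tLp p T (fun t => cubeSeminorm p s (u t)) := by
    rw [← tLp_const_mul (by linarith), ← tLp_const_mul (by linarith)]
    refine tLp_le_add hp ((measurable_cubeSeminorm hv).const_mul _).aemeasurable
      ((measurable_cubeSeminorm hu).const_mul _).aemeasurable ?_
    filter_upwards [ha, hb] with t hta htb
    exact cubeSeminorm_mul_le hp (measurable_slice hu t).aestronglyMeasurable
      (measurable_slice hv t).aestronglyMeasurable (ae_enorm_le_of_cubeSup_le hta)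
      (ae_enorm_le_of_cubeSup_le htb)
  unfold cylNorm
  have h1' := h1.trans (le_self_add (b := b * tLp p T fun t => cubeLp p (u t)))
  refine (add_le_add (add_le_add h1' h2) h3).trans (le_of_eq ?_)
  ring

/-- `g` is the weak gradient of `f` at almost all times. -/
structure IsCylGrad (T : ℝ) (f : ℝ → Euc m → ℝ) (g : Fin m → ℝ → Euc m → ℝ) : Prop where
  meas : Measurable (Function.uncurry f)
  meas_grad : ∀ i, Measurable (Function.uncurry (g i))
  weak : ∀ᵐ t ∂(timeMeasure T), ∀ i, IsWeakPartial i (f t) (g i t)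

theorem measurable_gradNorm (hp : 0 < p) {f : ℝ → Euc m → ℝ} {g : Fin m → ℝ → Euc m → ℝ}
    (hf : Measurable (Function.uncurry f)) (hg : ∀ i, Measurable (Function.uncurry (g i))) :
    Measurable fun t => gradNorm p s (f t) fun i => g i t := by
  unfold gradNorm
  exact ((measurable_cubeLp hp hf).add
    (Finset.measurable_fun_sum _ fun i _ => measurable_cubeLp hp (hg i))).add
    (Finset.measurable_fun_sum _ fun i _ => measurable_cubeSeminorm (hg i))

theorem ae_lt_top_of_tLp (hp : 0 < p) {N : ℝ → ℝ≥0∞} (hN : Measurable N) (h : tLp p T N < ⊤) :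
    ∀ᵐ t ∂(timeMeasure T), N t < ⊤ := by
  have hfin : ∫⁻ t, N t ^ p ∂(timeMeasure T) ≠ ⊤ := fun h' => by
    rw [tLp, h', ENNReal.top_rpow_of_pos (by positivity)] at h
    exact lt_irrefl _ h
  filter_upwards [ae_lt_top (hN.pow_const p) hfin] with t ht
  by_contra h'
  rw [not_lt, top_le_iff] at h'
  simp [h', ENNReal.top_rpow_of_pos hp] at ht

theorem ae_gradNorm_lt_top (hp : 1 ≤ p) {f : ℝ → Euc m → ℝ} {g : Fin m → ℝ → Euc m → ℝ}
    (h : IsCylGrad T f g) (hfin : cylNorm1 p s T f g < ⊤) :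
    ∀ᵐ t ∂(timeMeasure T), gradNorm p s (f t) (fun i => g i t) < ⊤ :=
  ae_lt_top_of_tLp (by linarith) (measurable_gradNorm (by linarith) h.meas h.meas_grad)
    (lt_of_le_of_lt le_add_self hfin)

/-- The slicewise estimate of order `1 + s`, integrated in time, together with the product rule for
slice distances. A uniform gradient bound is required of `v` alone, so `u` may be a factor without
vanishing trace. -/
theorem exists_const_cylNorm1_mul_le (hm : 1 ≤ m) (hp : 1 ≤ p) (hs : (m : ℝ) / p < s)
    (hs1 : s < 1) :
    ∃ C : ℝ≥0, ∀ (T : ℝ) (u v : ℝ → Euc m → ℝ) (g h : Fin m → ℝ → Euc m → ℝ) (a b l : ℝ≥0),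
      IsCylGrad T u g → IsCylGrad T v h → cylNorm1 p s T u g < ⊤ → cylNorm1 p s T v h < ⊤ →
      (∀ᵐ t ∂(timeMeasure T), cubeSup (u t) ≤ a) → (∀ᵐ t ∂(timeMeasure T), cubeSup (v t) ≤ b) →
      (∀ᵐ t ∂(timeMeasure T), ∀ i, cubeSup (h i t) ≤ l) →
      IsCylGrad T (u * v) (fun i => u * h i + v * g i) ∧
      cylNorm1 p s T (u * v) (fun i => u * h i + v * g i) ≤
        C * (a * cylNorm1 p s T v h + (b + l) * cylNorm1 p s T u g) := by
  obtain ⟨C, hC⟩ := exists_const_gradNorm_mul_le hm hp hs hs1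
  have hp0 : 0 < p := by linarith
  refine ⟨1 + C, fun T u v g h a b l hu hv fu fv ha hb hl => ⟨⟨hu.meas.mul hv.meas, fun i =>
    (hu.meas.mul (hv.meas_grad i)).add (hv.meas.mul (hu.meas_grad i)), ?_⟩, ?_⟩⟩
  · filter_upwards [hu.weak, hv.weak, ha, hb, hl, ae_gradNorm_lt_top hp hu fu] with
      t hut hvt hat hbt hlt fut i
    have mt := fun i => (measurable_slice (hu.meas_grad i) t).aestronglyMeasurable
      (μ := cubeMeasure m)
    exact (hut i).mul (hvt i) (measurable_slice hu.meas t).aestronglyMeasurable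
      (measurable_slice hv.meas t).aestronglyMeasurable
      (measurable_slice (hv.meas_grad i) t).aestronglyMeasurable
      (integrable_of_cubeLp hp (mt i)
        ((cubeLp_grad_le_gradNorm p s (u t) (fun i => g i t) i).trans_lt fut))
      (ae_enorm_le_of_cubeSup_le hat) (ae_enorm_le_of_cubeSup_le hbt)
      (ae_enorm_le_of_cubeSup_le (hlt i))
  · have h1 := tLp_cubeLp_mul_le (v := v) hp ha
    have h2 := tSem_sliceDist_mul_le (θ := (1 + s) / 2) hp hu.meas hv.meas ha hb
    have h3 : tLp p T (fun t => gradNorm p s ((u * v) t) fun i => (u * h i + v * g i) t) ≤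
        (C * a : ℝ≥0) * tLp p T (fun t => gradNorm p s (v t) fun i => h i t) +
          (C * (b + l) : ℝ≥0) * tLp p T (fun t => gradNorm p s (u t) fun i => g i t) := by
      rw [← tLp_const_mul hp0, ← tLp_const_mul hp0]
      refine tLp_le_add hp ((measurable_gradNorm hp0 hv.meas hv.meas_grad).const_mul _).aemeasurable
        ((measurable_gradNorm hp0 hu.meas hu.meas_grad).const_mul _).aemeasurable ?_
      filter_upwards [hu.weak, hv.weak, ha, hb, hl, ae_gradNorm_lt_top hp hu fu,
        ae_gradNorm_lt_top hp hv fv] with t hut hvt hat hbt hlt fut fvt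
      refine (hC (u t) (v t) _ _ a b l (measurable_slice hu.meas t)
        (fun i => measurable_slice (hu.meas_grad i) t) hut fut (measurable_slice hv.meas t)
        (fun i => measurable_slice (hv.meas_grad i) t) hvt fvt (ae_enorm_le_of_cubeSup_le hat)
        (ae_enorm_le_of_cubeSup_le hbt) fun i => ae_enorm_le_of_cubeSup_le (hlt i)).trans
        (le_of_eq ?_)
      push_cast
      ring
    unfold cylNorm1
    set E1 := tLp p T (fun t => cubeLp p (u t))
    set E2 := tLp p T (fun t => cubeLp p (v t))
    set D1 := tSem p ((1 + s) / 2) T (sliceDist p u)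
    set D2 := tSem p ((1 + s) / 2) T (sliceDist p v)
    set G1 := tLp p T (fun t => gradNorm p s (u t) fun i => g i t)
    set G2 := tLp p T (fun t => gradNorm p s (v t) fun i => h i t)
    calc _ ≤ a * E2 + (a * D2 + b * D1) + ((C * a : ℝ≥0) * G2 + (C * (b + l) : ℝ≥0) * G1) :=
          add_le_add (add_le_add h1 h2) h3
      _ = 1 * (a * (E2 + D2) + b * D1) + C * (a * G2 + (b + l) * G1) := by push_cast; ring
      _ ≤ 1 * (a * (E2 + D2 + G2) + (b + l) * (E1 + D1 + G1)) +
          C * (a * (E2 + D2 + G2) + (b + l) * (E1 + D1 + G1)) := by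
          have q1 : b * D1 ≤ (b + l) * (E1 + D1 + G1) :=
            mul_le_mul' le_self_add (le_add_self.trans le_self_add)
          have q2 : E2 + D2 ≤ E2 + D2 + G2 := le_self_add
          have q3 : G2 ≤ E2 + D2 + G2 := le_add_self
          have q4 : G1 ≤ E1 + D1 + G1 := le_add_self
          gcongr
      _ = _ := by push_cast; ring

end CylinderProducts

/-! ### Bounds by the norms on a cylinder -/

section CylinderBounds

variable {m : ℕ} {p s T : ℝ}

theorem tLp_cubeLp_le_cylNorm (f : ℝ → Euc m → ℝ) :
    tLp p T (fun t => cubeLp p (f t)) ≤ cylNorm p s T f := le_self_add.trans le_self_add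

theorem tSem_le_cylNorm (f : ℝ → Euc m → ℝ) :
    tSem p (s / 2) T (sliceDist p f) ≤ cylNorm p s T f := le_add_self.trans le_self_add

theorem tLp_cubeSeminorm_le_cylNorm (f : ℝ → Euc m → ℝ) :
    tLp p T (fun t => cubeSeminorm p s (f t)) ≤ cylNorm p s T f := le_add_self

theorem tLp_cubeLp_le_cylNorm1 (f : ℝ → Euc m → ℝ) (g : Fin m → ℝ → Euc m → ℝ) :
    tLp p T (fun t => cubeLp p (f t)) ≤ cylNorm1 p s T f g := le_self_add.trans le_self_add

theorem tSem_le_cylNorm1 (f : ℝ → Euc m → ℝ) (g : Fin m → ℝ → Euc m → ℝ) :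
    tSem p ((1 + s) / 2) T (sliceDist p f) ≤ cylNorm1 p s T f g := le_add_self.trans le_self_add

theorem tLp_gradNorm_le_cylNorm1 (f : ℝ → Euc m → ℝ) (g : Fin m → ℝ → Euc m → ℝ) :
    tLp p T (fun t => gradNorm p s (f t) fun i => g i t) ≤ cylNorm1 p s T f g := le_add_self

theorem tLp_cubeLp_grad_le_cylNorm1 (hp : 0 < p) (f : ℝ → Euc m → ℝ)
    (g : Fin m → ℝ → Euc m → ℝ) (i : Fin m) :
    tLp p T (fun t => cubeLp p (g i t)) ≤ cylNorm1 p s T f g :=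
  (tLp_mono hp (Eventually.of_forall fun t =>
    cubeLp_grad_le_gradNorm p s (f t) (fun i => g i t) i)).trans (tLp_gradNorm_le_cylNorm1 f g)

theorem tLp_cubeSeminorm_grad_le_cylNorm1 (hp : 0 < p) (f : ℝ → Euc m → ℝ)
    (g : Fin m → ℝ → Euc m → ℝ) (i : Fin m) :
    tLp p T (fun t => cubeSeminorm p s (g i t)) ≤ cylNorm1 p s T f g :=
  (tLp_mono hp (Eventually.of_forall fun t =>
    cubeSeminorm_le_gradNorm p s (f t) (fun i => g i t) i)).trans (tLp_gradNorm_le_cylNorm1 f g)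

theorem exists_const_tLp_cubeSeminorm_le_cylNorm1 (hm : 1 ≤ m) (hp : 1 ≤ p)
    (hs : (m : ℝ) / p < s) (hs1 : s < 1) :
    ∃ C : ℝ≥0, ∀ (T : ℝ) (f : ℝ → Euc m → ℝ) (g : Fin m → ℝ → Euc m → ℝ), IsCylGrad T f g →
      cylNorm1 p s T f g < ⊤ →
      tLp p T (fun t => cubeSeminorm p s (f t)) ≤ C * cylNorm1 p s T f g := by
  obtain ⟨C, hC⟩ := exists_const_cubeSeminorm_le_gradNorm hm hp hs hs1
  have hp0 : 0 < p := by linarith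
  refine ⟨C, fun T f g h hfin => ?_⟩
  refine le_trans ?_ (mul_le_mul_right (tLp_gradNorm_le_cylNorm1 f g) _)
  rw [← tLp_const_mul hp0]
  refine tLp_mono hp0 ?_
  filter_upwards [ae_gradNorm_lt_top hp h hfin, h.weak] with t ht hw
  exact hC _ _ (measurable_slice h.meas t) (fun i => measurable_slice (h.meas_grad i) t) hw ht

/-- Here `θ = s / 2` and `β = m / p`, for which the condition linking temporal and spatial exponents
holds with equality. -/
theorem exists_const_cubeSup_le_cylNorm (hm : 1 ≤ m) (hp : 1 ≤ p)
    (hs : 1 / p < (s - m / p) / 2) :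
    ∃ C : ℝ≥0, ∀ T : ℝ, 0 < T → ∀ f : ℝ → Euc m → ℝ, Measurable (Function.uncurry f) →
      cylNorm p s T f < ⊤ → SliceZeroTrace p T f →
      ∀ᵐ t ∂(timeMeasure T), cubeSup (f t) ≤ C * cylNorm p s T f := by
  have hp0 : 0 < p := by linarith
  have hp1 : 0 < 1 / p := by positivity
  have hmp : 0 ≤ (m : ℝ) / p := by positivity
  obtain ⟨C₀, hC₀⟩ := exists_const_supEst hm hp (show (m : ℝ) / p < s by linarith)
  obtain ⟨C, hC⟩ := exists_const_sup_le (m := m) (θ := s / 2) hp hs hmp (by linarith) C₀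
  refine ⟨C, fun T hT f hf hfin hz => ?_⟩
  filter_upwards [hC T hT f f hf hf (hC₀ T f hf ((tLp_cubeLp_le_cylNorm f).trans_lt hfin))
    ((tLp_cubeSeminorm_le_cylNorm f).trans_lt hfin) ((tSem_le_cylNorm f).trans_lt hfin) hz] with t ht
  refine ht.trans (le_of_eq ?_)
  rw [cylNorm]
  ring

/-- Here `θ = (1 + s) / 2`. The derivative loses one power of the spatial scale, `β = 1 + m / p`,
which the additional half order in time offsets exactly; for the function itself `β = m / p` leaves
room to spare. -/
theorem exists_const_cubeSup_le_cylNorm1 (hm : 1 ≤ m) (hp : 1 ≤ p)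
    (hs : 1 / p < (s - m / p) / 2) (hs1 : s < 1) :
    ∃ C : ℝ≥0, ∀ T : ℝ, 0 < T → ∀ (f : ℝ → Euc m → ℝ) (g : Fin m → ℝ → Euc m → ℝ),
      IsCylGrad T f g → cylNorm1 p s T f g < ⊤ → SliceZeroTrace p T f →
      (∀ᵐ t ∂(timeMeasure T), cubeSup (f t) ≤ C * cylNorm1 p s T f g) ∧
      ∀ᵐ t ∂(timeMeasure T), ∀ i, cubeSup (g i t) ≤ C * cylNorm1 p s T f g := by
  have hp0 : 0 < p := by linarith
  have hp1 : 0 < 1 / p := by positivity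
  have hmp : 0 ≤ (m : ℝ) / p := by positivity
  have hsm : (m : ℝ) / p < s := by linarith
  obtain ⟨C₀, hC₀⟩ := exists_const_supEst hm hp hsm
  obtain ⟨C₁, hC₁⟩ := exists_const_supEst_grad hm hp hsm
  obtain ⟨K, hK⟩ := exists_const_tLp_cubeSeminorm_le_cylNorm1 hm hp hsm hs1
  obtain ⟨C, hC⟩ := exists_const_sup_le (m := m) (θ := (1 + s) / 2) hp hs hmp (by linarith) C₀
  obtain ⟨C', hC'⟩ := exists_const_sup_le (m := m) (θ := (1 + s) / 2) (β := 1 + m / p) hp hs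
    (by linarith) (by linarith) C₁
  refine ⟨C * (K + 2) + C' * 3, fun T hT f g h hfin hz => ?_⟩
  set M := cylNorm1 p s T f g
  have hE := tLp_cubeLp_le_cylNorm1 (p := p) (s := s) (T := T) f g
  have hD := tSem_le_cylNorm1 (p := p) (s := s) (T := T) f g
  have hKM := hK T f g h hfin
  constructor
  · have hKt : (K : ℝ≥0∞) * M < ⊤ := ENNReal.mul_lt_top ENNReal.coe_lt_top hfin
    filter_upwards [hC T hT f f h.meas h.meas (hC₀ T f h.meas (hE.trans_lt hfin))
      (hKM.trans_lt hKt) (hD.trans_lt hfin) hz] with t ht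
    calc cubeSup (f t) ≤ C * (K * M + M + M) := ht.trans (by gcongr)
      _ = C * (K + 2) * M := by ring
      _ ≤ _ := by
        push_cast
        gcongr
        exact le_self_add
  · rw [ae_all_iff]
    intro i
    have hG := tLp_cubeLp_grad_le_cylNorm1 (s := s) (T := T) hp0 f g i
    have hN := tLp_cubeSeminorm_grad_le_cylNorm1 (s := s) (T := T) hp0 f g i
    filter_upwards [hC' T hT f (g i) h.meas (h.meas_grad i) (hC₁ T f (g i) i h.meas (h.meas_grad i)
      (hE.trans_lt hfin) (hG.trans_lt hfin) (h.weak.mono fun t ht => ht i)) (hN.trans_lt hfin)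
      (hD.trans_lt hfin) hz] with t ht
    calc cubeSup (g i t) ≤ C' * (M + M + M) := ht.trans (by gcongr)
      _ = C' * 3 * M := by ring
      _ ≤ _ := by
        push_cast
        gcongr
        exact le_add_self

theorem exists_const_cubeLp_le_of_cubeSup (m : ℕ) (p : ℝ) :
    ∃ K : ℝ≥0, ∀ (u : Euc m → ℝ) (b : ℝ≥0), cubeSup u ≤ b → cubeLp p u ≤ b * K := by
  have h1 : cubeLp p (fun _ : Euc m => (1 : ℝ)) ≠ ⊤ :=
    (memLp_const (μ := cubeMeasure m) (p := ENNReal.ofReal p) (1 : ℝ)).2.ne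
  refine ⟨(cubeLp p (fun _ : Euc m => (1 : ℝ))).toNNReal, fun u b hb => ?_⟩
  rw [ENNReal.coe_toNNReal h1]
  have := cubeLp_mul_le (p := p) (v := fun _ => 1) (ae_enorm_le_of_cubeSup_le hb)
  rwa [show (u * fun _ => (1 : ℝ)) = u from funext fun x => mul_one (u x)] at this

/-- The spatial embedding on each slice. Neither a trace condition nor time regularity is used, so
this is the bound available for the first factor in the mixed product. -/
theorem exists_const_tLp_cubeSup_le_cylNorm (hm : 1 ≤ m) (hp : 1 ≤ p) (hs : (m : ℝ) / p < s) :
    ∃ C : ℝ≥0, ∀ (T : ℝ) (f : ℝ → Euc m → ℝ), Measurable (Function.uncurry f) →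
      cylNorm p s T f < ⊤ → (∀ᵐ t ∂(timeMeasure T), cubeSup (f t) < ⊤) ∧
      tLp p T (fun t => cubeSup (f t)) ≤ C * cylNorm p s T f := by
  obtain ⟨C, hC⟩ := exists_const_ae_enorm_le_cubeW hm hp hs
  have hp0 : 0 < p := by linarith
  refine ⟨C, fun T f hf hfin => ?_⟩
  have mE := measurable_cubeLp hp0 hf
  have mN := measurable_cubeSeminorm (p := p) (s := s) hf
  have key : ∀ᵐ t ∂(timeMeasure T), cubeW p s (f t) < ⊤ ∧ cubeSup (f t) ≤ C * cubeW p s (f t) := by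
    filter_upwards [ae_lt_top_of_tLp hp0 mE ((tLp_cubeLp_le_cylNorm f).trans_lt hfin),
      ae_lt_top_of_tLp hp0 mN ((tLp_cubeSeminorm_le_cylNorm f).trans_lt hfin)] with t h1 h2
    have h3 : cubeW p s (f t) < ⊤ := ENNReal.add_lt_top.2 ⟨h1, h2⟩
    exact ⟨h3, cubeSup_le (hC _ (measurable_slice hf t) h3)⟩
  constructor
  · filter_upwards [key] with t ht
    exact ht.2.trans_lt (ENNReal.mul_lt_top ENNReal.coe_lt_top ht.1)
  · calc _ ≤ tLp p T (fun t => C * cubeW p s (f t)) :=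
          tLp_mono hp0 (key.mono fun t ht => ht.2)
      _ = C * tLp p T (fun t => cubeW p s (f t)) := tLp_const_mul hp0 C
      _ ≤ C * (tLp p T (fun t => cubeLp p (f t)) + tLp p T (fun t => cubeSeminorm p s (f t))) := by
          gcongr
          exact tLp_le_add hp mE.aemeasurable mN.aemeasurable (Eventually.of_forall fun t => le_rfl)
      _ ≤ _ := by
          gcongr
          rw [cylNorm]
          gcongr
          exact le_self_add

/-- Multiplication by functions of higher order and vanishing trace. -/
theorem exists_const_cylNorm_mul_le (hm : 1 ≤ m) (hp : 1 ≤ p) (hs : 1 / p < (s - m / p) / 2)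
    (hs1 : s < 1) :
    ∃ C : ℝ≥0, ∀ T : ℝ, 0 < T → ∀ (u v : ℝ → Euc m → ℝ) (h : Fin m → ℝ → Euc m → ℝ),
      Measurable (Function.uncurry u) → cylNorm p s T u < ⊤ → IsCylGrad T v h →
      cylNorm1 p s T v h < ⊤ → SliceZeroTrace p T v →
      cylNorm p s T (u * v) ≤ C * cylNorm p s T u * cylNorm1 p s T v h := by
  have hp0 : 0 < p := by linarith
  have hp1 : 0 < 1 / p := by positivity
  have hmp : 0 ≤ (m : ℝ) / p := by positivity
  have hsm : (m : ℝ) / p < s := by linarith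
  obtain ⟨B, hB⟩ := exists_const_cubeSup_le_cylNorm1 hm hp hs hs1
  obtain ⟨H, hH⟩ := exists_const_slice_holder (m := m) (θ := (1 + s) / 2) hp (by linarith)
  obtain ⟨N, hN⟩ := exists_const_tLp_cubeSup_le_cylNorm hm hp hsm
  obtain ⟨Q, hQ⟩ := exists_const_cubeLp_le_of_cubeSup m p
  -- The inequality `γ > θ` amounts to `p > 2`.
  obtain ⟨K, hK⟩ := exists_const_tSem_holder_le (θ := s / 2) (γ := (1 + s) / 2 - 1 / p) hp
    (by linarith) (by linarith)
  obtain ⟨L, hL⟩ := exists_const_cubeSeminorm_mul_lipschitz_le (p := p) hm hp hs1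
  refine ⟨B + (K * (2 * B * Q + H) * N + B) + (B + L * m * B), fun T hT u v h hu hufin hv hvfin hz => ?_⟩
  set M := (cylNorm1 p s T v h).toNNReal with hM
  have hMe : (M : ℝ≥0∞) = cylNorm1 p s T v h := ENNReal.coe_toNNReal hvfin.ne
  obtain ⟨hb, hl⟩ := hB T hT v h hv hvfin hz
  rw [← hMe] at hb hl ⊢
  set U := cylNorm p s T u
  have hb' : ∀ᵐ t ∂(timeMeasure T), cubeSup (v t) ≤ ((B * M : ℝ≥0) : ℝ≥0∞) := by
    simpa using hb
  have hl' : ∀ᵐ t ∂(timeMeasure T), ∀ i, cubeSup (h i t) ≤ ((B * M : ℝ≥0) : ℝ≥0∞) := by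
    simpa using hl
  have c1 : tLp p T (fun t => cubeLp p ((u * v) t)) ≤ B * U * M := by
    rw [mul_comm u v]
    refine (tLp_cubeLp_mul_le hp hb').trans ?_
    push_cast
    rw [mul_right_comm]
    gcongr
    exact tLp_cubeLp_le_cylNorm u
  -- `u` has no uniform bound. In the term with a time difference of `v`, the sup norm of `u` stays
  -- in `L_p` over time while `v` contributes its sup bound and its Hölder bound of order above `s /
  -- 2`; the other term uses only the sup bound of `v`.
  have c2 : tSem p (s / 2) T (sliceDist p (u * v)) ≤ (K * (2 * B * Q + H) * N + B) * U * M := by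
    have mS := measurable_cubeSup hu
    obtain ⟨hfinS, hNS⟩ := hN T u hu hufin
    have d1 : tSem p (s / 2) T (fun t r => cubeSup (u t) * sliceDist p v t r) ≤
        K * ((2 * B * Q + H) * M : ℝ≥0) * tLp p T (fun t => cubeSup (u t)) := by
      refine hK T _ _ _ mS ?_ ?_
      · filter_upwards [hb'] with t ht
        filter_upwards [hb'] with r hr
        have e : v t - v r = v t + -v r := sub_eq_add_neg _ _
        have hn : cubeLp p (-v r) = cubeLp p (v r) := eLpNorm_neg _ _ _
        rw [sliceDist, e]
        refine (cubeLp_add_le hp (measurable_slice hv.meas t).aestronglyMeasurable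
          (measurable_slice hv.meas r).neg.aestronglyMeasurable).trans ?_
        rw [hn]
        refine (add_le_add (hQ _ _ ht) (hQ _ _ hr)).trans ?_
        push_cast
        calc (B * M * Q + B * M * Q : ℝ≥0∞) = 2 * B * Q * M := by ring
          _ ≤ _ := by
            gcongr
            exact le_self_add
      · filter_upwards [hH T v hv.meas ((tSem_le_cylNorm1 v h).trans_lt hvfin)] with t ht
        filter_upwards [ht] with r hr
        refine hr.trans ?_
        have : tSem p ((1 + s) / 2) T (sliceDist p v) ≤ M := by
          rw [hMe]; exact tSem_le_cylNorm1 v h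
        calc _ ≤ (H : ℝ≥0∞) * (.ofReal (|t - r| ^ ((1 + s) / 2 - 1 / p)) * M) := by gcongr
          _ = H * M * .ofReal (|t - r| ^ ((1 + s) / 2 - 1 / p)) := by ring
          _ ≤ _ := by
            push_cast
            gcongr
            exact le_add_self
    have d2 : tSem p (s / 2) T (sliceDist p (u * v)) ≤
        tSem p (s / 2) T (fun t r => cubeSup (u t) * sliceDist p v t r) +
          (B * M : ℝ≥0) * tSem p (s / 2) T (sliceDist p u) := by
      rw [tSem, tSem, tSem, ← wNorm_const_mul hp0]
      refine wNorm_le_add hp (measurable_time_weight _)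
        ((mS.comp measurable_fst).mul (measurable_sliceDist hp hv.meas)).aemeasurable
        ((measurable_sliceDist hp hu).const_mul _).aemeasurable ?_
      filter_upwards [hfinS] with t ht
      filter_upwards [hb'] with r hr
      refine (sliceDist_mul_le hp hu hv.meas t r).trans (add_le_add ?_
        (cubeLp_mul_le (ae_enorm_le_of_cubeSup_le hr)))
      have := cubeLp_mul_le (p := p) (v := v t - v r) (a := (cubeSup (u t)).toNNReal)
        (ae_enorm_le_of_cubeSup_le (ENNReal.coe_toNNReal ht.ne).ge)
      rwa [ENNReal.coe_toNNReal ht.ne] at this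
    calc _ ≤ (K : ℝ≥0∞) * ((2 * B * Q + H) * M : ℝ≥0) * (N * U) + (B * M : ℝ≥0) * U :=
          d2.trans (add_le_add (d1.trans (by gcongr)) (by gcongr; exact tSem_le_cylNorm u))
      _ = _ := by push_cast; ring
  -- Again `u` is unbounded. The gradient bound makes the slices of `v` Lipschitz, and the spatial
  -- seminorm of the product then needs only the seminorm and the `L_p`-norm of `u`.
  have c3 : tLp p T (fun t => cubeSeminorm p s ((u * v) t)) ≤ (B + L * m * B) * U * M := by
    have d : tLp p T (fun t => cubeSeminorm p s ((u * v) t)) ≤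
        (B * M : ℝ≥0) * tLp p T (fun t => cubeSeminorm p s (u t)) +
          (L * (m * (B * M)) : ℝ≥0) * tLp p T (fun t => cubeLp p (u t)) := by
      rw [← tLp_const_mul hp0, ← tLp_const_mul hp0]
      refine tLp_le_add hp ((measurable_cubeSeminorm hu).const_mul _).aemeasurable
        ((measurable_cubeLp hp0 hu).const_mul _).aemeasurable ?_
      filter_upwards [hb', hl', hv.weak] with t htb htl hw
      have mv := (measurable_slice hv.meas t).aestronglyMeasurable (μ := cubeMeasure m)
      have := hL (u t) (v t) (B * M) (m * (B * M)) (measurable_slice hu t).aestronglyMeasurable mv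
        (ae_enorm_le_of_cubeSup_le htb) (by
          have := ae_lipschitz_of_weakPartial
            (integrable_of_ae_le mv (ae_enorm_le_of_cubeSup_le htb)) hw
            fun i => ae_enorm_le_of_cubeSup_le (htl i)
          simpa using this)
      refine this.trans (le_of_eq ?_)
      push_cast
      ring
    calc _ ≤ ((B * M : ℝ≥0) : ℝ≥0∞) * U + (L * (m * (B * M)) : ℝ≥0) * U :=
          d.trans (add_le_add (by gcongr; exact tLp_cubeSeminorm_le_cylNorm u)
            (by gcongr; exact tLp_cubeLp_le_cylNorm u))
      _ = _ := by push_cast; ring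
  calc cylNorm p s T (u * v) ≤ B * U * M + (K * (2 * B * Q + H) * N + B) * U * M +
        (B + L * m * B) * U * M := add_le_add (add_le_add c1 c2) c3
    _ = _ := by push_cast; ring

end CylinderBounds

/-! ### Reduction to cylinders over the cube -/

section Representation

variable {m : ℕ} {S : Set (Euc (m + 1))} {ι : Type*} {A : NormalizedAtlas m S ι}
  {p T : ℝ} {v w : ℝ → S → ℝ}

/-- Equality of almost all time slices, almost everywhere on the cube. -/
def SliceEq (T : ℝ) (u f : ℝ → Euc m → ℝ) : Prop :=
  ∀ᵐ t ∂(timeMeasure T), u t =ᵐ[cubeMeasure m] f t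

/-- `f` is a measurable representative of `v` in the chart `κ`. -/
structure IsRep (A : NormalizedAtlas m S ι) (T : ℝ) (κ : ι) (v : ℝ → S → ℝ)
    (f : ℝ → Euc m → ℝ) : Prop where
  meas : Measurable (Function.uncurry f)
  ae_eq : ∀ᵐ z ∂((timeMeasure T).prod (cubeMeasure m)), pull A κ (v z.1) z.2 = f z.1 z.2

theorem IsRep.eq {κ : ι} {f : ℝ → Euc m → ℝ} (h : IsRep A T κ v f) :
    SliceEq T (fun t => pull A κ (v t)) f := Measure.ae_ae_of_ae_prod h.ae_eq

theorem AEMeasOn.exists_isRep (h : AEMeasOn A T v) :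
    ∃ f : ι → ℝ → Euc m → ℝ, ∀ κ, IsRep A T κ v (f κ) := by
  refine ⟨fun κ t x => (h κ).mk _ (t, x), fun κ => ⟨(h κ).stronglyMeasurable_mk.measurable,
    (h κ).ae_eq_mk⟩⟩

theorem IsRep.mul {κ : ι} {f f' : ℝ → Euc m → ℝ} (h : IsRep A T κ v f) (h' : IsRep A T κ w f') :
    IsRep A T κ (v * w) (f * f') := by
  refine ⟨h.meas.mul h'.meas, ?_⟩
  filter_upwards [h.ae_eq, h'.ae_eq] with z h1 h2
  simp only [pull, Pi.mul_apply] at h1 h2 ⊢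
  rw [h1, h2]

theorem AEMeasOn.mul (h : AEMeasOn A T v) (h' : AEMeasOn A T w) : AEMeasOn A T (v * w) :=
  fun κ => (h κ).mul (h' κ)

theorem AEEqOn.mul {v' w' : ℝ → S → ℝ} (h : AEEqOn A T v w) (h' : AEEqOn A T v' w') :
    AEEqOn A T (v * v') (w * w') := fun κ => by
  filter_upwards [h κ, h' κ] with z h1 h2
  simp only [pull, Pi.mul_apply] at h1 h2 ⊢
  rw [h1, h2]

theorem AEEqOn.sliceEq (h : AEEqOn A T v w) (κ : ι) :
    SliceEq T (fun t => pull A κ (v t)) (fun t => pull A κ (w t)) :=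
  Measure.ae_ae_of_ae_prod (h κ)

theorem IsRep.sliceDist_eq {κ : ι} {f : ℝ → Euc m → ℝ} (h : IsRep A T κ v f) :
    ∀ᵐ t ∂(timeMeasure T), ∀ᵐ r ∂(timeMeasure T),
      cubeLp p (pull A κ (v t - v r)) = sliceDist p f t r := by
  filter_upwards [h.eq] with t ht
  filter_upwards [h.eq] with r hr
  exact cubeLp_congr (ht.sub hr)

theorem IsRep.cubeW1_eq {s : ℝ} {κ : ι} {f : ℝ → Euc m → ℝ} {g : Fin m → ℝ → Euc m → ℝ}
    (h : IsRep A T κ v f) (hg : IsCylGrad T f g) :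
    ∀ᵐ t ∂(timeMeasure T), cubeW1 p s (pull A κ (v t)) = gradNorm p s (f t) fun i => g i t := by
  filter_upwards [h.eq, hg.weak] with t ht hw
  rw [cubeW1_eq_gradNorm fun i => (hw i).congr ht.symm, gradNorm, cubeLp_congr ht]
  rfl

variable [Fintype ι]

theorem le_surfaceNorm (N : (Euc m → ℝ) → ℝ≥0∞) (κ : ι) (u : S → ℝ) :
    N (pull A κ u) ≤ surfaceNorm A N u :=
  Finset.single_le_sum (f := fun κ => N (pull A κ u)) (fun _ _ => zero_le) (Finset.mem_univ κ)

theorem IsRep.tLp_le (hp : 0 < p) {κ : ι} {f : ℝ → Euc m → ℝ} (h : IsRep A T κ v f)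
    {N N' : (Euc m → ℝ) → ℝ≥0∞} (hN : ∀ u u', u =ᵐ[cubeMeasure m] u' → N' u = N' u')
    (hNN : ∀ u, N' u ≤ N u) :
    tLp p T (fun t => N' (f t)) ≤ timeLp p T (surfaceNorm A N) v := by
  refine tLp_mono hp ?_
  filter_upwards [h.eq] with t ht
  rw [← hN _ _ ht]
  exact (hNN _).trans (le_surfaceNorm N κ (v t))

theorem IsRep.tSem_le (hp : 0 < p) {θ : ℝ} {κ : ι} {f : ℝ → Euc m → ℝ} (h : IsRep A T κ v f) :
    tSem p θ T (sliceDist p f) ≤ timeSeminorm p θ T (surfaceLp A p) v := by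
  refine wNorm_mono hp ?_
  filter_upwards [h.sliceDist_eq (p := p)] with t ht
  filter_upwards [ht] with r hr
  rw [← hr]
  exact le_surfaceNorm (cubeLp p) κ (v t - v r)

theorem timeLp_le_sum (hp : 1 ≤ p) {N : (Euc m → ℝ) → ℝ≥0∞} {N' : ι → ℝ → ℝ≥0∞}
    (hN' : ∀ κ, Measurable (N' κ))
    (h : ∀ κ, ∀ᵐ t ∂(timeMeasure T), N (pull A κ (v t)) = N' κ t) :
    timeLp p T (surfaceNorm A N) v ≤ ∑ κ, tLp p T (N' κ) := by
  refine le_trans ?_ (tLp_sum_le hp Finset.univ fun κ => (hN' κ).aemeasurable)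
  refine tLp_mono (by linarith) ?_
  filter_upwards [ae_all_iff.2 h] with t ht
  exact (Finset.sum_congr rfl fun κ _ => ht κ).le

theorem timeSeminorm_le_sum (hp : 1 ≤ p) {θ : ℝ} {f : ι → ℝ → Euc m → ℝ}
    (h : ∀ κ, IsRep A T κ v (f κ)) :
    timeSeminorm p θ T (surfaceLp A p) v ≤ ∑ κ, tSem p θ T (sliceDist p (f κ)) := by
  refine le_trans ?_ (tSem_sum_le hp Finset.univ fun κ =>
    (measurable_sliceDist hp (h κ).meas).aemeasurable)
  refine wNorm_mono (by linarith) ?_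
  filter_upwards [ae_all_iff.2 fun κ => (h κ).sliceDist_eq (p := p)] with t ht
  filter_upwards [ae_all_iff.2 ht] with r hr
  exact (Finset.sum_congr rfl fun κ _ => hr κ).le

theorem cylNorm_le_normF3 (hp : 0 < p) {κ : ι} {f : ℝ → Euc m → ℝ} (h : IsRep A T κ v f) :
    cylNorm p (1 - 1 / p) T f ≤ normF3 A p T v := by
  refine add_le_add (add_le_add (h.tLp_le hp (fun _ _ => cubeLp_congr) fun _ => le_rfl) ?_)
    (h.tLp_le hp (fun _ _ => cubeSeminorm_congr) fun _ => le_add_self)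
  rw [show (1 - 1 / p) / 2 = 1 / 2 - 1 / (2 * p) by field_simp]
  exact h.tSem_le hp

/-- The factor `2` arises because the `L_p`-norm occurs in both summands of `normF3` but only once
in `cylNorm`. -/
theorem normF3_le_sum (hp : 1 ≤ p) {f : ι → ℝ → Euc m → ℝ} (h : ∀ κ, IsRep A T κ v (f κ)) :
    normF3 A p T v ≤ 2 * ∑ κ, cylNorm p (1 - 1 / p) T (f κ) := by
  have hp0 : 0 < p := by linarith
  have h1 := timeLp_le_sum (A := A) (v := v) (T := T) (N := cubeLp p) hp
    (fun κ => measurable_cubeLp hp0 (h κ).meas) fun κ => (h κ).eq.mono fun t ht => cubeLp_congr ht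
  have h2 := timeSeminorm_le_sum (θ := 1 / 2 - 1 / (2 * p)) hp h
  have h3 := timeLp_le_sum (A := A) (v := v) (T := T) (N := cubeW p (1 - 1 / p)) hp
    (fun κ => (measurable_cubeLp hp0 (h κ).meas).add (measurable_cubeSeminorm (h κ).meas))
    fun κ => (h κ).eq.mono fun t ht => by
      rw [cubeW, cubeLp_congr ht, cubeSeminorm_congr (s := 1 - 1 / p) ht]; rfl
  refine (add_le_add (add_le_add h1 h2) h3).trans ?_
  rw [← Finset.sum_add_distrib, ← Finset.sum_add_distrib, Finset.mul_sum]
  refine Finset.sum_le_sum fun κ _ => ?_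
  have h4 : tLp p T ((fun t => cubeLp p (f κ t)) + fun t => cubeSeminorm p (1 - 1 / p) (f κ t)) ≤
      tLp p T (fun t => cubeLp p (f κ t)) + tLp p T fun t => cubeSeminorm p (1 - 1 / p) (f κ t) :=
    tLp_le_add hp (measurable_cubeLp hp0 (h κ).meas).aemeasurable
      (measurable_cubeSeminorm (h κ).meas).aemeasurable (Eventually.of_forall fun t => le_rfl)
  rw [two_mul (cylNorm _ _ _ _)]
  refine add_le_add ?_ (h4.trans ?_)
  · rw [show 1 / 2 - 1 / (2 * p) = (1 - 1 / p) / 2 by field_simp]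
    exact le_self_add
  · rw [cylNorm]
    gcongr
    exact le_self_add

theorem one_sub_half {p : ℝ} (hp : 0 < p) : (1 + (1 - 1 / p)) / 2 = 1 - 1 / (2 * p) := by
  field_simp
  ring

theorem cylNorm1_le_normF2 (hp : 0 < p) {κ : ι} {f : ℝ → Euc m → ℝ}
    {g : Fin m → ℝ → Euc m → ℝ} (h : IsRep A T κ v f) (hg : IsCylGrad T f g) :
    cylNorm1 p (1 - 1 / p) T f g ≤ normF2 A p T v := by
  refine add_le_add (add_le_add (h.tLp_le hp (fun _ _ => cubeLp_congr) fun _ => le_rfl) ?_) ?_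
  · rw [one_sub_half hp]
    exact h.tSem_le hp
  · refine tLp_mono hp ?_
    filter_upwards [h.cubeW1_eq hg] with t ht
    rw [← ht]
    exact le_surfaceNorm _ κ (v t)

theorem normF2_le_sum (hp : 1 ≤ p) {f : ι → ℝ → Euc m → ℝ} {g : ι → Fin m → ℝ → Euc m → ℝ}
    (h : ∀ κ, IsRep A T κ v (f κ)) (hg : ∀ κ, IsCylGrad T (f κ) (g κ)) :
    normF2 A p T v ≤ ∑ κ, cylNorm1 p (1 - 1 / p) T (f κ) (g κ) := by
  have hp0 : 0 < p := by linarith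
  have h1 := timeLp_le_sum (A := A) (v := v) (T := T) (N := cubeLp p) hp
    (fun κ => measurable_cubeLp hp0 (h κ).meas) fun κ => (h κ).eq.mono fun t ht => cubeLp_congr ht
  have h2 := timeSeminorm_le_sum (θ := 1 - 1 / (2 * p)) hp h
  have h3 := timeLp_le_sum (A := A) (v := v) (T := T) (N := cubeW1 p (1 - 1 / p)) hp
    (fun κ => measurable_gradNorm hp0 (h κ).meas (hg κ).meas_grad) fun κ => (h κ).cubeW1_eq (hg κ)
  refine (add_le_add (add_le_add h1 h2) h3).trans (le_of_eq ?_)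
  rw [← Finset.sum_add_distrib, ← Finset.sum_add_distrib, ← one_sub_half hp0]
  rfl

/-- Passing to jointly measurable versions of the function and of its gradient makes all slice norms
measurable in time. Weak derivatives survive because they depend only on almost everywhere classes.
-/
theorem MemF2.exists_isRep (h : MemF2 A p T v) :
    ∃ (f : ι → ℝ → Euc m → ℝ) (g : ι → Fin m → ℝ → Euc m → ℝ),
      (∀ κ, IsRep A T κ v (f κ)) ∧ ∀ κ, IsCylGrad T (f κ) (g κ) := by
  obtain ⟨f, hf⟩ := h.meas.exists_isRep
  choose g hg hw using h.grad
  refine ⟨f, fun κ i t x => (hg κ i).mk _ (t, x), hf, fun κ => ⟨(hf κ).meas,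
    fun i => (hg κ i).stronglyMeasurable_mk.measurable, ?_⟩⟩
  rw [ae_all_iff]
  intro i
  filter_upwards [hw κ i, (hf κ).eq, Measure.ae_ae_of_ae_prod (hg κ i).ae_eq_mk] with t h1 h2 h3
  exact (h1.congr h2).congr_deriv h3

theorem memF2_of_isRep {f : ι → ℝ → Euc m → ℝ} {g : ι → Fin m → ℝ → Euc m → ℝ}
    (hm : AEMeasOn A T v) (h : ∀ κ, IsRep A T κ v (f κ)) (hg : ∀ κ, IsCylGrad T (f κ) (g κ))
    (hfin : normF2 A p T v < ⊤) : MemF2 A p T v := by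
  refine ⟨hm, fun κ i => ⟨Function.uncurry (g κ i),
    ((hg κ).meas_grad i).aestronglyMeasurable, ?_⟩, hfin⟩
  filter_upwards [(hg κ).weak, (h κ).eq] with t h1 h2
  exact (h1 i).congr h2.symm

theorem ZeroTrace.sliceZeroTrace (hp : 1 ≤ p) (h : ZeroTrace A p T v) (hT : 0 < T) {κ : ι}
    {f : ℝ → Euc m → ℝ} (hf : IsRep A T κ v f) : SliceZeroTrace p T f := by
  obtain ⟨w, h1, h2, h3, h4⟩ := h
  intro ε hε
  have h0 : (0 : ℝ) ∈ Icc 0 T := ⟨le_rfl, hT.le⟩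
  have hev := (h2 0 h0).eventually (Iic_mem_nhds (show (0 : ℝ≥0∞) < ε by exact_mod_cast hε))
  rw [eventually_nhdsWithin_iff, Metric.eventually_nhds_iff] at hev
  obtain ⟨δ, hδ, hball⟩ := hev
  refine ⟨δ, hδ, ?_⟩
  filter_upwards [hf.eq, h3.sliceEq κ, ae_timeMeasure_mem T] with r hr1 hr2 hrT hrδ
  have hc : cubeLp p (pull A κ (w 0)) = 0 :=
    le_antisymm ((le_surfaceNorm (cubeLp p) κ (w 0)).trans h4.le) zero_le
  have m1 := (h1 r hrT).1 κ
  have m0 := (h1 0 h0).1 κ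
  rw [← cubeLp_congr hr1, cubeLp_congr hr2]
  calc cubeLp p (pull A κ (w r)) = cubeLp p (pull A κ (w r) - pull A κ (w 0) + pull A κ (w 0)) := by
        rw [sub_add_cancel]
    _ ≤ cubeLp p (pull A κ (w r) - pull A κ (w 0)) + cubeLp p (pull A κ (w 0)) :=
        cubeLp_add_le hp (m1.sub m0) m0
    _ ≤ ε := by
        rw [hc, add_zero]
        refine (le_surfaceNorm (cubeLp p) κ (w r - w 0)).trans (hball ?_ hrT)
        rw [Real.dist_eq, sub_zero, abs_of_nonneg hrT.1]
        exact hrδ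

end Representation

/-! ### Continuous representatives on the surface -/

section Gluing

variable {m : ℕ} {S : Set (Euc (m + 1))} {ι : Type*} {A : NormalizedAtlas m S ι}
  {p T : ℝ} {v w : ℝ → S → ℝ}

/-- Continuity in space upgrades the identity to every point of `V` for almost every time;
continuity in time at each fixed point then removes the exceptional times. -/
theorem eq_of_ae_ae_eq (hT : 0 < T) {V : Set (Euc m)} (hV : IsOpen V) {F G : ℝ × Euc m → ℝ}
    (hF : ContinuousOn F (Icc 0 T ×ˢ V)) (hG : ContinuousOn G (Icc 0 T ×ˢ V))
    (h : ∀ᵐ t ∂(timeMeasure T), ∀ᵐ y ∂(volume.restrict V), F (t, y) = G (t, y)) :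
    ∀ t ∈ Icc 0 T, ∀ y ∈ V, F (t, y) = G (t, y) := by
  have h1 : ∀ᵐ t ∂(timeMeasure T), ∀ y ∈ V, F (t, y) = G (t, y) := by
    filter_upwards [h, ae_timeMeasure_mem T] with t ht htT
    have c : ContinuousOn (fun y : Euc m => (t, y)) V := by fun_prop
    have hm : MapsTo (fun y : Euc m => (t, y)) V (Icc 0 T ×ˢ V) := fun y hy => ⟨htT, hy⟩
    exact Measure.eqOn_open_of_ae_eq ht hV (hF.comp c hm) (hG.comp c hm)
  intro t ht y hy
  have c : ContinuousOn (fun t : ℝ => (t, y)) (Icc 0 T) := by fun_prop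
  have hm : MapsTo (fun t : ℝ => (t, y)) (Icc 0 T) (Icc 0 T ×ˢ V) := fun t ht => ⟨ht, hy⟩
  exact Measure.eqOn_Icc_of_ae_eq volume hT.ne (h1.mono fun t ht => ht y hy)
    (hF.comp c hm) (hG.comp c hm) ht

theorem chart_mem_cube {κ : ι} {x : S} (hx : x ∈ (A.chart κ).source) : A.chart κ x ∈ cube m := by
  rw [← A.target_eq κ]
  exact (A.chart κ).map_source hx

/-- Transition maps pull back null sets to null sets. -/
theorem ae_transition (κ κ' : ι) {P : Euc m → Prop} (h : ∀ᵐ y ∂(cubeMeasure m), P y) :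
    ∀ᵐ y ∂(volume.restrict ((A.chart κ).symm.trans (A.chart κ')).source),
      P ((A.chart κ).symm.trans (A.chart κ') y) := by
  set e := (A.chart κ).symm.trans (A.chart κ') with he
  rw [cubeMeasure, ae_restrict_iff' (measurableSet_cube m)] at h
  rw [ae_restrict_iff' e.open_source.measurableSet]
  set N := {y | ¬ (y ∈ cube m → P y)}
  have hN : volume (N ∩ e.target) = 0 := measure_mono_null inter_subset_left h
  -- The preimage of a null set under the transition is its image under the inverse transition,
  -- which is differentiable and so preserves null sets.
  have hd : DifferentiableOn ℝ e.symm (N ∩ e.target) := by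
    have h1 : e.symm = (A.chart κ').symm.trans (A.chart κ) := by
      rw [he, OpenPartialHomeomorph.trans_symm_eq_symm_trans_symm, OpenPartialHomeomorph.symm_symm]
    have h2 : AnalyticOnNhd ℝ e.symm e.symm.source := by
      rw [h1]; exact A.transition_analytic κ' κ
    exact h2.differentiableOn.mono inter_subset_right
  refine measure_mono_null (fun y hy => ?_)
    (addHaar_image_eq_zero_of_differentiableOn_of_addHaar_eq_zero volume hd hN)
  simp only [mem_compl_iff, mem_ofPred_eq, Classical.not_imp] at hy
  have hm : e y ∈ cube m := by
    rw [← A.target_eq κ']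
    exact (A.chart κ').map_source (by have := hy.1; rw [he] at this; exact this.2)
  exact ⟨e y, ⟨fun hc => hy.2 (hc hm), e.map_source hy.1⟩, e.left_inv hy.1⟩

/-- On the overlap both local functions represent `v` almost everywhere, the second one after
composition with the transition map. Continuity turns this into equality everywhere. -/
theorem chart_consistent (hT : 0 < T) {G : ι → ℝ × Euc m → ℝ}
    (hG : ∀ κ, ContinuousOn (G κ) (Icc 0 T ×ˢ cube m))
    (h : ∀ κ, ∀ᵐ t ∂(timeMeasure T), ∀ᵐ y ∂(cubeMeasure m), G κ (t, y) = pull A κ (v t) y)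
    {κ κ' : ι} {t : ℝ} (ht : t ∈ Icc 0 T) {x : S} (hx : x ∈ (A.chart κ).source)
    (hx' : x ∈ (A.chart κ').source) : G κ (t, A.chart κ x) = G κ' (t, A.chart κ' x) := by
  set e := (A.chart κ).symm.trans (A.chart κ') with he
  have hsub : e.source ⊆ cube m := fun y hy => by rw [← A.target_eq κ]; exact hy.1
  have hmaps : ∀ y ∈ e.source, e y ∈ cube m := fun y hy => by
    rw [← A.target_eq κ']; exact (A.chart κ').map_source hy.2
  have hc : ContinuousOn (fun z : ℝ × Euc m => G κ' (z.1, e z.2)) (Icc 0 T ×ˢ e.source) := by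
    refine (hG κ').comp (continuousOn_fst.prodMk (e.continuousOn.comp continuousOn_snd
      fun z hz => hz.2)) fun z hz => ⟨hz.1, hmaps _ hz.2⟩
  have key := eq_of_ae_ae_eq hT e.open_source
    ((hG κ).mono (prod_mono_right hsub)) hc (by
      filter_upwards [h κ, h κ'] with t h1 h2
      have h1' : ∀ᵐ y ∂(volume.restrict e.source), G κ (t, y) = pull A κ (v t) y :=
        ae_restrict_of_ae_restrict_of_subset hsub h1
      filter_upwards [h1', ae_transition κ κ' h2, ae_restrict_mem e.open_source.measurableSet]
        with y hy1 hy2 hy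
      rw [hy1, hy2]
      have : (A.chart κ').symm (e y) = (A.chart κ).symm y := (A.chart κ').left_inv hy.2
      rw [pull, pull, this])
  have hxm : A.chart κ x ∈ e.source :=
    ⟨(A.chart κ).map_source hx, by
      change (A.chart κ).symm (A.chart κ x) ∈ (A.chart κ').source
      rw [(A.chart κ).left_inv hx]
      exact hx'⟩
  have := key t ht _ hxm
  rw [this]
  change G κ' (t, A.chart κ' ((A.chart κ).symm (A.chart κ x))) = _
  rw [(A.chart κ).left_inv hx]

/-- At each point an arbitrary chart is chosen. Consistency on overlaps lets a single chart be used
in a whole neighbourhood, so the discontinuous choice does no harm. -/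
theorem exists_isContRep (hT : 0 < T) {f : ι → ℝ → Euc m → ℝ} (hf : ∀ κ, IsRep A T κ v (f κ))
    (h : ∀ κ, ∃ G : ℝ × Euc m → ℝ, ContinuousOn G (Icc 0 T ×ˢ cube m) ∧
      ∀ᵐ z ∂((timeMeasure T).prod (cubeMeasure m)), G z = f κ z.1 z.2) :
    ∃ w, IsContRep A T v w := by
  choose G hG hGf using h
  have hae : ∀ κ, ∀ᵐ z ∂((timeMeasure T).prod (cubeMeasure m)), G κ z = pull A κ (v z.1) z.2 :=
    fun κ => by
      filter_upwards [hGf κ, (hf κ).ae_eq] with z h1 h2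
      rw [h1, h2]
  choose c hc using A.covers
  have hw : ∀ κ, ∀ t ∈ Icc 0 T, ∀ x ∈ (A.chart κ).source,
      G (c x) (t, A.chart (c x) x) = G κ (t, A.chart κ x) := fun κ t ht x hx =>
    chart_consistent hT hG (fun κ => Measure.ae_ae_of_ae_prod (hae κ)) ht (hc x) hx
  refine ⟨fun t x => G (c x) (t, A.chart (c x) x), fun z hz => ?_, fun κ => ?_⟩
  · set κ := c z.2
    have hopen : IsOpen {q : ℝ × S | q.2 ∈ (A.chart κ).source} :=
      (A.chart κ).open_source.preimage continuous_snd
    have hcont : ContinuousOn (fun q : ℝ × S => G κ (q.1, A.chart κ q.2))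
        (Icc 0 T ×ˢ (A.chart κ).source) :=
      (hG κ).comp (continuousOn_fst.prodMk ((A.chart κ).continuousOn.comp continuousOn_snd
        fun q hq => hq.2)) fun q hq => ⟨hq.1, chart_mem_cube hq.2⟩
    have hz' : z ∈ Icc 0 T ×ˢ (A.chart κ).source := ⟨hz.1, hc z.2⟩
    have h1 : ContinuousWithinAt (fun q : ℝ × S => G (c q.2) (q.1, A.chart (c q.2) q.2))
        (Icc 0 T ×ˢ (A.chart κ).source) z :=
      (hcont z hz').congr (fun q hq => hw κ q.1 hq.1 q.2 hq.2) (hw κ z.1 hz'.1 z.2 hz'.2)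
    refine h1.mono_of_mem_nhdsWithin ?_
    rw [mem_nhdsWithin]
    exact ⟨_, hopen, hc z.2, fun q hq => ⟨hq.2.1, hq.1⟩⟩
  · have hmem : ∀ᵐ z ∂((timeMeasure T).prod (cubeMeasure m)), z ∈ Icc 0 T ×ˢ cube m := by
      rw [cubeMeasure, timeMeasure_prod_restrict]
      exact ae_restrict_mem (measurableSet_Icc.prod (measurableSet_cube m))
    filter_upwards [hae κ, hmem] with z hz hzm
    have hzt : z.2 ∈ (A.chart κ).target := by rw [A.target_eq]; exact hzm.2
    rw [← hz, pull, hw κ z.1 hzm.1 _ ((A.chart κ).map_target hzt), (A.chart κ).right_inv hzt]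

theorem IsContRep.mul {v' w' : ℝ → S → ℝ} (h : IsContRep A T v w) (h' : IsContRep A T v' w') :
    IsContRep A T (v * v') (w * w') := ⟨h.1.mul h'.1, h.2.mul h'.2⟩

theorem enorm_le_supNorm {t : ℝ} (ht : t ∈ Icc 0 T) (x : S) : ‖w t x‖ₑ ≤ supNorm S T w :=
  (le_iSup (fun x : S => ‖w t x‖ₑ) x).trans
    (le_iSup₂ (f := fun t (_ : t ∈ Icc (0 : ℝ) T) => ⨆ x : S, ‖w t x‖ₑ) t ht)

theorem supNorm_lt_top (hS : IsCompact S)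
    (hw : ContinuousOn (fun z : ℝ × S => w z.1 z.2) (Icc 0 T ×ˢ univ)) : supNorm S T w < ⊤ := by
  have : CompactSpace S := isCompact_iff_compactSpace.1 hS
  obtain ⟨B, hB⟩ := (isCompact_Icc.prod isCompact_univ).exists_bound_of_continuousOn hw
  refine lt_of_le_of_lt (iSup₂_le fun t ht => iSup_le fun x => ?_)
    (ENNReal.ofReal_lt_top (r := B))
  rw [← ofReal_norm]
  exact ENNReal.ofReal_le_ofReal (hB (t, x) ⟨ht, mem_univ x⟩)

theorem IsContRep.cubeSup_le (h : IsContRep A T v w) {κ : ι} {f : ℝ → Euc m → ℝ}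
    (hf : IsRep A T κ v f) : ∀ᵐ t ∂(timeMeasure T), cubeSup (f t) ≤ supNorm S T w := by
  filter_upwards [h.2.sliceEq κ, hf.eq, ae_timeMeasure_mem T] with t h1 h2 ht
  refine StefanTrace.cubeSup_le ?_
  filter_upwards [h1, h2] with x hx1 hx2
  rw [← hx2, hx1]
  exact enorm_le_supNorm ht _

theorem continuousOn_pull {u : S → ℝ} (hu : Continuous u) (κ : ι) :
    ContinuousOn (pull A κ u) (cube m) := by
  rw [← A.target_eq κ]
  exact hu.comp_continuousOn (A.chart κ).continuousOn_symm

theorem aestronglyMeasurable_pull {u : S → ℝ} (hu : Continuous u) (κ : ι) :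
    AEStronglyMeasurable (pull A κ u) (cubeMeasure m) :=
  (continuousOn_pull hu κ).aestronglyMeasurable (measurableSet_cube m)

theorem continuous_slice (hw : ContinuousOn (fun z : ℝ × S => w z.1 z.2) (Icc 0 T ×ˢ univ))
    {t : ℝ} (ht : t ∈ Icc 0 T) : Continuous (w t) := by
  rw [← continuousOn_univ]
  exact hw.comp (f := fun x : S => (t, x)) (by fun_prop) fun x hx => ⟨ht, hx⟩

theorem tendsto_slice (hS : IsCompact S)
    (hw : ContinuousOn (fun z : ℝ × S => w z.1 z.2) (Icc 0 T ×ˢ univ)) {t : ℝ}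
    (ht : t ∈ Icc 0 T) {ε : ℝ} (hε : 0 < ε) :
    ∀ᶠ r in 𝓝[Icc 0 T] t, ∀ x, ‖w r x - w t x‖ ≤ ε := by
  have : CompactSpace S := isCompact_iff_compactSpace.1 hS
  have huc := (isCompact_Icc.prod isCompact_univ).uniformContinuousOn_of_continuous hw
  obtain ⟨δ, hδ, h⟩ := Metric.uniformContinuousOn_iff.1 huc ε hε
  filter_upwards [self_mem_nhdsWithin, mem_nhdsWithin_of_mem_nhds (Metric.ball_mem_nhds t hδ)] with
    r hr hrδ x
  rw [← dist_eq_norm]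
  refine (h (r, x) ⟨hr, mem_univ x⟩ (t, x) ⟨ht, mem_univ x⟩ ?_).le
  rw [Prod.dist_eq, dist_self, max_lt_iff]
  exact ⟨hrδ, hδ⟩

theorem exists_const_surfaceLp_le [Fintype ι] (A : NormalizedAtlas m S ι) (p : ℝ) :
    ∃ K : ℝ≥0, ∀ (u : S → ℝ) (b : ℝ≥0), (∀ x, ‖u x‖ₑ ≤ b) → surfaceLp A p u ≤ b * K := by
  obtain ⟨K, hK⟩ := exists_const_cubeLp_le_of_cubeSup m p
  refine ⟨Fintype.card ι * K, fun u b hb => ?_⟩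
  calc surfaceLp A p u ≤ ∑ _κ : ι, (b * K : ℝ≥0∞) := Finset.sum_le_sum fun κ _ =>
        hK _ b (StefanTrace.cubeSup_le (Eventually.of_forall fun x => hb _))
    _ = _ := by
        simp only [Finset.sum_const, Finset.card_univ, nsmul_eq_mul]
        push_cast
        ring

theorem tendsto_surfaceLp [Fintype ι] (hS : IsCompact S)
    (hw : ContinuousOn (fun z : ℝ × S => w z.1 z.2) (Icc 0 T ×ˢ univ)) {t : ℝ}
    (ht : t ∈ Icc 0 T) :
    Tendsto (fun r => surfaceLp A p (w r - w t)) (𝓝[Icc 0 T] t) (𝓝 0) := by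
  obtain ⟨K, hK⟩ := exists_const_surfaceLp_le A p
  rw [ENNReal.tendsto_nhds_zero]
  intro ε hε
  obtain ⟨b, hb0, hb⟩ : ∃ b : ℝ≥0, 0 < b ∧ (b * K : ℝ≥0∞) ≤ ε := by
    rcases eq_or_ne ε ⊤ with rfl | hεt
    · exact ⟨1, one_pos, le_top⟩
    · lift ε to ℝ≥0 using hεt
      have hε0 : 0 < ε := by exact_mod_cast hε
      refine ⟨ε / (K + 1), by positivity, ?_⟩
      norm_cast
      rw [div_mul_eq_mul_div, div_le_iff₀ (by positivity)]
      gcongr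
      exact le_self_add
  filter_upwards [tendsto_slice hS hw ht (NNReal.coe_pos.2 hb0)] with r hr
  refine (hK _ b fun x => ?_).trans hb
  rw [← ofReal_norm, ← ENNReal.ofReal_coe_nnreal]
  exact ENNReal.ofReal_le_ofReal (hr x)

/-- Uniform continuity on the compact set `J × S` makes `w` continuous in time with values in `L_p`,
so `w` is itself the witness. -/
theorem IsContRep.zeroTrace [Fintype ι] (hS : IsCompact S) (h : IsContRep A T v w)
    (hz : surfaceLp A p (w 0) = 0) : ZeroTrace A p T v := by
  obtain ⟨K, hK⟩ := exists_const_surfaceLp_le A p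
  have hfin := supNorm_lt_top hS h.1
  refine ⟨w, fun t ht => ⟨fun κ => aestronglyMeasurable_pull (continuous_slice h.1 ht) κ, ?_⟩,
    fun t ht => tendsto_surfaceLp hS h.1 ht, h.2, hz⟩
  refine (hK (w t) (supNorm S T w).toNNReal fun x => ?_).trans_lt
    (ENNReal.mul_lt_top ENNReal.coe_lt_top ENNReal.coe_lt_top)
  rw [ENNReal.coe_toNNReal hfin.ne]
  exact enorm_le_supNorm ht x

/-- The continuous representative of a function of vanishing trace vanishes at `t = 0`. -/
theorem IsContRep.ae_eq_zero [Fintype ι] (hS : IsCompact S) (hp : 1 ≤ p) (hT : 0 < T)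
    (h : IsContRep A T v w) {κ : ι} {f : ℝ → Euc m → ℝ} (hf : IsRep A T κ v f)
    (hz : SliceZeroTrace p T f) : pull A κ (w 0) =ᵐ[cubeMeasure m] 0 := by
  have h0 : (0 : ℝ) ∈ Icc 0 T := ⟨le_rfl, hT.le⟩
  have m0 := aestronglyMeasurable_pull (A := A) (continuous_slice h.1 h0) κ
  suffices h1 : cubeLp p (pull A κ (w 0)) = 0 by
    have hp0 : ENNReal.ofReal p ≠ 0 := by simpa using by linarith
    exact (eLpNorm_eq_zero_iff m0 hp0).1 h1
  refine le_antisymm (ENNReal.le_of_forall_pos_le_add fun ε hε _ => ?_) zero_le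
  have hε2 : 0 < ε / 2 := by positivity
  obtain ⟨δ, hδ, hr⟩ := hz (ε / 2) hε2
  have hev := (tendsto_surfaceLp (A := A) (p := p) hS h.1 h0).eventually
    (Iic_mem_nhds (show (0 : ℝ≥0∞) < (ε / 2 : ℝ≥0) by exact_mod_cast hε2))
  rw [eventually_nhdsWithin_iff, Metric.eventually_nhds_iff] at hev
  obtain ⟨δ', hδ', hball⟩ := hev
  obtain ⟨r, hr0, hrδ, ⟨h1, h2⟩, h3⟩ := exists_mem_of_ae_timeMeasure
    (lt_min (lt_min hδ hδ') hT) (min_le_right _ _) (((h.2.sliceEq κ).and hf.eq).and hr)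
  have hrT : r ∈ Icc 0 T := ⟨hr0.le, (hrδ.trans_le (min_le_right _ _)).le⟩
  have hrd : r < δ := hrδ.trans_le ((min_le_left _ _).trans (min_le_left _ _))
  have hrd' : r < δ' := hrδ.trans_le ((min_le_left _ _).trans (min_le_right _ _))
  have mr := aestronglyMeasurable_pull (A := A) (continuous_slice h.1 hrT) κ
  have e1 : cubeLp p (pull A κ (w r)) ≤ (ε / 2 : ℝ≥0) := by
    rw [← cubeLp_congr h1, cubeLp_congr h2]
    exact h3 hrd
  have e2 : cubeLp p (pull A κ (w r) - pull A κ (w 0)) ≤ (ε / 2 : ℝ≥0) := by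
    refine (le_surfaceNorm (A := A) (cubeLp p) κ (w r - w 0)).trans (hball ?_ hrT)
    rw [Real.dist_eq, sub_zero, abs_of_pos hr0]
    exact hrd'
  calc cubeLp p (pull A κ (w 0)) =
        cubeLp p (pull A κ (w 0) - pull A κ (w r) + pull A κ (w r)) := by rw [sub_add_cancel]
    _ ≤ cubeLp p (pull A κ (w 0) - pull A κ (w r)) + cubeLp p (pull A κ (w r)) :=
        cubeLp_add_le hp (m0.sub mr) mr
    _ ≤ (ε / 2 : ℝ≥0) + (ε / 2 : ℝ≥0) := by
        rw [cubeLp_sub_comm]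
        gcongr
    _ = 0 + ε := by
        rw [zero_add]
        exact_mod_cast add_halves ε

end Gluing

/-! ### Products on the surface -/

section SurfaceProducts

variable {m : ℕ} {S : Set (Euc (m + 1))} {ι : Type*} [Fintype ι] {A : NormalizedAtlas m S ι}
  {p T : ℝ}

/-- The difference of the two sides is `(p - m - 3) / (2p)`. This is where `p > m + 3` enters in
full strength, as the exponent condition of the sup bounds for `s = 1 - 1 / p`. -/
theorem one_div_lt_of_lt (hp : (m : ℝ) + 3 < p) : 1 / p < (1 - 1 / p - m / p) / 2 := by
  have hp0 : 0 < p := by have : (0 : ℝ) ≤ m := by positivity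
                         linarith
  have e : (1 - 1 / p - m / p) / 2 - 1 / p = (p - (m + 3)) / (2 * p) := by
    field_simp
    ring
  have : 0 < (p - (m + 3)) / (2 * p) := by
    have : 0 < p - (m + 3) := by linarith
    positivity
  linarith

theorem MemF3.exists_isContRep {v : ℝ → S → ℝ} (h : MemF3 A p T v) (hm : 1 ≤ m)
    (hp : (m : ℝ) + 3 < p) (hT : 0 < T) {f : ι → ℝ → Euc m → ℝ} (hf : ∀ κ, IsRep A T κ v (f κ)) :
    ∃ w, IsContRep A T v w := by
  have hp1 : 1 ≤ p := by have : (0 : ℝ) ≤ m := by positivity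
                         linarith
  have hp0 : 0 < p := by linarith
  refine StefanTrace.exists_isContRep hT hf fun κ => ?_
  have hle := (cylNorm_le_normF3 hp0 (hf κ)).trans_lt h.norm_lt_top
  exact exists_continuousOn_rep hm hp1 (one_div_lt_of_lt hp) le_rfl hT (hf κ).meas
    ((tLp_cubeLp_le_cylNorm _).trans_lt hle) ((tLp_cubeSeminorm_le_cylNorm _).trans_lt hle)
    ((tSem_le_cylNorm _).trans_lt hle)

/-- The criterion of order `s` still applies: the temporal order `(1 + s) / 2` exceeds `s / 2`, and
the spatial seminorm of order `s` is controlled by the embedding. -/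
theorem MemF2.exists_isContRep {v : ℝ → S → ℝ} (h : MemF2 A p T v) (hm : 1 ≤ m)
    (hp : (m : ℝ) + 3 < p) (hT : 0 < T) {f : ι → ℝ → Euc m → ℝ} {g : ι → Fin m → ℝ → Euc m → ℝ}
    (hf : ∀ κ, IsRep A T κ v (f κ)) (hg : ∀ κ, IsCylGrad T (f κ) (g κ)) :
    ∃ w, IsContRep A T v w := by
  have hp1 : 1 ≤ p := by have : (0 : ℝ) ≤ m := by positivity
                         linarith
  have hp0 : 0 < p := by linarith
  have hpi : 0 < 1 / p := by positivity
  have hs := one_div_lt_of_lt hp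
  obtain ⟨C, hC⟩ := exists_const_tLp_cubeSeminorm_le_cylNorm1 (s := 1 - 1 / p) hm hp1 (by linarith)
    (by linarith)
  refine StefanTrace.exists_isContRep hT hf fun κ => ?_
  have hle := (cylNorm1_le_normF2 hp0 (hf κ) (hg κ)).trans_lt h.norm_lt_top
  exact exists_continuousOn_rep (θ := (1 + (1 - 1 / p)) / 2) hm hp1 hs (by linarith) hT (hf κ).meas
    ((tLp_cubeLp_le_cylNorm1 _ (g κ)).trans_lt hle)
    ((hC T _ _ (hg κ) hle).trans_lt (ENNReal.mul_lt_top ENNReal.coe_lt_top hle))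
    ((tSem_le_cylNorm1 _ (g κ)).trans_lt hle)

/-- The product of the continuous representatives vanishes almost everywhere at `t = 0` as soon as
one factor does. -/
theorem zeroTrace_mul (hS : IsCompact S) (hp : 1 ≤ p) (hT : 0 < T) {v v' w w' : ℝ → S → ℝ}
    (h : IsContRep A T v w) (h' : IsContRep A T v' w') (hz : ZeroTrace A p T v')
    {f : ι → ℝ → Euc m → ℝ} (hf : ∀ κ, IsRep A T κ v' (f κ)) : ZeroTrace A p T (v * v') := by
  refine (h.mul h').zeroTrace hS (Finset.sum_eq_zero fun κ _ => ?_)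
  have h0 := h'.ae_eq_zero hS hp hT (hf κ) (hz.sliceZeroTrace hp hT (hf κ))
  have h1 : pull A κ ((w * w') 0) =ᵐ[cubeMeasure m] 0 := by
    filter_upwards [h0] with x hx
    simp only [pull, Pi.mul_apply, Pi.zero_apply] at hx ⊢
    rw [hx, mul_zero]
  rw [cubeLp_congr h1]
  exact eLpNorm_zero

theorem normF3_mul_le (hp : 1 ≤ p) {v₁ v₂ : ℝ → S → ℝ} {f₁ f₂ : ι → ℝ → Euc m → ℝ}
    (h₁ : ∀ κ, IsRep A T κ v₁ (f₁ κ)) (h₂ : ∀ κ, IsRep A T κ v₂ (f₂ κ)) {a b : ℝ≥0}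
    (ha : ∀ κ, ∀ᵐ t ∂(timeMeasure T), cubeSup (f₁ κ t) ≤ a)
    (hb : ∀ κ, ∀ᵐ t ∂(timeMeasure T), cubeSup (f₂ κ t) ≤ b) :
    normF3 A p T (v₁ * v₂) ≤
      2 * Fintype.card ι * (a * normF3 A p T v₂ + b * normF3 A p T v₁) := by
  have hp0 : 0 < p := by linarith
  refine (normF3_le_sum hp fun κ => (h₁ κ).mul (h₂ κ)).trans ?_
  rw [mul_assoc]
  refine mul_le_mul_right ?_ 2
  calc _ ≤ ∑ _κ : ι, (a * normF3 A p T v₂ + b * normF3 A p T v₁) := by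
        refine Finset.sum_le_sum fun κ _ => (cylNorm_mul_le hp (h₁ κ).meas (h₂ κ).meas (ha κ)
          (hb κ)).trans ?_
        gcongr
        · exact cylNorm_le_normF3 hp0 (h₂ κ)
        · exact cylNorm_le_normF3 hp0 (h₁ κ)
    _ = _ := by rw [Finset.sum_const, Finset.card_univ, nsmul_eq_mul]

theorem exists_const_normF2_mul_le (hm : 1 ≤ m) (hp : (m : ℝ) + 3 < p) :
    ∃ C : ℝ≥0, ∀ (A : NormalizedAtlas m S ι) (T : ℝ) (v₁ v₂ : ℝ → S → ℝ)
      (f₁ f₂ : ι → ℝ → Euc m → ℝ) (g₁ g₂ : ι → Fin m → ℝ → Euc m → ℝ) (a b : ℝ≥0),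
      MemF2 A p T v₁ → MemF2 A p T v₂ →
      (∀ κ, IsRep A T κ v₁ (f₁ κ)) → (∀ κ, IsRep A T κ v₂ (f₂ κ)) →
      (∀ κ, IsCylGrad T (f₁ κ) (g₁ κ)) → (∀ κ, IsCylGrad T (f₂ κ) (g₂ κ)) →
      (∀ κ, ∀ᵐ t ∂(timeMeasure T), cubeSup (f₁ κ t) ≤ a) →
      (∀ κ, ∀ᵐ t ∂(timeMeasure T), cubeSup (f₂ κ t) ≤ b) →
      (∀ κ, ∀ᵐ t ∂(timeMeasure T), ∀ i, cubeSup (g₂ κ i t) ≤ b) →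
      MemF2 A p T (v₁ * v₂) ∧
      normF2 A p T (v₁ * v₂) ≤ C * (a * normF2 A p T v₂ + b * normF2 A p T v₁) := by
  have hp1 : 1 ≤ p := by have : (0 : ℝ) ≤ m := by positivity
                         linarith
  have hp0 : 0 < p := by linarith
  have hpi : 0 < 1 / p := by positivity
  have hs := one_div_lt_of_lt hp
  obtain ⟨C, hC⟩ := exists_const_cylNorm1_mul_le (s := 1 - 1 / p) hm hp1 (by linarith)
    (by linarith)
  refine ⟨Fintype.card ι * (C * 2), fun A T v₁ v₂ f₁ f₂ g₁ g₂ a b m₁ m₂ h₁ h₂ d₁ d₂ ha hb hl => ?_⟩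
  have key := fun κ => hC T _ _ _ _ a b b (d₁ κ) (d₂ κ)
    ((cylNorm1_le_normF2 hp0 (h₁ κ) (d₁ κ)).trans_lt m₁.norm_lt_top)
    ((cylNorm1_le_normF2 hp0 (h₂ κ) (d₂ κ)).trans_lt m₂.norm_lt_top) (ha κ) (hb κ) (hl κ)
  have hrep := fun κ => (h₁ κ).mul (h₂ κ)
  have est : normF2 A p T (v₁ * v₂) ≤
      (Fintype.card ι * (C * 2) : ℝ≥0) * (a * normF2 A p T v₂ + b * normF2 A p T v₁) := by
    refine (normF2_le_sum hp1 hrep fun κ => (key κ).1).trans ?_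
    calc _ ≤ ∑ _κ : ι, (C * 2 * (a * normF2 A p T v₂ + b * normF2 A p T v₁) : ℝ≥0∞) := by
          refine Finset.sum_le_sum fun κ _ => (key κ).2.trans ?_
          rw [mul_assoc (C : ℝ≥0∞) 2]
          gcongr
          have q1 := cylNorm1_le_normF2 hp0 (h₁ κ) (d₁ κ)
          have q2 := cylNorm1_le_normF2 hp0 (h₂ κ) (d₂ κ)
          calc (a * cylNorm1 p (1 - 1 / p) T (f₂ κ) (g₂ κ) +
                (b + b) * cylNorm1 p (1 - 1 / p) T (f₁ κ) (g₁ κ) : ℝ≥0∞)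
              ≤ a * normF2 A p T v₂ + (b + b) * normF2 A p T v₁ := by gcongr
            _ ≤ (a * normF2 A p T v₂ + (b + b) * normF2 A p T v₁) + a * normF2 A p T v₂ :=
              le_self_add
            _ = _ := by ring
      _ = _ := by
          rw [Finset.sum_const, Finset.card_univ, nsmul_eq_mul]
          push_cast
          ring
  refine ⟨memF2_of_isRep (m₁.meas.mul m₂.meas) hrep (fun κ => (key κ).1) (est.trans_lt ?_), est⟩
  have e1 := m₁.norm_lt_top.ne
  have e2 := m₂.norm_lt_top.ne
  finiteness

theorem exists_const_cubeSup_le_normF3 (hm : 1 ≤ m) (hp : (m : ℝ) + 3 < p) :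
    ∃ C : ℝ≥0, ∀ (A : NormalizedAtlas m S ι) (T : ℝ) (v : ℝ → S → ℝ) (κ : ι) (f : ℝ → Euc m → ℝ),
      0 < T → MemF3Zero A p T v → IsRep A T κ v f →
      ∀ᵐ t ∂(timeMeasure T), cubeSup (f t) ≤ C * normF3 A p T v := by
  have hp1 : 1 ≤ p := by have : (0 : ℝ) ≤ m := by positivity
                         linarith
  have hp0 : 0 < p := by linarith
  obtain ⟨C, hC⟩ := exists_const_cubeSup_le_cylNorm hm hp1 (one_div_lt_of_lt hp)
  refine ⟨C, fun A T v κ f hT hv hf => ?_⟩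
  have hle := cylNorm_le_normF3 hp0 hf
  filter_upwards [hC T hT f hf.meas (hle.trans_lt hv.1.norm_lt_top)
    (hv.2.sliceZeroTrace hp1 hT hf)] with t ht
  exact ht.trans (mul_le_mul_right hle _)

theorem exists_const_cubeSup_le_normF2 (hm : 1 ≤ m) (hp : (m : ℝ) + 3 < p) :
    ∃ C : ℝ≥0, ∀ (A : NormalizedAtlas m S ι) (T : ℝ) (v : ℝ → S → ℝ) (κ : ι) (f : ℝ → Euc m → ℝ)
      (g : Fin m → ℝ → Euc m → ℝ), 0 < T → MemF2Zero A p T v → IsRep A T κ v f →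
      IsCylGrad T f g → (∀ᵐ t ∂(timeMeasure T), cubeSup (f t) ≤ C * normF2 A p T v) ∧
      ∀ᵐ t ∂(timeMeasure T), ∀ i, cubeSup (g i t) ≤ C * normF2 A p T v := by
  have hp1 : 1 ≤ p := by have : (0 : ℝ) ≤ m := by positivity
                         linarith
  have hp0 : 0 < p := by linarith
  have hpi : 0 < 1 / p := by positivity
  obtain ⟨C, hC⟩ := exists_const_cubeSup_le_cylNorm1 hm hp1 (one_div_lt_of_lt hp) (by linarith)
  refine ⟨C, fun A T v κ f g hT hv hf hg => ?_⟩
  have hle := cylNorm1_le_normF2 hp0 hf hg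
  obtain ⟨h1, h2⟩ := hC T hT f g hg (hle.trans_lt hv.1.norm_lt_top)
    (hv.2.sliceZeroTrace hp1 hT hf)
  exact ⟨h1.mono fun t ht => ht.trans (mul_le_mul_right hle _),
    h2.mono fun t ht i => (ht i).trans (mul_le_mul_right hle _)⟩

/-- A factor of vanishing trace is bounded by its norm uniformly in `T`; the remaining factor is
bounded by the sup norm of its continuous representative. -/
theorem exists_const_memF3_mul (hm : 1 ≤ m) (hp : (m : ℝ) + 3 < p) (hS : IsCompact S)
    (A : NormalizedAtlas m S ι) :
    ∃ C : ℝ≥0, ∀ T : ℝ, 0 < T →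
      (∀ v₁ v₂ : ℝ → S → ℝ, MemF3 A p T v₁ → MemF3Zero A p T v₂ →
        MemF3 A p T (v₁ * v₂) ∧ ∃ w₁, IsContRep A T v₁ w₁ ∧ normF3 A p T (v₁ * v₂) ≤
          C * (supNorm S T w₁ + normF3 A p T v₁) * normF3 A p T v₂) ∧
      (∀ v₁ v₂ : ℝ → S → ℝ, MemF3Zero A p T v₁ → MemF3Zero A p T v₂ →
        MemF3Zero A p T (v₁ * v₂) ∧
        normF3 A p T (v₁ * v₂) ≤ C * normF3 A p T v₁ * normF3 A p T v₂) := by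
  have hp1 : 1 ≤ p := by have : (0 : ℝ) ≤ m := by positivity
                         linarith
  obtain ⟨C, hC⟩ := exists_const_cubeSup_le_normF3 (S := S) (ι := ι) hm hp
  refine ⟨2 * Fintype.card ι * (1 + 2 * C), fun T hT => ⟨fun v₁ v₂ h₁ h₂ => ?_,
    fun v₁ v₂ h₁ h₂ => ?_⟩⟩
  · obtain ⟨f₁, hf₁⟩ := h₁.meas.exists_isRep
    obtain ⟨f₂, hf₂⟩ := h₂.1.meas.exists_isRep
    obtain ⟨w, hw⟩ := h₁.exists_isContRep hm hp hT hf₁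
    have hwt := supNorm_lt_top hS hw.1
    have e1 := h₁.norm_lt_top
    have e2 := h₂.1.norm_lt_top
    set N₁ := normF3 A p T v₁
    set N₂ := normF3 A p T v₂
    have eb : ((C * N₂.toNNReal : ℝ≥0) : ℝ≥0∞) = C * N₂ := by
      rw [ENNReal.coe_mul, ENNReal.coe_toNNReal e2.ne]
    have ea : ((supNorm S T w).toNNReal : ℝ≥0∞) = supNorm S T w := ENNReal.coe_toNNReal hwt.ne
    have est := normF3_mul_le (a := (supNorm S T w).toNNReal) (b := C * N₂.toNNReal) hp1 hf₁ hf₂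
      (fun κ => by rw [ea]; exact hw.cubeSup_le (hf₁ κ))
      (fun κ => by rw [eb]; exact hC A T v₂ κ (f₂ κ) hT h₂ (hf₂ κ))
    rw [ea, eb] at est
    have fin : normF3 A p T (v₁ * v₂) ≤ (2 * Fintype.card ι * (1 + 2 * C) : ℝ≥0) *
        (supNorm S T w + N₁) * N₂ := by
      refine est.trans ?_
      push_cast
      -- The added terms are exactly what is missing from the expanded right-hand side, so that an
      -- algebraic identity finishes the estimate.
      calc (2 * Fintype.card ι * (supNorm S T w * N₂ + C * N₂ * N₁) : ℝ≥0∞)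
          ≤ 2 * Fintype.card ι * (supNorm S T w * N₂ + C * N₂ * N₁) + 2 * Fintype.card ι *
            (N₁ * N₂ + C * N₂ * N₁ + 2 * C * supNorm S T w * N₂) := le_self_add
        _ = _ := by ring
    refine ⟨⟨h₁.meas.mul h₂.1.meas, fin.trans_lt ?_⟩, w, hw, fin⟩
    have e1' := e1.ne
    have e2' := e2.ne
    have e3' := hwt.ne
    finiteness
  · obtain ⟨f₁, hf₁⟩ := h₁.1.meas.exists_isRep
    obtain ⟨f₂, hf₂⟩ := h₂.1.meas.exists_isRep
    obtain ⟨w₁, hw₁⟩ := h₁.1.exists_isContRep hm hp hT hf₁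
    obtain ⟨w₂, hw₂⟩ := h₂.1.exists_isContRep hm hp hT hf₂
    have e1 := h₁.1.norm_lt_top.ne
    have e2 := h₂.1.norm_lt_top.ne
    set N₁ := normF3 A p T v₁
    set N₂ := normF3 A p T v₂
    have ea : ((C * N₁.toNNReal : ℝ≥0) : ℝ≥0∞) = C * N₁ := by
      rw [ENNReal.coe_mul, ENNReal.coe_toNNReal e1]
    have eb : ((C * N₂.toNNReal : ℝ≥0) : ℝ≥0∞) = C * N₂ := by
      rw [ENNReal.coe_mul, ENNReal.coe_toNNReal e2]
    have est := normF3_mul_le (a := C * N₁.toNNReal) (b := C * N₂.toNNReal) hp1 hf₁ hf₂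
      (fun κ => by rw [ea]; exact hC A T v₁ κ (f₁ κ) hT h₁ (hf₁ κ))
      (fun κ => by rw [eb]; exact hC A T v₂ κ (f₂ κ) hT h₂ (hf₂ κ))
    rw [ea, eb] at est
    have fin : normF3 A p T (v₁ * v₂) ≤ (2 * Fintype.card ι * (1 + 2 * C) : ℝ≥0) * N₁ * N₂ := by
      refine est.trans ?_
      push_cast
      calc (2 * Fintype.card ι * (C * N₁ * N₂ + C * N₂ * N₁) : ℝ≥0∞)
          ≤ 2 * Fintype.card ι * (C * N₁ * N₂ + C * N₂ * N₁) + 2 * Fintype.card ι * (N₁ * N₂) :=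
            le_self_add
        _ = _ := by ring
    refine ⟨⟨⟨h₁.1.meas.mul h₂.1.meas, fin.trans_lt ?_⟩,
      zeroTrace_mul hS hp1 hT hw₁ hw₂ h₂.2 hf₂⟩, fin⟩
    finiteness

theorem exists_const_memF2_mul (hm : 1 ≤ m) (hp : (m : ℝ) + 3 < p) (hS : IsCompact S)
    (A : NormalizedAtlas m S ι) :
    ∃ C : ℝ≥0, ∀ T : ℝ, 0 < T →
      (∀ v₁ v₂ : ℝ → S → ℝ, MemF2 A p T v₁ → MemF2Zero A p T v₂ →
        MemF2 A p T (v₁ * v₂) ∧ ∃ w₁, IsContRep A T v₁ w₁ ∧ normF2 A p T (v₁ * v₂) ≤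
          C * (supNorm S T w₁ + normF2 A p T v₁) * normF2 A p T v₂) ∧
      (∀ v₁ v₂ : ℝ → S → ℝ, MemF2Zero A p T v₁ → MemF2Zero A p T v₂ →
        MemF2Zero A p T (v₁ * v₂) ∧
        normF2 A p T (v₁ * v₂) ≤ C * normF2 A p T v₁ * normF2 A p T v₂) := by
  have hp1 : 1 ≤ p := by have : (0 : ℝ) ≤ m := by positivity
                         linarith
  obtain ⟨C, hC⟩ := exists_const_cubeSup_le_normF2 (S := S) (ι := ι) hm hp
  obtain ⟨K, hK⟩ := exists_const_normF2_mul_le (S := S) (ι := ι) hm hp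
  refine ⟨K * (1 + 2 * C), fun T hT => ⟨fun v₁ v₂ h₁ h₂ => ?_, fun v₁ v₂ h₁ h₂ => ?_⟩⟩
  · obtain ⟨f₁, g₁, hf₁, hg₁⟩ := h₁.exists_isRep
    obtain ⟨f₂, g₂, hf₂, hg₂⟩ := h₂.1.exists_isRep
    obtain ⟨w, hw⟩ := h₁.exists_isContRep hm hp hT hf₁ hg₁
    have hwt := supNorm_lt_top hS hw.1
    have e2 := h₂.1.norm_lt_top
    set N₁ := normF2 A p T v₁
    set N₂ := normF2 A p T v₂
    have eb : ((C * N₂.toNNReal : ℝ≥0) : ℝ≥0∞) = C * N₂ := by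
      rw [ENNReal.coe_mul, ENNReal.coe_toNNReal e2.ne]
    have ea : ((supNorm S T w).toNNReal : ℝ≥0∞) = supNorm S T w := ENNReal.coe_toNNReal hwt.ne
    obtain ⟨hmem, est⟩ := hK A T v₁ v₂ f₁ f₂ g₁ g₂ (supNorm S T w).toNNReal (C * N₂.toNNReal)
      h₁ h₂.1 hf₁ hf₂ hg₁ hg₂ (fun κ => by rw [ea]; exact hw.cubeSup_le (hf₁ κ))
      (fun κ => by rw [eb]; exact (hC A T v₂ κ (f₂ κ) (g₂ κ) hT h₂ (hf₂ κ) (hg₂ κ)).1)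
      (fun κ => by rw [eb]; exact (hC A T v₂ κ (f₂ κ) (g₂ κ) hT h₂ (hf₂ κ) (hg₂ κ)).2)
    rw [ea, eb] at est
    refine ⟨hmem, w, hw, est.trans ?_⟩
    push_cast
    calc (K * (supNorm S T w * N₂ + C * N₂ * N₁) : ℝ≥0∞)
        ≤ K * (supNorm S T w * N₂ + C * N₂ * N₁) + K *
          (N₁ * N₂ + C * N₂ * N₁ + 2 * C * supNorm S T w * N₂) := le_self_add
      _ = _ := by ring
  · obtain ⟨f₁, g₁, hf₁, hg₁⟩ := h₁.1.exists_isRep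
    obtain ⟨f₂, g₂, hf₂, hg₂⟩ := h₂.1.exists_isRep
    obtain ⟨w₁, hw₁⟩ := h₁.1.exists_isContRep hm hp hT hf₁ hg₁
    obtain ⟨w₂, hw₂⟩ := h₂.1.exists_isContRep hm hp hT hf₂ hg₂
    have e1 := h₁.1.norm_lt_top.ne
    have e2 := h₂.1.norm_lt_top.ne
    set N₁ := normF2 A p T v₁
    set N₂ := normF2 A p T v₂
    have ea : ((C * N₁.toNNReal : ℝ≥0) : ℝ≥0∞) = C * N₁ := by
      rw [ENNReal.coe_mul, ENNReal.coe_toNNReal e1]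
    have eb : ((C * N₂.toNNReal : ℝ≥0) : ℝ≥0∞) = C * N₂ := by
      rw [ENNReal.coe_mul, ENNReal.coe_toNNReal e2]
    obtain ⟨hmem, est⟩ := hK A T v₁ v₂ f₁ f₂ g₁ g₂ (C * N₁.toNNReal) (C * N₂.toNNReal)
      h₁.1 h₂.1 hf₁ hf₂ hg₁ hg₂
      (fun κ => by rw [ea]; exact (hC A T v₁ κ (f₁ κ) (g₁ κ) hT h₁ (hf₁ κ) (hg₁ κ)).1)
      (fun κ => by rw [eb]; exact (hC A T v₂ κ (f₂ κ) (g₂ κ) hT h₂ (hf₂ κ) (hg₂ κ)).1)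
      (fun κ => by rw [eb]; exact (hC A T v₂ κ (f₂ κ) (g₂ κ) hT h₂ (hf₂ κ) (hg₂ κ)).2)
    rw [ea, eb] at est
    refine ⟨⟨hmem, zeroTrace_mul hS hp1 hT hw₁ hw₂ h₂.2 hf₂⟩, est.trans ?_⟩
    push_cast
    calc (K * (C * N₁ * N₂ + C * N₂ * N₁) : ℝ≥0∞)
        ≤ K * (C * N₁ * N₂ + C * N₂ * N₁) + K * (N₁ * N₂) := le_self_add
      _ = _ := by ring

/-- The mixed estimate on each cylinder, summed over charts. No sup norm of `v₁` appears and no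
continuous representative is needed, hence compactness of the surface plays no role. -/
theorem exists_const_memF3_mul_memF2 (hm : 1 ≤ m) (hp : (m : ℝ) + 3 < p)
    (A : NormalizedAtlas m S ι) :
    ∃ C : ℝ≥0, ∀ T : ℝ, 0 < T → ∀ v₁ v₂ : ℝ → S → ℝ, MemF3 A p T v₁ → MemF2Zero A p T v₂ →
      MemF3 A p T (v₁ * v₂) ∧
      normF3 A p T (v₁ * v₂) ≤ C * normF3 A p T v₁ * normF2 A p T v₂ := by
  have hp1 : 1 ≤ p := by have : (0 : ℝ) ≤ m := by positivity
                         linarith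
  have hp0 : 0 < p := by linarith
  have hpi : 0 < 1 / p := by positivity
  obtain ⟨C, hC⟩ := exists_const_cylNorm_mul_le hm hp1 (one_div_lt_of_lt hp) (by linarith)
  refine ⟨2 * Fintype.card ι * C, fun T hT v₁ v₂ h₁ h₂ => ?_⟩
  obtain ⟨f₁, hf₁⟩ := h₁.meas.exists_isRep
  obtain ⟨f₂, g₂, hf₂, hg₂⟩ := h₂.1.exists_isRep
  have q1 := fun κ => cylNorm_le_normF3 hp0 (hf₁ κ)
  have q2 := fun κ => cylNorm1_le_normF2 hp0 (hf₂ κ) (hg₂ κ)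
  have e1 := h₁.norm_lt_top
  have e2 := h₂.1.norm_lt_top
  have fin : normF3 A p T (v₁ * v₂) ≤
      (2 * Fintype.card ι * C : ℝ≥0) * normF3 A p T v₁ * normF2 A p T v₂ := by
    refine (normF3_le_sum hp1 fun κ => (hf₁ κ).mul (hf₂ κ)).trans ?_
    calc _ ≤ 2 * ∑ _κ : ι, (C * normF3 A p T v₁ * normF2 A p T v₂ : ℝ≥0∞) := by
          gcongr with κ
          refine (hC T hT (f₁ κ) (f₂ κ) (g₂ κ) (hf₁ κ).meas ((q1 κ).trans_lt e1) (hg₂ κ)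
            ((q2 κ).trans_lt e2) (h₂.2.sliceZeroTrace hp1 hT (hf₂ κ))).trans ?_
          gcongr
          · exact q1 κ
          · exact q2 κ
      _ = _ := by
          rw [Finset.sum_const, Finset.card_univ, nsmul_eq_mul]
          push_cast
          ring
  refine ⟨⟨h₁.meas.mul h₂.1.meas, fin.trans_lt ?_⟩, fin⟩
  have e1' := e1.ne
  have e2' := e2.ne
  finiteness

end SurfaceProducts

end

end StefanTrace

theorem mainTheorem6 (m : ℕ) (hm : 1 ≤ m) (p : ℝ) (hp : (m : ℝ) + 3 < p)
    (S : Set (StefanTrace.Euc (m + 1))) (hS : IsCompact S)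
    {ι : Type*} [Fintype ι] (A : StefanTrace.NormalizedAtlas m S ι) :
    ∃ C₀ : ℝ≥0, ∀ T : ℝ, 0 < T →
      -- (a)
      ((∀ v₁ v₂ : ℝ → S → ℝ, StefanTrace.MemF2 A p T v₁ → StefanTrace.MemF2Zero A p T v₂ →
          StefanTrace.MemF2 A p T (v₁ * v₂) ∧
          ∃ w₁, StefanTrace.IsContRep A T v₁ w₁ ∧
            StefanTrace.normF2 A p T (v₁ * v₂) ≤
              C₀ * (StefanTrace.supNorm S T w₁ + StefanTrace.normF2 A p T v₁) *
                StefanTrace.normF2 A p T v₂) ∧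
        (∀ v₁ v₂ : ℝ → S → ℝ, StefanTrace.MemF3 A p T v₁ → StefanTrace.MemF3Zero A p T v₂ →
          StefanTrace.MemF3 A p T (v₁ * v₂) ∧
          ∃ w₁, StefanTrace.IsContRep A T v₁ w₁ ∧
            StefanTrace.normF3 A p T (v₁ * v₂) ≤
              C₀ * (StefanTrace.supNorm S T w₁ + StefanTrace.normF3 A p T v₁) *
                StefanTrace.normF3 A p T v₂)) ∧
      -- (b)
      ((∀ v₁ v₂ : ℝ → S → ℝ, StefanTrace.MemF2Zero A p T v₁ → StefanTrace.MemF2Zero A p T v₂ →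
          StefanTrace.MemF2Zero A p T (v₁ * v₂) ∧
          StefanTrace.normF2 A p T (v₁ * v₂) ≤
            C₀ * StefanTrace.normF2 A p T v₁ * StefanTrace.normF2 A p T v₂) ∧
        (∀ v₁ v₂ : ℝ → S → ℝ, StefanTrace.MemF3Zero A p T v₁ → StefanTrace.MemF3Zero A p T v₂ →
          StefanTrace.MemF3Zero A p T (v₁ * v₂) ∧
          StefanTrace.normF3 A p T (v₁ * v₂) ≤
            C₀ * StefanTrace.normF3 A p T v₁ * StefanTrace.normF3 A p T v₂)) ∧
      -- (c)
      (∀ v₁ v₂ : ℝ → S → ℝ, StefanTrace.MemF3 A p T v₁ → StefanTrace.MemF2Zero A p T v₂ →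
        StefanTrace.MemF3 A p T (v₁ * v₂) ∧
        StefanTrace.normF3 A p T (v₁ * v₂) ≤
          C₀ * StefanTrace.normF3 A p T v₁ * StefanTrace.normF2 A p T v₂) := by
  obtain ⟨C₂, h₂⟩ := StefanTrace.exists_const_memF2_mul hm hp hS A
  obtain ⟨C₃, h₃⟩ := StefanTrace.exists_const_memF3_mul hm hp hS A
  obtain ⟨C, h⟩ := StefanTrace.exists_const_memF3_mul_memF2 hm hp A
  have i₂ : (C₂ : ℝ≥0∞) ≤ (C₂ + C₃ + C : ℝ≥0) := by
    rw [add_assoc]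
    exact_mod_cast le_self_add
  have i₃ : (C₃ : ℝ≥0∞) ≤ (C₂ + C₃ + C : ℝ≥0) := by
    rw [add_comm C₂, add_assoc]
    exact_mod_cast le_self_add
  have i : (C : ℝ≥0∞) ≤ (C₂ + C₃ + C : ℝ≥0) := by exact_mod_cast le_add_self
  -- The sum dominates the constants of the separate estimates, all chosen before `T`.
  refine ⟨C₂ + C₃ + C, fun T hT => ⟨⟨fun v₁ v₂ m₁ m₂ => ?_, fun v₁ v₂ m₁ m₂ => ?_⟩,
    ⟨fun v₁ v₂ m₁ m₂ => ?_, fun v₁ v₂ m₁ m₂ => ?_⟩, fun v₁ v₂ m₁ m₂ => ?_⟩⟩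
  · obtain ⟨hmem, w, hw, est⟩ := (h₂ T hT).1 v₁ v₂ m₁ m₂
    exact ⟨hmem, w, hw, est.trans (by gcongr)⟩
  · obtain ⟨hmem, w, hw, est⟩ := (h₃ T hT).1 v₁ v₂ m₁ m₂
    exact ⟨hmem, w, hw, est.trans (by gcongr)⟩
  · obtain ⟨hmem, est⟩ := (h₂ T hT).2 v₁ v₂ m₁ m₂
    exact ⟨hmem, est.trans (by gcongr)⟩
  · obtain ⟨hmem, est⟩ := (h₃ T hT).2 v₁ v₂ m₁ m₂
    exact ⟨hmem, est.trans (by gcongr)⟩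
  · obtain ⟨hmem, est⟩ := h T hT v₁ v₂ m₁ m₂
    exact ⟨hmem, est.trans (by gcongr)⟩
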